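/- **Setting.** There are $n\ge 1$ jobs $J_1,\dots,J_n$ with integer release dates $r_j$ and deadlines $d_j$, $0\le r_j<d_j$, $\min_j r_j=0$, indexed so that $d_1\le\dots\le d_n$, all with the same integer work $p\ge1$. A single processor can run at any non-negative speed $v(\tau)$ at time $\tau$ and consumes power $v(\tau)^\alpha$, where $\alpha>1$; a budget $E\ge0$ of energy is given. In a non-preemptive schedule each job of a set $S$ is executed in one time interval contained in $[r_j,d_j)$, in which exactly $p$ units of work are done; the intervals are disjoint; the energy is $\int v(\tau)^\alpha\,d\tau$. The optimal throughput is the largest $|S|$ of a schedule with energy at most $E$ (the problem $1|r_j,p_j=p,E|\sum U_j$). Let $d_{\max}=\max_j d_j$ and $J(k,s,t)=\{J_j : j\le k,\ s\le r_j<t\}$, and let $E_k(s,x,t,u)\in[0,\infty]$ be the minimum energy of a non-preemptive schedule of some $S\subseteq J(k,s,t)$ with $|S|=u$, with all jobs executed in $[s,t]$ and the processor idle in $[s,x)$ ($\infty$ if there is none). **Candidate sets.** $\Omega=\{r_j\}\cup\{d_j\}$, $\Theta=\{a+h\frac{b-a}{i} : a,b\in\Omega,\ 1\le i\le n,\ 0\le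 h\le i\}$, and $\Gamma(s)=\{a+(h+1)\frac{b-a}{i} : a,b\in\Omega,\ 1\le i\le n,\ 0\le h\le i,\ s=a+h\frac{b-a}{i}\}$; $|\Gamma|=\max_{s\in\Theta}|\Gamma(s)|$. **Dynamic program.** Let $D_0(s,x,t,0)=0$, $D_0(s,x,t,u)=\infty$ for $u>0$, and let $D_k(s,x,t,u)$ be the minimum of $D_{k-1}(s,x,t,u)$ and of $$D_{k-1}(s,x,s',\ell)+D_{k-1}(s',x',t,u-\ell-1)+\frac{p^\alpha}{(x'-s')^{\alpha-1}}$$ over all $s'\in\Theta$, $x'\in\Gamma(s')$, $0\le\ell\le u-1$ with $s\le r_k\le s'$, $x\le s'<x'\le t$ and $x'\le d_k$. The table consists of the values with $0\le k,u\le n$, $s,t\in\Theta$, $x\in\Gamma(s)$. **Theorem.** $|\Theta|=O(n^4)$ and $|\Gamma|=O(n^3)$; $D_n(0,0,d_{\max},u)=E_n(0,0,d_{\max},u)$ for all $0\le u\le n$; and there is one real-RAM program, the same for all instances, which on input $n,p,E,\alpha,(r_j),(d_j)$ fills in the whole table and outputs $\max\{u\le n : D_n(0,0,d_{\max},u)\le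 E\}$, which is the optimal throughput. It uses $O(|\Gamma|^2|\Theta|^3n^3)$ steps, which is $O(n^{21})$, on a machine with $O(n^{13})$ memory cells and with integers bounded by $O(n^{13})$. All constants are absolute; in particular the number of steps is bounded by a polynomial in $n$ alone (the algorithm is strongly polynomial). Here the real RAM has integer and real registers and an integer and a real memory addressed by integers; at unit cost it performs $+$, truncated $-$ and $\times$ on integers, $+,-,\times,\div$ and powers with positive base on reals, conversion of an integer to a real, comparisons, and register and memory accesses; it has no operation that converts reals to integers. -/

import Mathlib

open scoped NNReal ENNReal

noncomputable section

namespace SpeedScaling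

/-! ## The scheduling problem `1 | r_j, p_j = p, E | ∑ U_j` with speed scaling -/

/-- An instance. Jobs are indexed by `Fin n`, in non-decreasing order of deadlines; job `j` of the
code is the job `J_{j+1}` of the usual 1-based numbering. Times and the common work are integers,
and the earliest release date is `0` (in particular there is at least one job). -/
structure Instance where
  /-- number of jobs -/
  n : ℕ
  /-- release dates -/
  r : Fin n → ℕ
  /-- deadlines -/
  d : Fin n → ℕ
  /-- common processing requirement -/
  p : ℕ
  /-- exponent of the power function `speed ^ α` -/
  α : ℝ
  /-- energy budget -/
  E : ℝ
  p_pos : 0 < p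
  one_lt_α : 1 < α
  E_nonneg : 0 ≤ E
  r_lt_d : ∀ j, r j < d j
  d_mono : Monotone d
  exists_r_eq_zero : ∃ j, r j = 0

/-- A non-preemptive schedule that completes every job of `S` on time. The processor has a
(measurable) speed function; job `j ∈ S` occupies the single time interval `[start j, finish j)`,
contained in `[r_j, d_j)`, in which the processor executes exactly `p` units of work; the intervals
of different jobs are disjoint. -/
structure Schedule (I : Instance) (S : Finset (Fin I.n)) where
  speed : ℝ → ℝ≥0
  measurable_speed : Measurable speed
  start : Fin I.n → ℝ
  finish : Fin I.n → ℝ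
  release_le : ∀ j ∈ S, (I.r j : ℝ) ≤ start j
  le_deadline : ∀ j ∈ S, finish j ≤ (I.d j : ℝ)
  work : ∀ j ∈ S, ∫⁻ τ in Set.Ico (start j) (finish j), (speed τ : ℝ≥0∞) = (I.p : ℝ≥0∞)
  disjoint : ∀ i ∈ S, ∀ j ∈ S, i ≠ j →
    Disjoint (Set.Ico (start i) (finish i)) (Set.Ico (start j) (finish j))

/-- Energy consumption `∫ speed(τ)^α dτ` of a schedule. -/
def Schedule.energy {I : Instance} {S : Finset (Fin I.n)} (σ : Schedule I S) : ℝ≥0∞ :=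
  ∫⁻ τ, (σ.speed τ : ℝ≥0∞) ^ I.α

/-- The throughputs `|S|` of the schedules whose energy does not exceed the budget. -/
def throughputs (I : Instance) : Set ℕ :=
  {u | ∃ (S : Finset (Fin I.n)) (σ : Schedule I S),
    σ.energy ≤ ENNReal.ofReal I.E ∧ S.card = u}

/-- `J(k,s,t)`: the jobs among the first `k` ones released in `[s,t)`. -/
def Instance.jobs (I : Instance) (k : ℕ) (s t : ℝ) : Set (Fin I.n) :=
  {j | (j : ℕ) < k ∧ s ≤ (I.r j : ℝ) ∧ (I.r j : ℝ) < t}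

/-- `E_k(s,x,t,u)`: the minimum energy of a non-preemptive `S`-schedule with `S ⊆ J(k,s,t)`,
`|S| = u`, all jobs of `S` executed entirely in `[s,t]`, and the processor idle in `[s,x)`;
it is `∞` if there is none. -/
def minEnergy (I : Instance) (k : ℕ) (s x t : ℝ) (u : ℕ) : ℝ≥0∞ :=
  sInf {e | ∃ (S : Finset (Fin I.n)) (σ : Schedule I S),
    (∀ j ∈ S, j ∈ I.jobs k s t) ∧ S.card = u ∧
    (∀ j ∈ S, s ≤ σ.start j ∧ σ.finish j ≤ t) ∧
    (∀ τ ∈ Set.Ico s x, σ.speed τ = 0) ∧ e = σ.energy}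

/-- The latest deadline. -/
def Instance.dmax (I : Instance) : ℝ := ((Finset.univ.sup I.d : ℕ) : ℝ)

/-! ## Candidate dates -/

/-- `Ω`: all release dates and deadlines. -/
def Omega (I : Instance) : Finset ℝ :=
  (Finset.univ.image fun j => (I.r j : ℝ)) ∪ (Finset.univ.image fun j => (I.d j : ℝ))

/-- The date `a + h (b - a) / i`. -/
def gridPoint (a b : ℝ) (i h : ℕ) : ℝ := a + (h : ℝ) * ((b - a) / (i : ℝ))

/-- `Θ_{a,b} = {a + h (b - a) / i | 1 ≤ i ≤ n, 0 ≤ h ≤ i}`. -/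
def ThetaOf (I : Instance) (a b : ℝ) : Finset ℝ :=
  (Finset.Icc 1 I.n).biUnion fun i => (Finset.range (i + 1)).image fun h => gridPoint a b i h

/-- `Θ = ⋃_{a,b ∈ Ω} Θ_{a,b}`. -/
def Theta (I : Instance) : Finset ℝ :=
  (Omega I).biUnion fun a => (Omega I).biUnion fun b => ThetaOf I a b

/-- `Γ(s) = {a + (h+1) (b-a)/i | a, b ∈ Ω, 1 ≤ i ≤ n, 0 ≤ h ≤ i, s = a + h (b-a)/i}`. -/
def Gamma (I : Instance) (s : ℝ) : Finset ℝ :=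
  (Omega I).biUnion fun a => (Omega I).biUnion fun b => (Finset.Icc 1 I.n).biUnion fun i =>
    ((Finset.range (i + 1)).filter fun h => s = gridPoint a b i h).image
      fun h => gridPoint a b i (h + 1)

/-- `|Γ| = max_{s ∈ Θ} |Γ(s)|`. -/
def gammaCard (I : Instance) : ℕ := (Theta I).sup fun s => (Gamma I s).card

/-! ## The dynamic program -/

/-- The value computed by the dynamic program for the state `(k,s,x,t,u)`. The job that the step
from `k` to `k + 1` adds is the `(k+1)`-st one, of index `k`; it may be executed in `[s',x')`
with `s' ∈ Θ`, `x' ∈ Γ(s')`, at constant speed. -/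
def dpValue (I : Instance) : ℕ → ℝ → ℝ → ℝ → ℕ → ℝ≥0∞
  | 0, _, _, _, u => if u = 0 then 0 else ⊤
  | k + 1, s, x, t, u =>
      min (dpValue I k s x t u)
        (⨅ (j : Fin I.n) (_ : (j : ℕ) = k) (s' ∈ Theta I) (x' ∈ Gamma I s')
          (_ : s ≤ (I.r j : ℝ) ∧ (I.r j : ℝ) ≤ s' ∧ x ≤ s' ∧ s' < x' ∧ x' ≤ t ∧
            x' ≤ (I.d j : ℝ))
          (l ∈ Finset.range u),
          dpValue I k s x s' l + dpValue I k s' x' t (u - l - 1) +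
            ENNReal.ofReal ((I.p : ℝ) ^ I.α / (x' - s') ^ (I.α - 1)))

/-- The states `(k,s,x,t,u)` of the dynamic program. -/
def dpStates (I : Instance) : Set (ℕ × ℝ × ℝ × ℝ × ℕ) :=
  {q | q.1 ≤ I.n ∧ q.2.1 ∈ Theta I ∧ q.2.2.1 ∈ Gamma I q.2.1 ∧ q.2.2.2.1 ∈ Theta I ∧
    q.2.2.2.2 ≤ I.n}

/-- The real number that represents an energy in memory; `∞` is represented by `-1`. -/
def encode (v : ℝ≥0∞) : ℝ := if v = ⊤ then -1 else v.toReal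

end SpeedScaling

/-! ## The machine model: a real RAM

The machine has integer registers, real registers, an integer memory and a real memory, both
addressed by integers. It is programmed in a structured language; each arithmetic operation,
comparison, register or memory access and control step costs one unit. The machine of size `M` has
`M` cells in each memory and its integers range over `0, …, M`; a program that leaves these
ranges, divides by zero, or takes a power of a non-positive base has no execution. No operation
turns a real number into an integer. -/

namespace RealRAM

/-- Contents of registers and memories. -/
structure State where
  ireg : ℕ → ℕ
  rreg : ℕ → ℝ
  imem : ℕ → ℕ
  rmem : ℕ → ℝ

/-- Integer expressions. -/
inductive IExp where
  | const (c : ℕ)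
  | reg (r : ℕ)
  | load (addr : IExp)
  | add (e₁ e₂ : IExp)
  | sub (e₁ e₂ : IExp)
  | mul (e₁ e₂ : IExp)

/-- Number of elementary operations in an integer expression. -/
def IExp.cost : IExp → ℕ
  | const _ => 1
  | reg _ => 1
  | load e => e.cost + 1
  | add e₁ e₂ => e₁.cost + e₂.cost + 1
  | sub e₁ e₂ => e₁.cost + e₂.cost + 1
  | mul e₁ e₂ => e₁.cost + e₂.cost + 1

/-- Value of an integer expression (subtraction is truncated at `0`). -/
def IExp.eval (σ : State) : IExp → ℕ
  | const c => c
  | reg r => σ.ireg r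
  | load e => σ.imem (e.eval σ)
  | add e₁ e₂ => e₁.eval σ + e₂.eval σ
  | sub e₁ e₂ => e₁.eval σ - e₂.eval σ
  | mul e₁ e₂ => e₁.eval σ * e₂.eval σ

/-- The evaluation stays within the machine of size `M`. -/
def IExp.Safe (M : ℕ) (σ : State) : IExp → Prop
  | const c => c ≤ M
  | reg r => σ.ireg r ≤ M
  | load e => e.Safe M σ ∧ e.eval σ < M ∧ σ.imem (e.eval σ) ≤ M
  | add e₁ e₂ => e₁.Safe M σ ∧ e₂.Safe M σ ∧ e₁.eval σ + e₂.eval σ ≤ M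
  | sub e₁ e₂ => e₁.Safe M σ ∧ e₂.Safe M σ
  | mul e₁ e₂ => e₁.Safe M σ ∧ e₂.Safe M σ ∧ e₁.eval σ * e₂.eval σ ≤ M

/-- Real expressions. -/
inductive RExp where
  | ofInt (e : IExp)
  | reg (r : ℕ)
  | load (addr : IExp)
  | add (e₁ e₂ : RExp)
  | sub (e₁ e₂ : RExp)
  | mul (e₁ e₂ : RExp)
  | div (e₁ e₂ : RExp)
  | pow (e₁ e₂ : RExp)

/-- Number of elementary operations in a real expression. -/
def RExp.cost : RExp → ℕ
  | ofInt e => e.cost + 1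
  | reg _ => 1
  | load e => e.cost + 1
  | add e₁ e₂ => e₁.cost + e₂.cost + 1
  | sub e₁ e₂ => e₁.cost + e₂.cost + 1
  | mul e₁ e₂ => e₁.cost + e₂.cost + 1
  | div e₁ e₂ => e₁.cost + e₂.cost + 1
  | pow e₁ e₂ => e₁.cost + e₂.cost + 1

/-- Value of a real expression. -/
def RExp.eval (σ : State) : RExp → ℝ
  | ofInt e => (e.eval σ : ℝ)
  | reg r => σ.rreg r
  | load e => σ.rmem (e.eval σ)
  | add e₁ e₂ => e₁.eval σ + e₂.eval σ
  | sub e₁ e₂ => e₁.eval σ - e₂.eval σ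
  | mul e₁ e₂ => e₁.eval σ * e₂.eval σ
  | div e₁ e₂ => e₁.eval σ / e₂.eval σ
  | pow e₁ e₂ => e₁.eval σ ^ e₂.eval σ

/-- The evaluation is legal on the machine of size `M`. -/
def RExp.Safe (M : ℕ) (σ : State) : RExp → Prop
  | ofInt e => e.Safe M σ
  | reg _ => True
  | load e => e.Safe M σ ∧ e.eval σ < M
  | add e₁ e₂ => e₁.Safe M σ ∧ e₂.Safe M σ
  | sub e₁ e₂ => e₁.Safe M σ ∧ e₂.Safe M σ
  | mul e₁ e₂ => e₁.Safe M σ ∧ e₂.Safe M σ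
  | div e₁ e₂ => e₁.Safe M σ ∧ e₂.Safe M σ ∧ e₂.eval σ ≠ 0
  | pow e₁ e₂ => e₁.Safe M σ ∧ e₂.Safe M σ ∧ 0 < e₁.eval σ

/-- Tests. -/
inductive BExp where
  | ile (e₁ e₂ : IExp)
  | rle (e₁ e₂ : RExp)
  | not (b : BExp)
  | and (b₁ b₂ : BExp)

/-- Number of elementary operations in a test. -/
def BExp.cost : BExp → ℕ
  | ile e₁ e₂ => e₁.cost + e₂.cost + 1
  | rle e₁ e₂ => e₁.cost + e₂.cost + 1
  | not b => b.cost + 1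
  | and b₁ b₂ => b₁.cost + b₂.cost + 1

/-- Truth of a test. -/
def BExp.Holds (σ : State) : BExp → Prop
  | ile e₁ e₂ => e₁.eval σ ≤ e₂.eval σ
  | rle e₁ e₂ => e₁.eval σ ≤ e₂.eval σ
  | not b => ¬ b.Holds σ
  | and b₁ b₂ => b₁.Holds σ ∧ b₂.Holds σ

/-- The evaluation of the test is legal on the machine of size `M`. -/
def BExp.Safe (M : ℕ) (σ : State) : BExp → Prop
  | ile e₁ e₂ => e₁.Safe M σ ∧ e₂.Safe M σ
  | rle e₁ e₂ => e₁.Safe M σ ∧ e₂.Safe M σ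
  | not b => b.Safe M σ
  | and b₁ b₂ => b₁.Safe M σ ∧ b₂.Safe M σ

/-- Programs. -/
inductive Prog where
  | skip
  | iset (r : ℕ) (e : IExp)
  | rset (r : ℕ) (e : RExp)
  | istore (addr e : IExp)
  | rstore (addr : IExp) (e : RExp)
  | seq (c₁ c₂ : Prog)
  | cond (b : BExp) (c₁ c₂ : Prog)
  | loop (b : BExp) (c : Prog)

/-- `Exec M c σ T σ'`: on the machine of size `M`, the program `c` started in `σ` halts after
exactly `T` steps in `σ'`. -/
inductive Exec (M : ℕ) : Prog → State → ℕ → State → Prop where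
  | skip (σ : State) : Exec M Prog.skip σ 1 σ
  | iset (σ : State) (r : ℕ) (e : IExp) (h : e.Safe M σ) :
      Exec M (Prog.iset r e) σ (e.cost + 1)
        { σ with ireg := Function.update σ.ireg r (e.eval σ) }
  | rset (σ : State) (r : ℕ) (e : RExp) (h : e.Safe M σ) :
      Exec M (Prog.rset r e) σ (e.cost + 1)
        { σ with rreg := Function.update σ.rreg r (e.eval σ) }
  | istore (σ : State) (a e : IExp) (ha : a.Safe M σ) (hlt : a.eval σ < M) (h : e.Safe M σ) :
      Exec M (Prog.istore a e) σ (a.cost + e.cost + 1)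
        { σ with imem := Function.update σ.imem (a.eval σ) (e.eval σ) }
  | rstore (σ : State) (a : IExp) (e : RExp) (ha : a.Safe M σ) (hlt : a.eval σ < M)
      (h : e.Safe M σ) :
      Exec M (Prog.rstore a e) σ (a.cost + e.cost + 1)
        { σ with rmem := Function.update σ.rmem (a.eval σ) (e.eval σ) }
  | seq {σ σ₁ σ₂ : State} {c₁ c₂ : Prog} {T₁ T₂ : ℕ} (h₁ : Exec M c₁ σ T₁ σ₁)
      (h₂ : Exec M c₂ σ₁ T₂ σ₂) : Exec M (Prog.seq c₁ c₂) σ (T₁ + T₂) σ₂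
  | cond_true {σ σ₁ : State} {b : BExp} {c₁ c₂ : Prog} {T : ℕ} (hs : b.Safe M σ)
      (hb : b.Holds σ) (h : Exec M c₁ σ T σ₁) :
      Exec M (Prog.cond b c₁ c₂) σ (b.cost + 1 + T) σ₁
  | cond_false {σ σ₁ : State} {b : BExp} {c₁ c₂ : Prog} {T : ℕ} (hs : b.Safe M σ)
      (hb : ¬ b.Holds σ) (h : Exec M c₂ σ T σ₁) :
      Exec M (Prog.cond b c₁ c₂) σ (b.cost + 1 + T) σ₁
  | loop_true {σ σ₁ σ₂ : State} {b : BExp} {c : Prog} {T₁ T₂ : ℕ} (hs : b.Safe M σ)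
      (hb : b.Holds σ) (h₁ : Exec M c σ T₁ σ₁) (h₂ : Exec M (Prog.loop b c) σ₁ T₂ σ₂) :
      Exec M (Prog.loop b c) σ (b.cost + 1 + T₁ + T₂) σ₂
  | loop_false {σ : State} {b : BExp} {c : Prog} (hs : b.Safe M σ) (hb : ¬ b.Holds σ) :
      Exec M (Prog.loop b c) σ (b.cost + 1) σ

end RealRAM

namespace SpeedScaling

/-- Input: integer register `0` contains `n`; real registers `0`, `1`, `2` contain `p`, `E`, `α`;
the first `2 n` cells of the real memory contain `r_1, …, r_n, d_1, …, d_n`. Everything else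
is `0`. -/
def inputState (I : Instance) : RealRAM.State where
  ireg := fun a => if a = 0 then I.n else 0
  rreg := fun a => if a = 0 then (I.p : ℝ) else if a = 1 then I.E else if a = 2 then I.α else 0
  imem := fun _ => 0
  rmem := fun a =>
    if h : a < I.n then (I.r ⟨a, h⟩ : ℝ)
    else if h : a - I.n < I.n then (I.d ⟨a - I.n, h⟩ : ℝ)
    else 0

/-- In the final state the real memory of size `M` contains the whole table of the dynamic program,
each state in its own cell. -/
def TableStored (I : Instance) (M : ℕ) (σ : RealRAM.State) : Prop :=
  ∃ addr : ℕ × ℝ × ℝ × ℝ × ℕ → ℕ, Set.InjOn addr (dpStates I) ∧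
    ∀ k s x t u, (k, s, x, t, u) ∈ dpStates I →
      addr (k, s, x, t, u) < M ∧
        σ.rmem (addr (k, s, x, t, u)) = encode (dpValue I k s x t u)

end SpeedScaling

end

/-! Correctness of the recurrence. By Hölder's inequality, `p` units of work in an interval of
length `l` cost at least `p^α / l^(α-1)`, with equality at constant speed (`slotCost_le_lintegral`).
So a schedule can be replaced by its slots, the execution intervals of its jobs, and the cost of a
slot is strictly decreasing and strictly convex in its length. For a fixed set of jobs, slots of
minimum total cost exist by compactness (`exists_optimal_slots`). In them, an endpoint outside Ω
must touch a neighbouring slot, since otherwise the slot could be lengthened, and the two slots must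
be equally long, since otherwise shifting their common boundary would save energy
(`IsOptimalSlots.length_eq`). Hence every slot belongs to a run of contiguous, equally long slots
between two dates of Ω. A run has at most `n` slots, so each slot is a cell of a candidate grid
(`IsOptimalSlots.mem_grid`).

The cost depends only on the slots, not on which job occupies which one. Giving the job of latest
deadline the latest slot it can obtain by exchanges forces every job executed after it to be
released no earlier than its start (`IsSlots.exists_rearrangement`). Cutting at this start leaves
two independent subproblems separated by their release dates, and induction bounds the dynamic
program from above by the cost of the slots (`dpValue_le_totalCost`). Conversely, a finite value is
realized by gluing two schedules around one slot run at constant speed (`exists_glued_schedule`).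

Complexity. `Runs` is a small calculus of total correctness with time bounds, in which the bounds of
nested loops multiply. Θ and the sets Γ(s) are built as duplicate-free arrays, so that loops over
them have exactly |Θ| and |Γ(s)| rounds. The table has `n + 1` layers, each of at most |Θ|²|Γ|(n+1)
entries; an entry of a layer after the first takes a minimum over at most |Θ||Γ|n choices. This
gives O(|Γ|²|Θ|³n³) steps, and |Θ| ≤ 8n⁴, |Γ| ≤ 4n³ turn it into O(n²¹). The loop invariants compare
the memory with a final memory fixed beforehand (`IsTarget`). -/

namespace SpeedScaling

/-! ### Convexity of the energy, and existence of optimal slots -/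

open MeasureTheory Set

/-- Energy needed to process one job at constant speed in an interval of length `l`. -/
noncomputable def slotCost (I : Instance) (l : ℝ) : ℝ := (I.p : ℝ) ^ I.α / l ^ (I.α - 1)

theorem slotCost_eq (I : Instance) {l : ℝ} (hl : 0 < l) :
    slotCost I l = (I.p : ℝ) ^ I.α * l ^ (-(I.α - 1)) := by
  rw [slotCost, Real.rpow_neg hl.le, div_eq_mul_inv]

theorem rpow_work_pos (I : Instance) : 0 < (I.p : ℝ) ^ I.α :=
  Real.rpow_pos_of_pos (by exact_mod_cast I.p_pos) _

theorem slotCost_pos (I : Instance) {l : ℝ} (hl : 0 < l) : 0 < slotCost I l :=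
  div_pos (rpow_work_pos I) (Real.rpow_pos_of_pos hl _)

theorem slotCost_lt (I : Instance) {l l' : ℝ} (hl : 0 < l) (h : l < l') :
    slotCost I l' < slotCost I l :=
  div_lt_div_of_pos_left (rpow_work_pos I) (Real.rpow_pos_of_pos hl _)
    (Real.rpow_lt_rpow hl.le h (by linarith [I.one_lt_α]))

theorem strictConvexOn_rpow_neg {q : ℝ} (hq : q < 0) :
    StrictConvexOn ℝ (Ioi 0) fun x : ℝ => x ^ q := by
  apply StrictMonoOn.strictConvexOn_of_deriv (convex_Ioi 0)
  · exact continuousOn_id.rpow_const fun x hx => Or.inl (ne_of_gt hx)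
  · rw [interior_Ioi]
    intro x hx y hy hxy
    rw [Real.deriv_rpow_const, Real.deriv_rpow_const]
    exact mul_lt_mul_of_neg_left (Real.rpow_lt_rpow_of_neg hx hxy (by linarith)) hq

theorem slotCost_strictConvexOn (I : Instance) : StrictConvexOn ℝ (Ioi 0) (slotCost I) := by
  have h : StrictConvexOn ℝ (Ioi 0) fun x : ℝ => x ^ (-(I.α - 1)) :=
    strictConvexOn_rpow_neg (by linarith [I.one_lt_α])
  refine ⟨convex_Ioi 0, fun x hx y hy hxy a b ha hb hab => ?_⟩
  have hz : (0 : ℝ) < a • x + b • y :=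
    (convex_Ioi (0 : ℝ)) hx hy ha.le hb.le hab
  have := mul_lt_mul_of_pos_left (h.2 hx hy hxy ha hb hab) (rpow_work_pos I)
  rw [slotCost_eq I hx, slotCost_eq I hy, slotCost_eq I hz]
  simp only [smul_eq_mul] at this ⊢
  linarith

/-- Transferring length from a longer slot to a shorter one saves energy. -/
theorem slotCost_transfer (I : Instance) {x y e : ℝ} (hx : 0 < x) (he : 0 < e) (hxy : x + e < y) :
    slotCost I (x + e) + slotCost I (y - e) < slotCost I x + slotCost I y := by
  have hc := slotCost_strictConvexOn I
  have hd : 0 < y - x := by linarith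
  -- `x + e` and `y - e` are convex combinations of `x` and `y` with mirrored weights, so adding the
  -- two strict inequalities gives the claim.
  have h1 := hc.2 (mem_Ioi.2 hx) (mem_Ioi.2 (show (0:ℝ) < y by linarith)) (by linarith)
    (show 0 < (y - x - e) / (y - x) by apply div_pos <;> linarith)
    (show 0 < e / (y - x) by positivity) (by field_simp; ring)
  have h2 := hc.2 (mem_Ioi.2 hx) (mem_Ioi.2 (show (0:ℝ) < y by linarith)) (by linarith)
    (show 0 < e / (y - x) by positivity)
    (show 0 < (y - x - e) / (y - x) by apply div_pos <;> linarith) (by field_simp; ring)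
  simp only [smul_eq_mul] at h1 h2
  have e1 : (y - x - e) / (y - x) * x + e / (y - x) * y = x + e := by field_simp; ring
  have e2 : e / (y - x) * x + (y - x - e) / (y - x) * y = y - e := by field_simp; ring
  have e3 : (y - x - e) / (y - x) = 1 - e / (y - x) := by field_simp
  rw [e1] at h1
  rw [e2] at h2
  rw [e3] at h1 h2
  linarith

/-- Hölder for `v` and the constant `1` gives `p ≤ (∫ v^α)^(1/α) · (c - a)^((α-1)/α)`, whose `α`-th
power is the bound. Positive work rules out an empty interval, hence `a < c`. -/
theorem slotCost_le_lintegral (I : Instance) {a c : ℝ} {v : ℝ → ℝ≥0} (hv : Measurable v)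
    (hw : ∫⁻ τ in Ico a c, (v τ : ℝ≥0∞) = (I.p : ℝ≥0∞)) :
    a < c ∧ ENNReal.ofReal (slotCost I (c - a)) ≤ ∫⁻ τ in Ico a c, (v τ : ℝ≥0∞) ^ I.α := by
  have hp : (I.p : ℝ≥0∞) ≠ 0 := by exact_mod_cast I.p_pos.ne'
  have hα := I.one_lt_α
  have hac : a < c := by
    by_contra h
    rw [Ico_eq_empty h] at hw
    simp at hw
    exact hp hw.symm
  refine ⟨hac, ?_⟩
  have hl : 0 < c - a := sub_pos.2 hac
  have hH := ENNReal.lintegral_mul_le_Lp_mul_Lq (volume.restrict (Ico a c))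
    (Real.HolderConjugate.conjExponent hα) (f := fun τ => (v τ : ℝ≥0∞)) (g := fun _ => 1)
    hv.coe_nnreal_ennreal.aemeasurable aemeasurable_const
  have hq : 1 / I.α.conjExponent = (I.α - 1) / I.α := by
    rw [Real.conjExponent, one_div_div]
  simp only [Pi.mul_apply, mul_one, ENNReal.one_rpow, lintegral_const, one_mul, hw,
    Measure.restrict_apply MeasurableSet.univ, univ_inter, Real.volume_Ico, hq] at hH
  have h2 := ENNReal.rpow_le_rpow hH (by linarith : 0 ≤ I.α)
  rw [ENNReal.mul_rpow_of_nonneg _ _ (by linarith : 0 ≤ I.α), ← ENNReal.rpow_mul,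
    ← ENNReal.rpow_mul, one_div_mul_cancel (by linarith : I.α ≠ 0),
    div_mul_cancel₀ _ (by linarith : I.α ≠ 0), ENNReal.rpow_one] at h2
  rw [slotCost, ENNReal.ofReal_div_of_pos (Real.rpow_pos_of_pos hl _)]
  refine ENNReal.div_le_of_le_mul ?_
  rw [← ENNReal.ofReal_rpow_of_pos hl, ← ENNReal.ofReal_rpow_of_pos (by exact_mod_cast I.p_pos),
    ENNReal.ofReal_natCast]
  exact h2

/-- Pairwise disjoint execution intervals `[a j, c j)` for the jobs of `S`. -/
structure IsSlots (I : Instance) (S : Finset (Fin I.n)) (a c : Fin I.n → ℝ) : Prop where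
  release : ∀ j ∈ S, (I.r j : ℝ) ≤ a j
  deadline : ∀ j ∈ S, c j ≤ (I.d j : ℝ)
  lt : ∀ j ∈ S, a j < c j
  sep : ∀ i ∈ S, ∀ j ∈ S, i ≠ j → c i ≤ a j ∨ c j ≤ a i

/-- Energy of the slots, each at constant speed. -/
noncomputable def totalCost (I : Instance) (S : Finset (Fin I.n)) (a c : Fin I.n → ℝ) : ℝ :=
  ∑ j ∈ S, slotCost I (c j - a j)

theorem Schedule.isSlots {I : Instance} {S : Finset (Fin I.n)} (σ : Schedule I S) :
    IsSlots I S σ.start σ.finish where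
  release := σ.release_le
  deadline := σ.le_deadline
  lt j hj := (slotCost_le_lintegral I σ.measurable_speed (σ.work j hj)).1
  sep i hi j hj hij := by
    have h1 := (slotCost_le_lintegral I σ.measurable_speed (σ.work i hi)).1
    have h2 := (slotCost_le_lintegral I σ.measurable_speed (σ.work j hj)).1
    have := σ.disjoint i hi j hj hij
    rw [Ico_disjoint_Ico] at this
    by_contra! h
    rw [min_le_iff, le_max_iff, le_max_iff] at this
    rcases this with (h | h) | (h | h) <;> linarith

/-- The slots are disjoint, so their energies add up to an integral over part of the time line;
whatever happens outside the slots can only increase the energy. -/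
theorem Schedule.totalCost_le {I : Instance} {S : Finset (Fin I.n)} (σ : Schedule I S) :
    ENNReal.ofReal (totalCost I S σ.start σ.finish) ≤ σ.energy := by
  have hs := σ.isSlots
  rw [totalCost, ENNReal.ofReal_sum_of_nonneg
    fun j hj => (slotCost_pos I (sub_pos.2 (hs.lt j hj))).le]
  calc ∑ j ∈ S, ENNReal.ofReal (slotCost I (σ.finish j - σ.start j))
      ≤ ∑ j ∈ S, ∫⁻ τ in Ico (σ.start j) (σ.finish j), (σ.speed τ : ℝ≥0∞) ^ I.α :=
        Finset.sum_le_sum fun j hj =>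
          (slotCost_le_lintegral I σ.measurable_speed (σ.work j hj)).2
    _ = ∫⁻ τ in ⋃ j ∈ S, Ico (σ.start j) (σ.finish j), (σ.speed τ : ℝ≥0∞) ^ I.α := by
        rw [lintegral_biUnion_finset]
        · intro i hi j hj hij
          exact σ.disjoint i hi j hj hij
        · exact fun j _ => measurableSet_Ico
    _ ≤ σ.energy := setLIntegral_le_lintegral _ _

theorem deadline_le_dmax (I : Instance) (j : Fin I.n) : (I.d j : ℝ) ≤ I.dmax := by
  unfold Instance.dmax
  exact_mod_cast Finset.le_sup (f := I.d) (Finset.mem_univ j)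

/-- The strict constraint start < finish spoils compactness. But the cost of a slot tends to
infinity as its length tends to `0`, so competitors no worse than the given slots have all lengths
at least some `δ`. Under this closed constraint the feasible set is compact and the cost is
continuous. -/
theorem exists_optimal_slots {I : Instance} {S : Finset (Fin I.n)} {a c : Fin I.n → ℝ}
    (h : IsSlots I S a c) :
    ∃ a' c', IsSlots I S a' c' ∧ totalCost I S a' c' ≤ totalCost I S a c ∧
      ∀ a'' c'', IsSlots I S a'' c'' → totalCost I S a' c' ≤ totalCost I S a'' c'' := by
  classical
  have htend : Filter.Tendsto (slotCost I) (nhdsWithin 0 (Ioi 0)) Filter.atTop := by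
    have h1 := (tendsto_rpow_neg_nhdsGT_zero (y := -(I.α - 1)) (by linarith [I.one_lt_α])).const_mul_atTop
      (rpow_work_pos I)
    refine h1.congr' ?_
    filter_upwards [self_mem_nhdsWithin] with l hl
    rw [slotCost_eq I hl]
  obtain ⟨δ, hδ, hδ0⟩ := ((htend.eventually_gt_atTop (totalCost I S a c)).and
    self_mem_nhdsWithin).exists
  have hδ0 : 0 < δ := hδ0
  have hlong : ∀ a' c', IsSlots I S a' c' → totalCost I S a' c' ≤ totalCost I S a c →
      ∀ j ∈ S, a' j + δ ≤ c' j := by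
    intro a' c' h' hle j hj
    by_contra! hlt
    have h1 : slotCost I δ < slotCost I (c' j - a' j) :=
      slotCost_lt I (sub_pos.2 (h'.lt j hj)) (by linarith)
    have h2 : slotCost I (c' j - a' j) ≤ totalCost I S a' c' :=
      Finset.single_le_sum (f := fun j => slotCost I (c' j - a' j))
        (fun i hi => (slotCost_pos I (sub_pos.2 (h'.lt i hi))).le) hj
    linarith
  let D : ℝ := I.dmax
  -- Entries outside `S` affect neither feasibility nor cost; they are confined to `[0, D]` as well,
  -- only to keep the set bounded. Each separation condition is a union of two closed conditions.
  let K : Set ((Fin I.n → ℝ) × (Fin I.n → ℝ)) :=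
    Icc ((fun _ => 0), fun _ => 0) ((fun _ => D), fun _ => D) ∩
      {q | (∀ j ∈ S, (I.r j : ℝ) ≤ q.1 j) ∧ (∀ j ∈ S, q.2 j ≤ I.d j) ∧
        (∀ j ∈ S, q.1 j + δ ≤ q.2 j) ∧
        ∀ i ∈ S, ∀ j ∈ S, i ≠ j → q.2 i ≤ q.1 j ∨ q.2 j ≤ q.1 i}
  have hKc : IsCompact K := by
    refine isCompact_Icc.inter_right ?_
    have c1 : ∀ j : Fin I.n, Continuous fun q : (Fin I.n → ℝ) × (Fin I.n → ℝ) => q.1 j :=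
      fun j => (continuous_apply j).comp continuous_fst
    have c2 : ∀ j : Fin I.n, Continuous fun q : (Fin I.n → ℝ) × (Fin I.n → ℝ) => q.2 j :=
      fun j => (continuous_apply j).comp continuous_snd
    simp only [ofPred_and, ofPred_forall]
    refine IsClosed.inter ?_ (IsClosed.inter ?_ (IsClosed.inter ?_ ?_))
    · exact isClosed_iInter fun j => isClosed_iInter fun _ => isClosed_le continuous_const (c1 j)
    · exact isClosed_iInter fun j => isClosed_iInter fun _ => isClosed_le (c2 j) continuous_const
    · exact isClosed_iInter fun j => isClosed_iInter fun _ =>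
        isClosed_le ((c1 j).add continuous_const) (c2 j)
    · exact isClosed_iInter fun i => isClosed_iInter fun _ => isClosed_iInter fun j =>
        isClosed_iInter fun _ => isClosed_iInter fun _ =>
          (isClosed_le (c2 i) (c1 j)).union (isClosed_le (c2 j) (c1 i))
  have hD : 0 ≤ D := by
    show (0 : ℝ) ≤ ((_ : ℕ) : ℝ)
    positivity
  have hmem : ∀ a' c', IsSlots I S a' c' → totalCost I S a' c' ≤ totalCost I S a c →
      ((fun j => if j ∈ S then a' j else 0), (fun j => if j ∈ S then c' j else 0)) ∈ K := by
    intro a' c' h' hle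
    have hb : ∀ j ∈ S, 0 ≤ a' j ∧ a' j ≤ D ∧ 0 ≤ c' j ∧ c' j ≤ D := by
      intro j hj
      have h1 := h'.release j hj
      have h2 := h'.deadline j hj
      have h3 := h'.lt j hj
      have h4 := deadline_le_dmax I j
      have h5 : (0 : ℝ) ≤ I.r j := by positivity
      have h6 : I.dmax = D := rfl
      refine ⟨?_, ?_, ?_, ?_⟩ <;> linarith
    refine ⟨⟨⟨fun j => ?_, fun j => ?_⟩, fun j => ?_, fun j => ?_⟩, fun j hj => ?_, fun j hj => ?_,
      fun j hj => ?_, fun i hi j hj hij => ?_⟩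
    · dsimp only; split_ifs with hj
      exacts [(hb j hj).1, le_rfl]
    · dsimp only; split_ifs with hj
      exacts [(hb j hj).2.2.1, le_rfl]
    · dsimp only; split_ifs with hj
      exacts [(hb j hj).2.1, hD]
    · dsimp only; split_ifs with hj
      exacts [(hb j hj).2.2.2, hD]
    · simpa [hj] using h'.release j hj
    · simpa [hj] using h'.deadline j hj
    · simpa [hj] using hlong a' c' h' hle j hj
    · simpa [hj, hi] using h'.sep i hi j hj hij
  have hcost : ∀ a' c', totalCost I S (fun j => if j ∈ S then a' j else 0)
      (fun j => if j ∈ S then c' j else 0) = totalCost I S a' c' := by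
    intro a' c'
    refine Finset.sum_congr rfl fun j hj => ?_
    simp [hj]
  have hcont : ContinuousOn (fun q : (Fin I.n → ℝ) × (Fin I.n → ℝ) => totalCost I S q.1 q.2) K := by
    unfold totalCost slotCost
    refine continuousOn_finsetSum _ fun j hj => ?_
    have c1 : Continuous fun q : (Fin I.n → ℝ) × (Fin I.n → ℝ) => q.2 j - q.1 j :=
      ((continuous_apply j).comp continuous_snd).sub ((continuous_apply j).comp continuous_fst)
    have hpos : ∀ q ∈ K, 0 < q.2 j - q.1 j := fun q hq => by
      have := hq.2.2.2.1 j hj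
      linarith
    refine continuousOn_const.div (c1.continuousOn.rpow_const fun q hq => Or.inl (hpos q hq).ne')
      fun q hq => (Real.rpow_pos_of_pos (hpos q hq) _).ne'
  obtain ⟨q, hqK, hq⟩ := hKc.exists_isMinOn ⟨_, hmem a c h le_rfl⟩ hcont
  have hqs : IsSlots I S q.1 q.2 :=
    ⟨hqK.2.1, hqK.2.2.1, fun j hj => by linarith [hqK.2.2.2.1 j hj], hqK.2.2.2.2⟩
  have hmin : ∀ a'' c'', IsSlots I S a'' c'' → totalCost I S a'' c'' ≤ totalCost I S a c →
      totalCost I S q.1 q.2 ≤ totalCost I S a'' c'' := by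
    intro a'' c'' h'' hle
    have := hq (hmem a'' c'' h'' hle)
    simp only [mem_ofPred_eq, hcost] at this
    exact this
  refine ⟨q.1, q.2, hqs, hmin a c h le_rfl, fun a'' c'' h'' => ?_⟩
  rcases le_total (totalCost I S a'' c'') (totalCost I S a c) with hle | hle
  · exact hmin a'' c'' h'' hle
  · exact (hmin a c h le_rfl).trans hle

end SpeedScaling

/-! ### Optimal slots are cells of the candidate grids -/

namespace SpeedScaling

open MeasureTheory Set

/-- Slots of minimum total energy among all slots for the same jobs. -/
def IsOptimalSlots (I : Instance) (S : Finset (Fin I.n)) (a c : Fin I.n → ℝ) : Prop :=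
  IsSlots I S a c ∧ ∀ a' c', IsSlots I S a' c' → totalCost I S a c ≤ totalCost I S a' c'

theorem totalCost_lt_of_one {I : Instance} {S : Finset (Fin I.n)} {a c a' c' : Fin I.n → ℝ}
    {j : Fin I.n} (hj : j ∈ S) (hlt : a j < c j) (h1 : c j - a j < c' j - a' j)
    (h2 : ∀ i ∈ S, i ≠ j → c' i - a' i = c i - a i) :
    totalCost I S a' c' < totalCost I S a c := by
  refine Finset.sum_lt_sum (fun i hi => ?_) ⟨j, hj, slotCost_lt I (sub_pos.2 hlt) h1⟩
  by_cases h : i = j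
  · subst h
    exact (slotCost_lt I (sub_pos.2 hlt) h1).le
  · rw [h2 i hi h]

/-- Supplies the room for enlarging a slot: from `x` one can advance towards `y` without passing any
of finitely many endpoints. -/
theorem exists_gt_le_of_finite (S : Finset ℝ) {x y : ℝ} (hxy : x < y) :
    ∃ z, x < z ∧ z ≤ y ∧ ∀ w ∈ S, x < w → z ≤ w := by
  classical
  let T := insert y (S.filter (x < ·))
  have hT : T.Nonempty := ⟨y, Finset.mem_insert_self _ _⟩
  refine ⟨T.min' hT, ?_, T.min'_le _ (Finset.mem_insert_self _ _), fun w hw hxw =>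
    T.min'_le _ (Finset.mem_insert_of_mem (Finset.mem_filter.2 ⟨hw, hxw⟩))⟩
  rcases Finset.mem_insert.1 (T.min'_mem hT) with h | h
  · rw [h]; exact hxy
  · exact (Finset.mem_filter.1 h).2

theorem exists_lt_ge_of_finite (S : Finset ℝ) {x y : ℝ} (hxy : y < x) :
    ∃ z, z < x ∧ y ≤ z ∧ ∀ w ∈ S, w < x → w ≤ z := by
  classical
  obtain ⟨z, h1, h2, h3⟩ := exists_gt_le_of_finite (S.image fun w => -w) (neg_lt_neg hxy)
  refine ⟨-z, by linarith, by linarith, fun w hw hwx => ?_⟩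
  linarith [h3 (-w) (Finset.mem_image_of_mem _ hw) (neg_lt_neg hwx)]

/-- Otherwise there is free time directly after the slot of `j` and before its deadline; lengthening
the slot into it lowers the cost strictly. -/
theorem IsOptimalSlots.exists_start_eq {I : Instance} {S : Finset (Fin I.n)} {a c : Fin I.n → ℝ}
    (h : IsOptimalSlots I S a c) {j : Fin I.n} (hj : j ∈ S) (hd : c j ≠ I.d j) :
    ∃ i ∈ S, a i = c j := by
  classical
  by_contra! hne
  obtain ⟨hs, hmin⟩ := h
  obtain ⟨z, hz, hzd, hzS⟩ := exists_gt_le_of_finite (S.image a)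
    (lt_of_le_of_ne (hs.deadline j hj) hd)
  have hzS : ∀ i ∈ S, c j ≤ a i → z ≤ a i := fun i hi hle =>
    hzS _ (Finset.mem_image_of_mem _ hi) (lt_of_le_of_ne hle (hne i hi).symm)
  refine absurd (hmin a (Function.update c j z) ⟨hs.release, fun i hi => ?_, fun i hi => ?_,
    fun i hi k hk hik => ?_⟩) (not_le.2 (totalCost_lt_of_one hj (hs.lt j hj) ?_ ?_))
  · by_cases hij : i = j
    · subst hij; simpa using hzd
    · simpa [hij] using hs.deadline i hi
  · by_cases hij : i = j
    · subst hij; simpa using (hs.lt i hi).trans hz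
    · simpa [hij] using hs.lt i hi
  · have := hs.sep i hi k hk hik
    by_cases hij : i = j
    · subst hij
      rcases this with h | h
      · left; simpa using hzS k hk h
      · right; simpa [Ne.symm hik] using h
    · by_cases hkj : k = j
      · subst hkj
        rcases this with h | h
        · left; simpa [hij] using h
        · right; simpa using hzS i hi h
      · simpa [hij, hkj] using this
  · simpa using hz
  · intro i _ hij
    simp [hij]

theorem IsOptimalSlots.exists_finish_eq {I : Instance} {S : Finset (Fin I.n)} {a c : Fin I.n → ℝ}
    (h : IsOptimalSlots I S a c) {j : Fin I.n} (hj : j ∈ S) (hr : a j ≠ I.r j) :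
    ∃ i ∈ S, c i = a j := by
  classical
  by_contra! hne
  obtain ⟨hs, hmin⟩ := h
  obtain ⟨z, hz, hzr, hzS⟩ := exists_lt_ge_of_finite (S.image c)
    (lt_of_le_of_ne (hs.release j hj) hr.symm)
  have hzS : ∀ i ∈ S, c i ≤ a j → c i ≤ z := fun i hi hle =>
    hzS _ (Finset.mem_image_of_mem _ hi) (lt_of_le_of_ne hle (hne i hi))
  refine absurd (hmin (Function.update a j z) c ⟨fun i hi => ?_, hs.deadline, fun i hi => ?_,
    fun i hi k hk hik => ?_⟩) (not_le.2 (totalCost_lt_of_one hj (hs.lt j hj) ?_ ?_))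
  · by_cases hij : i = j
    · subst hij; simpa using hzr
    · simpa [hij] using hs.release i hi
  · by_cases hij : i = j
    · subst hij; simpa using hz.trans (hs.lt i hi)
    · simpa [hij] using hs.lt i hi
  · have := hs.sep i hi k hk hik
    by_cases hij : i = j
    · subst hij
      rcases this with h | h
      · left; simpa [Ne.symm hik] using h
      · right; simpa using hzS k hk h
    · by_cases hkj : k = j
      · subst hkj
        rcases this with h | h
        · left; simpa using hzS i hi h
        · right; simpa [hij] using h
      · simpa [hij, hkj] using this
  · simpa using hz
  · intro i _ hij
    simp [hij]

/-- Moving the common boundary of two consecutive slots keeps the slots feasible. -/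
theorem IsSlots.move_boundary {I : Instance} {S : Finset (Fin I.n)} {a c : Fin I.n → ℝ}
    (hs : IsSlots I S a c) {i j : Fin I.n} (hi : i ∈ S) (hj : j ∈ S) (hij : c i = a j) {y : ℝ}
    (h1 : a i < y) (h2 : y < c j) (h3 : y ≤ I.d i) (h4 : I.r j ≤ y) :
    IsSlots I S (Function.update a j y) (Function.update c i y) := by
  have hli := hs.lt i hi
  have hlj := hs.lt j hj
  have hne : i ≠ j := by
    rintro rfl
    linarith
  -- The slots of `i` and `j` are adjacent, so every other slot lies before both or after both and
  -- is not affected by the move.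
  have hout : ∀ k ∈ S, k ≠ i → k ≠ j → c k ≤ a i ∨ c j ≤ a k := by
    intro k hk hki hkj
    rcases hs.sep k hk i hi hki with h | h
    · exact Or.inl h
    · rcases hs.sep k hk j hj hkj with h' | h'
      · linarith [hs.lt k hk]
      · exact Or.inr h'
  refine ⟨fun k hk => ?_, fun k hk => ?_, fun k hk => ?_, fun k hk l hl hkl => ?_⟩
  · by_cases hkj : k = j
    · subst hkj; simpa using h4
    · simpa [hkj] using hs.release k hk
  · by_cases hki : k = i
    · subst hki; simpa using h3
    · simpa [hki] using hs.deadline k hk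
  · by_cases hkj : k = j
    · subst hkj
      simpa [hne.symm] using h2
    · by_cases hki : k = i
      · subst hki
        simpa [hkj] using h1
      · simpa [hki, hkj] using hs.lt k hk
  · have key : ∀ k ∈ S, ∀ l ∈ S, k ≠ l → k = i ∨ k = j →
        Function.update c i y k ≤ Function.update a j y l ∨
        Function.update c i y l ≤ Function.update a j y k := by
      intro k hk l hl hkl hk'
      rcases hk' with rfl | rfl
      · by_cases hlj : l = j
        · subst hlj
          left; simp
        · rcases hout l hl hkl.symm hlj with h | h
          · right; simpa [hkl.symm, hne] using h
          · left; simpa [hlj] using h2.le.trans h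
      · by_cases hli' : l = i
        · subst hli'
          right; simp
        · rcases hout l hl hli' hkl.symm with h | h
          · right; simpa [hli'] using h.trans h1.le
          · left; simpa [hne.symm, hkl.symm] using h
    by_cases hk' : k = i ∨ k = j
    · exact key k hk l hl hkl hk'
    · by_cases hl' : l = i ∨ l = j
      · exact (key l hl k hk hkl.symm hl').symm
      · push Not at hk' hl'
        simpa [hk'.1, hk'.2, hl'.1, hl'.2] using hs.sep k hk l hl hkl

theorem IsOptimalSlots.le_of_move {I : Instance} {S : Finset (Fin I.n)} {a c : Fin I.n → ℝ}
    (h : IsOptimalSlots I S a c) {i j : Fin I.n} (hi : i ∈ S) (hj : j ∈ S) (hij : c i = a j) {y : ℝ}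
    (h1 : a i < y) (h2 : y < c j) (h3 : y ≤ I.d i) (h4 : I.r j ≤ y) :
    slotCost I (c i - a i) + slotCost I (c j - a j) ≤ slotCost I (y - a i) + slotCost I (c j - y) := by
  classical
  have hle := h.2 _ _ (h.1.move_boundary hi hj hij h1 h2 h3 h4)
  have hne : i ≠ j := by
    rintro rfl
    linarith [h.1.lt i hi]
  have hj' : j ∈ S.erase i := Finset.mem_erase.2 ⟨hne.symm, hj⟩
  unfold totalCost at hle
  rw [← Finset.add_sum_erase S _ hi, ← Finset.add_sum_erase (S.erase i) _ hj',
    ← Finset.add_sum_erase S _ hi, ← Finset.add_sum_erase (S.erase i) _ hj'] at hle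
  have hrest : ∑ k ∈ (S.erase i).erase j,
      slotCost I (Function.update c i y k - Function.update a j y k) =
      ∑ k ∈ (S.erase i).erase j, slotCost I (c k - a k) := by
    refine Finset.sum_congr rfl fun k hk => ?_
    simp only [Finset.mem_erase] at hk
    simp [hk.1, hk.2.1]
  rw [hrest] at hle
  simp only [Function.update_self, Function.update_of_ne hne, Function.update_of_ne hne.symm] at hle
  linarith

/-- The common boundary is free to move a little in both directions. If the lengths differ, moving
it into the longer slot saves energy by `slotCost_transfer`. The step `e` is taken so small that the
deadline of `i` or the release date of `j` is respected and the order of the lengths is not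
overshot. -/
theorem IsOptimalSlots.length_eq {I : Instance} {S : Finset (Fin I.n)} {a c : Fin I.n → ℝ}
    (h : IsOptimalSlots I S a c) {i j : Fin I.n} (hi : i ∈ S) (hj : j ∈ S) (hij : c i = a j)
    (hd : c i ≠ I.d i) (hr : a j ≠ I.r j) : c i - a i = c j - a j := by
  have hli := h.1.lt i hi
  have hlj := h.1.lt j hj
  have hd' : c i < I.d i := lt_of_le_of_ne (h.1.deadline i hi) hd
  have hr' : I.r j < a j := lt_of_le_of_ne (h.1.release j hj) hr.symm
  rcases lt_trichotomy (c i - a i) (c j - a j) with hlt | heq | hlt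
  · obtain ⟨e, he0, he⟩ := exists_between
      (show 0 < min (I.d i - c i) ((c j - a j) - (c i - a i)) from lt_min (by linarith) (by linarith))
    obtain ⟨he1, he2⟩ := lt_min_iff.1 he
    have h1 := h.le_of_move hi hj hij (y := c i + e) (by linarith) (by linarith) (by linarith)
      (by linarith)
    have h2 := slotCost_transfer I (x := c i - a i) (y := c j - a j) (sub_pos.2 hli) he0 (by linarith)
    rw [show c i + e - a i = c i - a i + e by ring,
      show c j - (c i + e) = c j - a j - e by rw [hij]; ring] at h1
    linarith
  · exact heq
  · obtain ⟨e, he0, he⟩ := exists_between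
      (show 0 < min (a j - I.r j) ((c i - a i) - (c j - a j)) from lt_min (by linarith) (by linarith))
    obtain ⟨he1, he2⟩ := lt_min_iff.1 he
    have h1 := h.le_of_move hi hj hij (y := a j - e) (by linarith) (by linarith) (by linarith)
      (by linarith)
    have h2 := slotCost_transfer I (x := c j - a j) (y := c i - a i) (sub_pos.2 hlj) he0 (by linarith)
    rw [show a j - e - a i = c i - a i - e by rw [hij]; ring,
      show c j - (a j - e) = c j - a j + e by ring] at h1
    linarith

theorem release_mem_Omega (I : Instance) (j : Fin I.n) : (I.r j : ℝ) ∈ Omega I :=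
  Finset.mem_union_left _ (Finset.mem_image_of_mem (fun j => (I.r j : ℝ)) (Finset.mem_univ j))

theorem deadline_mem_Omega (I : Instance) (j : Fin I.n) : (I.d j : ℝ) ∈ Omega I :=
  Finset.mem_union_right _ (Finset.mem_image_of_mem (fun j => (I.d j : ℝ)) (Finset.mem_univ j))

/-- Walk to the left from the slot of `j`. As long as the start reached is not in Ω, some slot ends
there and has the same length; fewer slots start before it, so the walk stops, at a date `w` of Ω.
`L` collects the jobs passed. The property `c i ≤ a j` serves to show that the walks to the left and
to the right share no job. -/
theorem IsOptimalSlots.exists_left {I : Instance} {S : Finset (Fin I.n)} {a c : Fin I.n → ℝ}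
    (h : IsOptimalSlots I S a c) {j : Fin I.n} (hj : j ∈ S) :
    ∃ L ⊆ S, (∀ i ∈ L, c i ≤ a j) ∧ ∃ w ∈ Omega I, a j = w + L.card * (c j - a j) := by
  classical
  induction hN : (S.filter (a · < a j)).card using Nat.strong_induction_on generalizing j with
  | _ N ih =>
    by_cases hΩ : a j ∈ Omega I
    · exact ⟨∅, by simp, by simp, a j, hΩ, by simp⟩
    · have hr : a j ≠ I.r j := fun e => hΩ (e ▸ release_mem_Omega I j)
      obtain ⟨i, hi, hij⟩ := h.exists_finish_eq hj hr
      have hd : c i ≠ I.d i := fun e => hΩ (hij ▸ e ▸ deadline_mem_Omega I i)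
      have hlen := h.length_eq hi hj hij hd hr
      have hlt : a i < a j := hij ▸ h.1.lt i hi
      obtain ⟨L, hLS, hL, w, hw, hLw⟩ := ih _ (by
        rw [← hN]
        refine Finset.card_lt_card ⟨fun k hk => ?_, fun hsub => ?_⟩
        · simp only [Finset.mem_filter] at hk ⊢
          exact ⟨hk.1, hk.2.trans hlt⟩
        · simpa using hsub (Finset.mem_filter.2 ⟨hi, hlt⟩)) hi rfl
      have hiL : i ∉ L := fun hiL => by linarith [hL i hiL, h.1.lt i hi]
      refine ⟨insert i L, Finset.insert_subset hi hLS, fun k hk => ?_, w, hw, ?_⟩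
      · rcases Finset.mem_insert.1 hk with rfl | hk
        · exact hij.le
        · linarith [hL k hk]
      · rw [Finset.card_insert_of_notMem hiL, ← hlen]
        push_cast
        linarith

theorem IsOptimalSlots.exists_right {I : Instance} {S : Finset (Fin I.n)} {a c : Fin I.n → ℝ}
    (h : IsOptimalSlots I S a c) {j : Fin I.n} (hj : j ∈ S) :
    ∃ R ⊆ S, (∀ i ∈ R, c j ≤ a i) ∧ ∃ w ∈ Omega I, w = c j + R.card * (c j - a j) := by
  classical
  induction hN : (S.filter (c j < c ·)).card using Nat.strong_induction_on generalizing j with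
  | _ N ih =>
    by_cases hΩ : c j ∈ Omega I
    · exact ⟨∅, by simp, by simp, c j, hΩ, by simp⟩
    · have hd : c j ≠ I.d j := fun e => hΩ (e ▸ deadline_mem_Omega I j)
      obtain ⟨i, hi, hij⟩ := h.exists_start_eq hj hd
      have hr : a i ≠ I.r i := fun e => hΩ (hij ▸ e ▸ release_mem_Omega I i)
      have hlen := h.length_eq hj hi hij.symm hd hr
      have hlt : c j < c i := hij ▸ h.1.lt i hi
      obtain ⟨R, hRS, hR, w, hw, hRw⟩ := ih _ (by
        rw [← hN]
        refine Finset.card_lt_card ⟨fun k hk => ?_, fun hsub => ?_⟩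
        · simp only [Finset.mem_filter] at hk ⊢
          exact ⟨hk.1, hlt.trans hk.2⟩
        · simpa using hsub (Finset.mem_filter.2 ⟨hi, hlt⟩)) hi rfl
      have hiR : i ∉ R := fun hiR => by linarith [hR i hiR, h.1.lt i hi]
      refine ⟨insert i R, Finset.insert_subset hi hRS, fun k hk => ?_, w, hw, ?_⟩
      · rcases Finset.mem_insert.1 hk with rfl | hk
        · exact hij.ge
        · linarith [hR k hk]
      · rw [Finset.card_insert_of_notMem hiR, hRw, ← hlen]
        push_cast
        linarith

theorem mem_Theta {I : Instance} {x : ℝ} : x ∈ Theta I ↔ ∃ a ∈ Omega I, ∃ b ∈ Omega I,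
    ∃ i h, 1 ≤ i ∧ i ≤ I.n ∧ h ≤ i ∧ x = gridPoint a b i h := by
  simp only [Theta, ThetaOf, Finset.mem_biUnion, Finset.mem_Icc, Finset.mem_image,
    Finset.mem_range, Nat.lt_succ_iff]
  constructor
  · rintro ⟨a, ha, b, hb, i, ⟨h1, h2⟩, h, hh, rfl⟩
    exact ⟨a, ha, b, hb, i, h, h1, h2, hh, rfl⟩
  · rintro ⟨a, ha, b, hb, i, h, h1, h2, hh, rfl⟩
    exact ⟨a, ha, b, hb, i, ⟨h1, h2⟩, h, hh, rfl⟩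

theorem mem_Gamma {I : Instance} {s x : ℝ} : x ∈ Gamma I s ↔ ∃ a ∈ Omega I, ∃ b ∈ Omega I,
    ∃ i h, 1 ≤ i ∧ i ≤ I.n ∧ h ≤ i ∧ s = gridPoint a b i h ∧ x = gridPoint a b i (h + 1) := by
  simp only [Gamma, Finset.mem_biUnion, Finset.mem_Icc, Finset.mem_image,
    Finset.mem_range, Nat.lt_succ_iff, Finset.mem_filter]
  constructor
  · rintro ⟨a, ha, b, hb, i, ⟨h1, h2⟩, h, ⟨hh, hs⟩, rfl⟩
    exact ⟨a, ha, b, hb, i, h, h1, h2, hh, hs, rfl⟩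
  · rintro ⟨a, ha, b, hb, i, h, h1, h2, hh, hs, rfl⟩
    exact ⟨a, ha, b, hb, i, ⟨h1, h2⟩, h, ⟨hh, hs⟩, rfl⟩

/-- In optimal slots, every execution interval is a cell of one of the candidate grids. -/
theorem IsOptimalSlots.mem_grid {I : Instance} {S : Finset (Fin I.n)} {a c : Fin I.n → ℝ}
    (h : IsOptimalSlots I S a c) {j : Fin I.n} (hj : j ∈ S) :
    a j ∈ Theta I ∧ c j ∈ Gamma I (a j) := by
  classical
  obtain ⟨L, hLS, hL, w, hw, hLw⟩ := h.exists_left hj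
  obtain ⟨R, hRS, hR, w', hw', hRw⟩ := h.exists_right hj
  have hlt := h.1.lt j hj
  have hjR : j ∉ R := fun hjR => by linarith [hR j hjR]
  -- The cells of the run belong to different jobs, which bounds their number by `n`, the largest
  -- denominator of the grids. The slot of `j` is preceded by `L.card` cells of the run.
  have hdis : Disjoint L (insert j R) := by
    rw [Finset.disjoint_left]
    intro i hiL hiR
    have h1 := hL i hiL
    rcases Finset.mem_insert.1 hiR with rfl | hiR
    · linarith
    · linarith [hR i hiR, h.1.lt i (hLS hiL)]
  have hcard : L.card + (R.card + 1) ≤ I.n := by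
    rw [← Finset.card_insert_of_notMem hjR, ← Finset.card_union_of_disjoint hdis]
    simpa using Finset.card_le_univ (L ∪ insert j R)
  have hi : ((L.card + (R.card + 1) : ℕ) : ℝ) ≠ 0 := Nat.cast_ne_zero.2 (by omega)
  have hlen : (w' - w) / ((L.card + (R.card + 1) : ℕ) : ℝ) = c j - a j := by
    rw [div_eq_iff hi, hRw]
    push_cast
    linarith
  have h1 : a j = gridPoint w w' (L.card + (R.card + 1)) L.card := by
    rw [gridPoint, hlen]
    exact hLw
  have h2 : c j = gridPoint w w' (L.card + (R.card + 1)) (L.card + 1) := by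
    rw [gridPoint, hlen]
    push_cast
    linarith
  exact ⟨mem_Theta.2 ⟨w, hw, w', hw', _, _, by omega, hcard, by omega, h1⟩,
    mem_Gamma.2 ⟨w, hw, w', hw', _, _, by omega, hcard, by omega, h1, h2⟩⟩

end SpeedScaling

/-! ### Exchange argument, and the lower bound for the energy -/

namespace SpeedScaling

open MeasureTheory Set

/-- Exchanging a job with a later one that is already available keeps the slots feasible, provided
the deadlines are ordered the right way. -/
theorem IsSlots.swap {I : Instance} {S : Finset (Fin I.n)} {a c : Fin I.n → ℝ}
    (hs : IsSlots I S a c) {i j : Fin I.n} (hi : i ∈ S) (hj : j ∈ S) (hd : I.d i ≤ I.d j)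
    (hlt : a j < a i) (hr : (I.r i : ℝ) ≤ a j) :
    IsSlots I S (a ∘ Equiv.swap i j) (c ∘ Equiv.swap i j) := by
  have hmem : ∀ k ∈ S, Equiv.swap i j k ∈ S := by
    intro k hk
    rw [Equiv.swap_apply_def]
    split_ifs <;> assumption
  have hd' : (I.d i : ℝ) ≤ I.d j := by exact_mod_cast hd
  have hne : i ≠ j := by
    rintro rfl
    exact lt_irrefl _ hlt
  -- The slot of `j` ends before that of `i` begins. Hence `i` meets its deadline in the earlier
  -- slot, while in the later one `j` is already released and ends by `d i ≤ d j`.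
  have hcj : c j ≤ a i := by
    rcases hs.sep i hi j hj hne with h | h
    · linarith [hs.lt i hi]
    · exact h
  refine ⟨fun k hk => ?_, fun k hk => ?_, fun k hk => hs.lt _ (hmem k hk),
    fun k hk l hl hkl => hs.sep _ (hmem k hk) _ (hmem l hl) fun e => hkl ((Equiv.swap i j).injective e)⟩
  · rw [Function.comp, Equiv.swap_apply_def]
    split_ifs with h1 h2
    · rw [h1]; exact hr
    · rw [h2]; linarith [hs.release j hj]
    · exact hs.release k hk
  · rw [Function.comp, Equiv.swap_apply_def]
    split_ifs with h1 h2
    · rw [h1]; linarith [hs.deadline i hi, hs.lt i hi]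
    · rw [h2]; linarith [hs.deadline i hi]
    · exact hs.deadline k hk

/-- The slots can be redistributed so that every job executed after the job `j` of latest deadline
is released after the start of `j`. -/
theorem IsSlots.exists_rearrangement {I : Instance} {S : Finset (Fin I.n)} {a c : Fin I.n → ℝ}
    (hs : IsSlots I S a c) {j : Fin I.n} (hj : j ∈ S) (hd : ∀ i ∈ S, I.d i ≤ I.d j) :
    ∃ e : Equiv.Perm (Fin I.n), (∀ i, e i ∈ S ↔ i ∈ S) ∧ IsSlots I S (a ∘ e) (c ∘ e) ∧
      ∀ i ∈ S, a (e j) < a (e i) → a (e j) ≤ I.r i := by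
  classical
  -- Among the finitely many feasible reassignments take one in which `j` starts latest. A later job
  -- already released before that start could be exchanged with `j`, which would then start later
  -- still.
  obtain ⟨e, he, hmax⟩ := Finset.exists_max_image
    (Finset.univ.filter fun e : Equiv.Perm (Fin I.n) =>
      (∀ i, e i ∈ S ↔ i ∈ S) ∧ IsSlots I S (a ∘ e) (c ∘ e)) (fun e => a (e j))
    ⟨1, Finset.mem_filter.2 ⟨Finset.mem_univ _, fun _ => Iff.rfl, hs⟩⟩
  obtain ⟨-, he1, he2⟩ := Finset.mem_filter.1 he
  refine ⟨e, he1, he2, fun i hi hlt => ?_⟩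
  by_contra! hr
  have hsw := he2.swap hi hj (hd i hi) hlt hr.le
  have := hmax (e * Equiv.swap i j) (Finset.mem_filter.2 ⟨Finset.mem_univ _, fun k => ?_, hsw⟩)
  · simp only [Equiv.Perm.mul_apply, Equiv.swap_apply_right] at this
    linarith
  · rw [Equiv.Perm.mul_apply, he1, Equiv.swap_apply_def]
    split_ifs with h1 h2
    · simp [h1, hi, hj]
    · simp [h2, hi, hj]
    · rfl

theorem totalCost_comp {I : Instance} {S : Finset (Fin I.n)} (a c : Fin I.n → ℝ)
    {e : Equiv.Perm (Fin I.n)} (he : ∀ i, e i ∈ S ↔ i ∈ S) :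
    totalCost I S (a ∘ e) (c ∘ e) = totalCost I S a c :=
  Finset.sum_equiv e (fun i => (he i).symm) fun _ _ => rfl

/-- The value of one choice of the dynamic program. -/
noncomputable def dpTerm (I : Instance) (k : ℕ) (s x t : ℝ) (u : ℕ) (s' x' : ℝ) (l : ℕ) : ℝ≥0∞ :=
  dpValue I k s x s' l + dpValue I k s' x' t (u - l - 1) + ENNReal.ofReal (slotCost I (x' - s'))

/-- The side conditions of one choice of the dynamic program. -/
def DpCond (I : Instance) (j : Fin I.n) (s x t s' x' : ℝ) : Prop :=
  s ≤ (I.r j : ℝ) ∧ (I.r j : ℝ) ≤ s' ∧ x ≤ s' ∧ s' < x' ∧ x' ≤ t ∧ x' ≤ (I.d j : ℝ)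

theorem dpValue_succ (I : Instance) (j : Fin I.n) (s x t : ℝ) (u : ℕ) :
    dpValue I (j + 1) s x t u = min (dpValue I j s x t u)
      (⨅ (s' ∈ Theta I) (x' ∈ Gamma I s') (_ : DpCond I j s x t s' x') (l ∈ Finset.range u),
        dpTerm I j s x t u s' x' l) := by
  rw [dpValue]
  congr 1
  apply le_antisymm
  · exact (iInf_le _ j).trans (iInf_le _ rfl)
  · refine le_iInf₂ fun i hi => ?_
    obtain rfl : i = j := Fin.ext hi
    rfl

/-- A finite infimum is attained unless the index set is empty, and then it is `⊤`. -/
theorem exists_le_iInf_finset {ι : Type*} {T : Finset ι} {f : ι → ℝ≥0∞}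
    (h : (⨅ i ∈ T, f i) ≠ ⊤) : ∃ i ∈ T, f i ≤ ⨅ i ∈ T, f i := by
  by_cases hT : T.Nonempty
  · obtain ⟨i, hi, he⟩ := T.exists_mem_eq_inf hT f
    exact ⟨i, hi, by rw [← Finset.inf_eq_iInf, he]⟩
  · rw [Finset.not_nonempty_iff_eq_empty] at hT
    subst hT
    simp at h

theorem exists_dpTerm_le {I : Instance} {j : Fin I.n} {s x t : ℝ} {u : ℕ}
    (h : dpValue I (j + 1) s x t u ≠ ⊤) :
    dpValue I j s x t u = dpValue I (j + 1) s x t u ∨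
      ∃ s' ∈ Theta I, ∃ x' ∈ Gamma I s', DpCond I j s x t s' x' ∧ ∃ l < u,
        dpTerm I j s x t u s' x' l ≤ dpValue I (j + 1) s x t u := by
  rw [dpValue_succ] at h ⊢
  rcases min_choice (dpValue I j s x t u) (⨅ (s' ∈ Theta I) (x' ∈ Gamma I s')
    (_ : DpCond I j s x t s' x') (l ∈ Finset.range u), dpTerm I j s x t u s' x' l) with e | e
  · exact Or.inl e.symm
  · right
    rw [e] at h ⊢
    obtain ⟨s', hs', h1⟩ := exists_le_iInf_finset h
    obtain ⟨x', hx', h2⟩ := exists_le_iInf_finset (ne_top_of_le_ne_top h h1)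
    have h3 := h2.trans h1
    by_cases hc : DpCond I j s x t s' x'
    · simp only [hc, iInf_pos] at h3
      obtain ⟨l, hl, h4⟩ := exists_le_iInf_finset (ne_top_of_le_ne_top h h3)
      exact ⟨s', hs', x', hx', hc, l, Finset.mem_range.1 hl, h4.trans h3⟩
    · simp only [hc, not_false_eq_true, iInf_neg, top_le_iff] at h3
      exact absurd h3 h

theorem dpValue_succ_le_dpTerm {I : Instance} {j : Fin I.n} {s x t s' x' : ℝ} {u l : ℕ}
    (hs' : s' ∈ Theta I) (hx' : x' ∈ Gamma I s') (hc : DpCond I j s x t s' x') (hl : l < u) :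
    dpValue I (j + 1) s x t u ≤ dpTerm I j s x t u s' x' l := by
  rw [dpValue_succ]
  exact (min_le_right _ _).trans <| (iInf₂_le s' hs').trans <| (iInf₂_le x' hx').trans <|
    (iInf_le _ hc).trans <| iInf₂_le l (Finset.mem_range.2 hl)

theorem dpValue_succ_le (I : Instance) (k : ℕ) (s x t : ℝ) (u : ℕ) :
    dpValue I (k + 1) s x t u ≤ dpValue I k s x t u := by
  rw [dpValue]
  exact min_le_left _ _

theorem IsSlots.mono {I : Instance} {S S' : Finset (Fin I.n)} {a c : Fin I.n → ℝ}
    (hs : IsSlots I S a c) (h : S' ⊆ S) : IsSlots I S' a c :=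
  ⟨fun j hj => hs.release j (h hj), fun j hj => hs.deadline j (h hj), fun j hj => hs.lt j (h hj),
    fun i hi j hj => hs.sep i (h hi) j (h hj)⟩

theorem IsSlots.totalCost_nonneg {I : Instance} {S : Finset (Fin I.n)} {a c : Fin I.n → ℝ}
    (hs : IsSlots I S a c) : 0 ≤ totalCost I S a c :=
  Finset.sum_nonneg fun j hj => (slotCost_pos I (sub_pos.2 (hs.lt j hj))).le

/-- Induction on `k`. The slots are only required to lie on the grid, not to be optimal: this
property survives both a reassignment of the slots and the restriction to fewer jobs, as the
induction needs. After the rearrangement the job of index `k`, which has the latest deadline,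
separates the jobs finished before its start from those executed after its end. The latter are
released no earlier than its start `s'`, so they form a subproblem beginning at `s'` and idle until
`x'`. -/
theorem dpValue_le_totalCost {I : Instance} {k : ℕ} {S : Finset (Fin I.n)} {a c : Fin I.n → ℝ}
    {s x t : ℝ} (hs : IsSlots I S a c) (hgrid : ∀ j ∈ S, a j ∈ Theta I ∧ c j ∈ Gamma I (a j))
    (hk : ∀ j ∈ S, (j : ℕ) < k) (hr : ∀ j ∈ S, s ≤ (I.r j : ℝ)) (hx : ∀ j ∈ S, x ≤ a j)
    (ht : ∀ j ∈ S, c j ≤ t) :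
    dpValue I k s x t S.card ≤ ENNReal.ofReal (totalCost I S a c) := by
  classical
  induction k generalizing S a c s x t with
  | zero =>
    obtain rfl : S = ∅ := Finset.eq_empty_of_forall_notMem fun j hj => absurd (hk j hj) (by simp)
    simp [dpValue]
  | succ k ih =>
    by_cases hS : ∃ j ∈ S, (j : ℕ) = k
    swap
    · push Not at hS
      exact (dpValue_succ_le I k s x t _).trans
        (ih hs hgrid (fun j hj => lt_of_le_of_ne (Nat.lt_succ_iff.1 (hk j hj)) (hS j hj)) hr hx ht)
    obtain ⟨j, hj, rfl⟩ := hS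
    obtain ⟨e, he, hs', hlate⟩ := hs.exists_rearrangement hj
      fun i hi => I.d_mono (Fin.le_def.2 (Nat.lt_succ_iff.1 (hk i hi)))
    rw [← totalCost_comp a c he]
    replace hgrid : ∀ j ∈ S, (a ∘ e) j ∈ Theta I ∧ (c ∘ e) j ∈ Gamma I ((a ∘ e) j) :=
      fun j hj => hgrid _ ((he j).2 hj)
    replace hx : ∀ j ∈ S, x ≤ (a ∘ e) j := fun j hj => hx _ ((he j).2 hj)
    replace ht : ∀ j ∈ S, (c ∘ e) j ≤ t := fun j hj => ht _ ((he j).2 hj)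
    replace hlate : ∀ i ∈ S, (a ∘ e) j < (a ∘ e) i → (a ∘ e) j ≤ I.r i := hlate
    generalize a ∘ e = a at *
    generalize c ∘ e = c at *
    clear hs
    have hsep : ∀ i ∈ S, i ≠ j → (a i < a j ∧ c i ≤ a j) ∨ (a j < a i ∧ c j ≤ a i) := by
      intro i hi hij
      have h1 := hs'.lt i hi
      have h2 := hs'.lt j hj
      rcases hs'.sep i hi j hj hij with h | h
      · exact Or.inl ⟨by linarith, h⟩
      · exact Or.inr ⟨by linarith, h⟩
    have hjlt := hs'.lt j hj
    set S₁ := (S.erase j).filter (a · < a j) with hS₁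
    set S₂ := (S.erase j).filter (¬ a · < a j) with hS₂
    have m1 : ∀ i ∈ S₁, i ∈ S ∧ i ≠ j ∧ a i < a j ∧ c i ≤ a j := by
      intro i hi
      simp only [hS₁, Finset.mem_filter, Finset.mem_erase] at hi
      rcases hsep i hi.1.2 hi.1.1 with h | h
      · exact ⟨hi.1.2, hi.1.1, h⟩
      · linarith
    have m2 : ∀ i ∈ S₂, i ∈ S ∧ i ≠ j ∧ a j < a i ∧ c j ≤ a i := by
      intro i hi
      simp only [hS₂, Finset.mem_filter, Finset.mem_erase] at hi
      rcases hsep i hi.1.2 hi.1.1 with h | h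
      · exact absurd h.1 hi.2
      · exact ⟨hi.1.2, hi.1.1, h⟩
    have hcard : S₁.card + S₂.card + 1 = S.card := by
      rw [hS₁, hS₂, Finset.card_filter_add_card_filter_not, Finset.card_erase_add_one hj]
    have hcost : totalCost I S a c =
        totalCost I S₁ a c + totalCost I S₂ a c + slotCost I (c j - a j) := by
      simp only [totalCost, hS₁, hS₂]
      rw [Finset.sum_filter_add_sum_filter_not, Finset.sum_erase_add _ _ hj]
    have hsub1 : S₁ ⊆ S := fun i hi => (m1 i hi).1
    have hsub2 : S₂ ⊆ S := fun i hi => (m2 i hi).1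
    have hlt : ∀ i ∈ S, i ≠ j → (i : ℕ) < j := fun i hi hij =>
      lt_of_le_of_ne (Nat.lt_succ_iff.1 (hk i hi)) fun e => hij (Fin.ext e)
    refine (dpValue_succ_le_dpTerm (hgrid j hj).1 (hgrid j hj).2
      ⟨hr j hj, hs'.release j hj, hx j hj, hjlt, ht j hj, hs'.deadline j hj⟩
      (show S₁.card < S.card by omega)).trans ?_
    rw [dpTerm, show S.card - S₁.card - 1 = S₂.card by omega, hcost,
      ENNReal.ofReal_add (add_nonneg (hs'.mono hsub1).totalCost_nonneg
        (hs'.mono hsub2).totalCost_nonneg) (slotCost_pos I (sub_pos.2 hjlt)).le,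
      ENNReal.ofReal_add (hs'.mono hsub1).totalCost_nonneg (hs'.mono hsub2).totalCost_nonneg]
    gcongr
    · exact ih (hs'.mono hsub1) (fun i hi => hgrid i (hsub1 hi))
        (fun i hi => hlt i (hsub1 hi) (m1 i hi).2.1) (fun i hi => hr i (hsub1 hi))
        (fun i hi => hx i (hsub1 hi)) fun i hi => (m1 i hi).2.2.2
    · exact ih (hs'.mono hsub2) (fun i hi => hgrid i (hsub2 hi))
        (fun i hi => hlt i (hsub2 hi) (m2 i hi).2.1)
        (fun i hi => hlate i (hsub2 hi) (m2 i hi).2.2.1) (fun i hi => (m2 i hi).2.2.2)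
        fun i hi => ht i (hsub2 hi)

/-! ### Gluing schedules, and exactness of the dynamic program -/

/-- The schedules over which `minEnergy` minimizes. -/
structure Schedule.Fits {I : Instance} {S : Finset (Fin I.n)} (σ : Schedule I S) (k : ℕ)
    (s x t : ℝ) (u : ℕ) : Prop where
  mem_jobs : ∀ j ∈ S, j ∈ I.jobs k s t
  card_eq : S.card = u
  within : ∀ j ∈ S, s ≤ σ.start j ∧ σ.finish j ≤ t
  idle : ∀ τ ∈ Ico s x, σ.speed τ = 0

theorem minEnergy_eq (I : Instance) (k : ℕ) (s x t : ℝ) (u : ℕ) :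
    minEnergy I k s x t u =
      sInf {e | ∃ (S : Finset (Fin I.n)) (σ : Schedule I S), σ.Fits k s x t u ∧ e = σ.energy} := by
  rw [minEnergy]
  congr 1
  ext e
  constructor
  · rintro ⟨S, σ, h1, h2, h3, h4, h5⟩
    exact ⟨S, σ, ⟨h1, h2, h3, h4⟩, h5⟩
  · rintro ⟨S, σ, ⟨h1, h2, h3, h4⟩, h5⟩
    exact ⟨S, σ, h1, h2, h3, h4, h5⟩

theorem mem_jobs {I : Instance} {k : ℕ} {s t : ℝ} {j : Fin I.n} :
    j ∈ I.jobs k s t ↔ (j : ℕ) < k ∧ s ≤ (I.r j : ℝ) ∧ (I.r j : ℝ) < t := Iff.rfl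

/-- Running `S₁` before `s'`, job `j` at constant speed in `[s', x')`, and `S₂` afterwards. -/
theorem exists_glued_schedule {I : Instance} {j : Fin I.n} {S₁ S₂ : Finset (Fin I.n)}
    {σ₁ : Schedule I S₁} {σ₂ : Schedule I S₂} {s x t s' x' : ℝ} {u l : ℕ}
    (hc : DpCond I j s x t s' x') (hl : l < u) (h₁ : σ₁.Fits j s x s' l)
    (h₂ : σ₂.Fits j s' x' t (u - l - 1)) :
    ∃ (S : Finset (Fin I.n)) (σ : Schedule I S), σ.Fits (j + 1) s x t u ∧
      σ.energy ≤ σ₁.energy + σ₂.energy + ENNReal.ofReal (slotCost I (x' - s')) := by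
  classical
  obtain ⟨hsr, hrs', hxs', hs'x', hx't, hx'd⟩ := hc
  have hlen : 0 < x' - s' := sub_pos.2 hs'x'
  have hα := I.one_lt_α
  have hj1 : j ∉ S₁ := fun h => lt_irrefl _ (h₁.mem_jobs j h).1
  have hj2 : j ∉ S₂ := fun h => lt_irrefl _ (h₂.mem_jobs j h).1
  -- Release dates before `s'` on one side and from `s'` on at the other: no job is used twice.
  have hdis : Disjoint S₁ S₂ := Finset.disjoint_left.2 fun i hi1 hi2 => by
    have h3 := (h₁.mem_jobs i hi1).2.2
    have h4 := (h₂.mem_jobs i hi2).2.1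
    linarith
  have h12 : ∀ i ∈ S₂, i ∉ S₁ := fun i hi2 hi1 => Finset.disjoint_left.1 hdis hi1 hi2
  let q : ℝ≥0 := (I.p : ℝ≥0) / (x' - s').toNNReal
  have hq0 : (x' - s').toNNReal ≠ 0 := by simpa using hs'x'
  let v : ℝ → ℝ≥0 := fun τ => if τ < s' then σ₁.speed τ else if τ < x' then q else σ₂.speed τ
  -- An interval of `σ₂` may begin inside `[s', x')`, where `σ₂` is idle. Cutting it off at `x'`
  -- loses no work and makes it disjoint from the slot of `j`.
  let st : Fin I.n → ℝ := fun i => if i = j then s' else if i ∈ S₁ then σ₁.start i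
    else max (σ₂.start i) x'
  let fi : Fin I.n → ℝ := fun i => if i = j then x' else if i ∈ S₁ then σ₁.finish i
    else σ₂.finish i
  have st_j : st j = s' := by simp [st]
  have fi_j : fi j = x' := by simp [fi]
  have ne1 : ∀ i ∈ S₁, i ≠ j := fun i hi e => hj1 (e ▸ hi)
  have ne2 : ∀ i ∈ S₂, i ≠ j := fun i hi e => hj2 (e ▸ hi)
  have st_1 : ∀ i ∈ S₁, st i = σ₁.start i := fun i hi => by simp [st, ne1 i hi, hi]
  have fi_1 : ∀ i ∈ S₁, fi i = σ₁.finish i := fun i hi => by simp [fi, ne1 i hi, hi]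
  have st_2 : ∀ i ∈ S₂, st i = max (σ₂.start i) x' := fun i hi => by
    simp [st, ne2 i hi, h12 i hi]
  have fi_2 : ∀ i ∈ S₂, fi i = σ₂.finish i := fun i hi => by simp [fi, ne2 i hi, h12 i hi]
  have hvm : Measurable v :=
    Measurable.ite measurableSet_Iio σ₁.measurable_speed
      (Measurable.ite measurableSet_Iio measurable_const σ₂.measurable_speed)
  have hmem : ∀ i ∈ insert j (S₁ ∪ S₂), i = j ∨ i ∈ S₁ ∨ i ∈ S₂ := fun i hi => by
    simpa using hi
  have hd12 : ∀ i ∈ S₁, ∀ k, k = j ∨ k ∈ S₂ → Disjoint (Ico (st i) (fi i)) (Ico (st k) (fi k)) := by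
    intro i hi k hk
    rw [st_1 i hi, fi_1 i hi]
    have h3 := (h₁.within i hi).2
    have h4 : s' ≤ st k := by
      rcases hk with rfl | hk
      · exact st_j.ge
      · rw [st_2 k hk]
        exact hs'x'.le.trans (le_max_right _ _)
    refine disjoint_left.2 fun τ h5 h6 => ?_
    linarith [h5.2, h6.1]
  have hdj2 : ∀ k ∈ S₂, Disjoint (Ico (st j) (fi j)) (Ico (st k) (fi k)) := by
    intro k hk
    rw [fi_j, st_2 k hk]
    refine disjoint_left.2 fun τ h5 h6 => ?_
    linarith [h5.2, h6.1, le_max_right (σ₂.start k) x']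
  refine ⟨insert j (S₁ ∪ S₂), ⟨v, hvm, st, fi, ?_, ?_, ?_, ?_⟩, ⟨?_, ?_, ?_, ?_⟩, ?_⟩
  · intro i hi
    rcases hmem i hi with rfl | hi | hi
    · rw [st_j]; exact hrs'
    · rw [st_1 i hi]; exact σ₁.release_le i hi
    · rw [st_2 i hi]; exact (σ₂.release_le i hi).trans (le_max_left _ _)
  · intro i hi
    rcases hmem i hi with rfl | hi | hi
    · rw [fi_j]; exact hx'd
    · rw [fi_1 i hi]; exact σ₁.le_deadline i hi
    · rw [fi_2 i hi]; exact σ₂.le_deadline i hi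
  · intro i hi
    rcases hmem i hi with rfl | hi | hi
    · rw [st_j, fi_j, setLIntegral_congr_fun (g := fun _ => (q : ℝ≥0∞)) measurableSet_Ico]
      · rw [setLIntegral_const, Real.volume_Ico, ENNReal.ofReal, ← ENNReal.coe_mul,
          div_mul_cancel₀ _ hq0, ENNReal.coe_natCast]
      · intro τ hτ
        simp [v, hτ.1, hτ.2]
    · rw [st_1 i hi, fi_1 i hi, ← σ₁.work i hi]
      refine setLIntegral_congr_fun measurableSet_Ico fun τ hτ => ?_
      have := hτ.2.trans_le (h₁.within i hi).2
      simp [v, this]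
    · rw [st_2 i hi, fi_2 i hi, ← σ₂.work i hi]
      rw [← lintegral_indicator measurableSet_Ico, ← lintegral_indicator measurableSet_Ico]
      congr 1
      ext τ
      simp only [indicator_apply, mem_Ico, max_le_iff]
      by_cases h3 : x' ≤ τ
      · simp [v, h3, not_lt.2 h3, not_lt.2 (hs'x'.le.trans h3)]
      · simp only [h3, and_false, false_and, if_false]
        split_ifs with h4
        · simp [h₂.idle τ ⟨(h₂.within i hi).1.trans h4.1, not_le.1 h3⟩]
        · rfl
  · intro i hi k hk hik
    rcases hmem i hi with e | hi' | hi'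
    · rcases hmem k hk with e' | hk' | hk'
      · exact absurd (e.trans e'.symm) hik
      · exact (hd12 k hk' i (Or.inl e)).symm
      · rw [e]; exact hdj2 k hk'
    · rcases hmem k hk with e' | hk' | hk'
      · exact hd12 i hi' k (Or.inl e')
      · rw [st_1 i hi', fi_1 i hi', st_1 k hk', fi_1 k hk']
        exact σ₁.disjoint i hi' k hk' hik
      · exact hd12 i hi' k (Or.inr hk')
    · rcases hmem k hk with e' | hk' | hk'
      · rw [e']; exact (hdj2 i hi').symm
      · exact (hd12 k hk' i (Or.inr hi')).symm
      · rw [st_2 i hi', fi_2 i hi', st_2 k hk', fi_2 k hk']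
        exact (σ₂.disjoint i hi' k hk' hik).mono (Ico_subset_Ico_left (le_max_left _ _))
          (Ico_subset_Ico_left (le_max_left _ _))
  · intro i hi
    rw [mem_jobs]
    rcases hmem i hi with rfl | hi | hi
    · exact ⟨Nat.lt_succ_self _, hsr, by linarith⟩
    · have := mem_jobs.1 (h₁.mem_jobs i hi)
      exact ⟨by omega, this.2.1, by linarith [this.2.2]⟩
    · have := mem_jobs.1 (h₂.mem_jobs i hi)
      exact ⟨by omega, by linarith [this.2.1], this.2.2⟩
  · rw [Finset.card_insert_of_notMem (by simp [hj1, hj2]), Finset.card_union_of_disjoint hdis,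
      h₁.card_eq, h₂.card_eq]
    omega
  · intro i hi
    show s ≤ st i ∧ fi i ≤ t
    rcases hmem i hi with rfl | hi | hi
    · rw [st_j, fi_j]
      exact ⟨hsr.trans hrs', hx't⟩
    · rw [st_1 i hi, fi_1 i hi]
      have := h₁.within i hi
      exact ⟨this.1, by linarith [this.2]⟩
    · rw [st_2 i hi, fi_2 i hi]
      have := h₂.within i hi
      exact ⟨by linarith [this.1, le_max_left (σ₂.start i) x'], this.2⟩
  · intro τ hτ
    have h3 : τ < s' := hτ.2.trans_le hxs'
    simp [v, h3, h₁.idle τ hτ]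
  · have hqE : ∫⁻ τ, (Ico s' x').indicator (fun _ => (q : ℝ≥0∞) ^ I.α) τ =
        ENNReal.ofReal (slotCost I (x' - s')) := by
      have hqr : (q : ℝ≥0∞) = ENNReal.ofReal ((I.p : ℝ) / (x' - s')) := by
        rw [ENNReal.ofReal, Real.toNNReal_div (by positivity), Real.toNNReal_natCast]
      have hpp : (0 : ℝ) < I.p := by exact_mod_cast I.p_pos
      rw [lintegral_indicator measurableSet_Ico, setLIntegral_const, Real.volume_Ico, hqr,
        ENNReal.ofReal_rpow_of_pos (div_pos hpp hlen), ← ENNReal.ofReal_mul (by positivity)]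
      congr 1
      rw [slotCost, Real.div_rpow hpp.le hlen.le, Real.rpow_sub_one hlen.ne']
      field_simp
    rw [← hqE]
    unfold Schedule.energy
    rw [← lintegral_add_left (σ₁.measurable_speed.coe_nnreal_ennreal.pow_const _),
      ← lintegral_add_right _ (measurable_const.indicator measurableSet_Ico)]
    -- In each of the three time ranges the glued power is one of the three summands; the other two
    -- are dropped, so only an inequality results.
    refine lintegral_mono fun τ => ?_
    show (v τ : ℝ≥0∞) ^ I.α ≤ _
    by_cases h3 : τ < s'
    · simp only [v, h3, if_true]
      rw [add_assoc]
      exact le_self_add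
    · by_cases h4 : τ < x'
      · simp only [v, h3, h4, if_true, if_false]
        rw [indicator_of_mem (show τ ∈ Ico s' x' from ⟨not_lt.1 h3, h4⟩)]
        exact le_add_self
      · simp only [v, h3, h4, if_false]
        rw [add_assoc]
        exact le_add_left le_self_add

/-- Every finite value comes from an attained choice, so unfolding the recurrence yields a schedule
by repeated gluing. The dates of the state need not be candidates here. -/
theorem exists_schedule_of_dpValue_ne_top {I : Instance} {k : ℕ} (hk : k ≤ I.n) {s x t : ℝ} {u : ℕ}
    (h : dpValue I k s x t u ≠ ⊤) :
    ∃ (S : Finset (Fin I.n)) (σ : Schedule I S), σ.Fits k s x t u ∧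
      σ.energy ≤ dpValue I k s x t u := by
  induction k generalizing s x t u with
  | zero =>
    obtain rfl : u = 0 := by
      by_contra hu
      exact h (by simp [dpValue, hu])
    have hα : 0 < I.α := by linarith [I.one_lt_α]
    refine ⟨∅, ⟨fun _ => 0, measurable_const, fun _ => 0, fun _ => 0, by simp, by simp, by simp,
      by simp⟩, ⟨by simp, by simp, by simp, by simp⟩, ?_⟩
    simp [Schedule.energy, hα]
  | succ k ih =>
    rcases exists_dpTerm_le (j := ⟨k, hk⟩) h with e | ⟨s', -, x', -, hc, l, hl, hle⟩
    · dsimp only at e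
      rw [← e] at h ⊢
      obtain ⟨S, σ, hf, hσ⟩ := ih (by omega) h
      exact ⟨S, σ, ⟨fun j hj => ⟨(hf.mem_jobs j hj).1.trans (Nat.lt_succ_self k),
        (hf.mem_jobs j hj).2⟩, hf.card_eq, hf.within, hf.idle⟩, hσ⟩
    · have hfin := ne_top_of_le_ne_top h hle
      unfold dpTerm at hfin hle
      simp only [ne_eq, ENNReal.add_eq_top, not_or] at hfin
      obtain ⟨S₁, σ₁, hf₁, hσ₁⟩ := ih (by omega) hfin.1.1
      obtain ⟨S₂, σ₂, hf₂, hσ₂⟩ := ih (by omega) hfin.1.2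
      obtain ⟨S, σ, hf, hσ⟩ := exists_glued_schedule hc hl hf₁ hf₂
      exact ⟨S, σ, hf, hσ.trans ((add_le_add_left (add_le_add hσ₁ hσ₂) _).trans hle)⟩

/-- Running each slot of `σ` at constant speed costs no more than `σ`, optimal slots for the same
jobs cost no more than that, and being on the grid they are among those the recurrence takes into
account. -/
theorem Schedule.dpValue_le_energy {I : Instance} {S : Finset (Fin I.n)} (σ : Schedule I S) :
    dpValue I I.n 0 0 I.dmax S.card ≤ σ.energy := by
  obtain ⟨a, c, hs, hle, hmin⟩ := exists_optimal_slots σ.isSlots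
  refine le_trans ?_ ((ENNReal.ofReal_le_ofReal hle).trans σ.totalCost_le)
  have hr : ∀ j, (0 : ℝ) ≤ I.r j := fun j => by positivity
  exact dpValue_le_totalCost hs (fun j hj => IsOptimalSlots.mem_grid ⟨hs, hmin⟩ hj) (fun j _ => j.2)
    (fun j _ => hr j) (fun j hj => (hr j).trans (hs.release j hj))
    fun j hj => (hs.deadline j hj).trans (deadline_le_dmax I j)

theorem dpValue_eq_minEnergy (I : Instance) (u : ℕ) :
    dpValue I I.n 0 0 I.dmax u = minEnergy I I.n 0 0 I.dmax u := by
  rw [minEnergy_eq]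
  apply le_antisymm
  · refine le_sInf ?_
    rintro e ⟨S, σ, hf, rfl⟩
    rw [← hf.card_eq]
    exact σ.dpValue_le_energy
  · by_cases h : dpValue I I.n 0 0 I.dmax u = ⊤
    · rw [h]; exact le_top
    · obtain ⟨S, σ, hf, hσ⟩ := exists_schedule_of_dpValue_ne_top le_rfl h
      exact le_trans (sInf_le (show _ ∈ _ from ⟨S, σ, hf, rfl⟩)) hσ

theorem throughputs_eq (I : Instance) : throughputs I =
    {u : ℕ | u ≤ I.n ∧ dpValue I I.n 0 0 I.dmax u ≤ ENNReal.ofReal I.E} := by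
  ext u
  constructor
  · rintro ⟨S, σ, hσ, rfl⟩
    exact ⟨by simpa using S.card_le_univ, σ.dpValue_le_energy.trans hσ⟩
  · rintro ⟨-, h⟩
    obtain ⟨S, σ, hf, hσ⟩ :=
      exists_schedule_of_dpValue_ne_top le_rfl (ne_top_of_le_ne_top ENNReal.ofReal_ne_top h)
    exact ⟨S, σ, hσ.trans h, hf.card_eq⟩

end SpeedScaling

/-! ### Sizes of the candidate sets -/

namespace SpeedScaling

theorem Instance.n_pos (I : Instance) : 0 < I.n :=
  let ⟨j, _⟩ := I.exists_r_eq_zero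
  j.pos

theorem card_Omega_le (I : Instance) : (Omega I).card ≤ 2 * I.n := by
  refine (Finset.card_union_le _ _).trans ?_
  have h1 := Finset.card_image_le (s := Finset.univ) (f := fun j : Fin I.n => (I.r j : ℝ))
  have h2 := Finset.card_image_le (s := Finset.univ) (f := fun j : Fin I.n => (I.d j : ℝ))
  simp only [Finset.card_univ, Fintype.card_fin] at h1 h2
  omega

theorem card_Theta_le (I : Instance) : (Theta I).card ≤ 8 * I.n ^ 4 := by
  have h1 : ∀ a b, (ThetaOf I a b).card ≤ I.n * (I.n + 1) := by
    intro a b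
    refine (Finset.card_biUnion_le_card_mul _ _ (I.n + 1) fun i hi => ?_).trans (by simp)
    refine Finset.card_image_le.trans ?_
    simpa using (Finset.mem_Icc.1 hi).2
  have h2 : (Theta I).card ≤ (2 * I.n) * ((2 * I.n) * (I.n * (I.n + 1))) := by
    refine (Finset.card_biUnion_le_card_mul _ _ ((2 * I.n) * (I.n * (I.n + 1)))
      fun a _ => ?_).trans (Nat.mul_le_mul_right _ (card_Omega_le I))
    exact (Finset.card_biUnion_le_card_mul _ _ _ fun b _ => h1 a b).trans
      (Nat.mul_le_mul_right _ (card_Omega_le I))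
  refine h2.trans ?_
  have := I.n_pos
  nlinarith [Nat.mul_le_mul_left (4 * I.n ^ 3) (show I.n + 1 ≤ 2 * I.n by omega)]

theorem gridPoint_succ (a b : ℝ) (i h : ℕ) :
    gridPoint a b i (h + 1) = gridPoint a b i h + (b - a) / i := by
  simp only [gridPoint, Nat.cast_add, Nat.cast_one]
  ring

/-- For given `a`, `b`, `i` the successor of `s` is `s + (b - a) / i`, whichever `h` represents `s`.
So each triple contributes at most one date, a factor `n` fewer than for Θ. -/
theorem card_Gamma_le (I : Instance) (s : ℝ) : (Gamma I s).card ≤ 4 * I.n ^ 3 := by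
  have h2 : (Gamma I s).card ≤ (2 * I.n) * ((2 * I.n) * (I.n * 1)) := by
    refine (Finset.card_biUnion_le_card_mul _ _ ((2 * I.n) * (I.n * 1))
      fun a _ => ?_).trans (Nat.mul_le_mul_right _ (card_Omega_le I))
    refine (Finset.card_biUnion_le_card_mul _ _ (I.n * 1) fun b _ => ?_).trans
      (Nat.mul_le_mul_right _ (card_Omega_le I))
    refine (Finset.card_biUnion_le_card_mul _ _ 1 fun i _ => ?_).trans (by simp)
    refine (Finset.card_le_card (t := {s + (b - a) / i}) fun x hx => ?_).trans_eq
      (Finset.card_singleton _)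
    obtain ⟨h, hh, rfl⟩ := Finset.mem_image.1 hx
    rw [Finset.mem_singleton, gridPoint_succ, ← (Finset.mem_filter.1 hh).2]
  refine h2.trans (le_of_eq ?_)
  ring

theorem gammaCard_le (I : Instance) : gammaCard I ≤ 4 * I.n ^ 3 :=
  Finset.sup_le fun s _ => card_Gamma_le I s

theorem card_Gamma_le_gammaCard {I : Instance} {s : ℝ} (hs : s ∈ Theta I) :
    (Gamma I s).card ≤ gammaCard I :=
  Finset.le_sup (f := fun s => (Gamma I s).card) hs

theorem mem_Theta_of_mem_Omega {I : Instance} {a : ℝ} (ha : a ∈ Omega I) : a ∈ Theta I :=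
  mem_Theta.2 ⟨a, ha, a, ha, 1, 0, le_rfl, I.n_pos, by simp, by simp [gridPoint]⟩

/-- For `b = a` the grid degenerates to a point, which is its own successor. This puts `0` into
Γ(0), and with it the states `(n, 0, 0, dmax, u)` into the table. -/
theorem mem_Gamma_of_mem_Omega {I : Instance} {a : ℝ} (ha : a ∈ Omega I) : a ∈ Gamma I a :=
  mem_Gamma.2 ⟨a, ha, a, ha, 1, 0, le_rfl, I.n_pos, by simp, by simp [gridPoint],
    by simp [gridPoint]⟩

theorem zero_mem_Omega (I : Instance) : (0 : ℝ) ∈ Omega I := by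
  obtain ⟨j, hj⟩ := I.exists_r_eq_zero
  have := release_mem_Omega I j
  rwa [hj, Nat.cast_zero] at this

theorem dmax_eq (I : Instance) (h : I.n - 1 < I.n) : I.dmax = (I.d ⟨I.n - 1, h⟩ : ℝ) := by
  refine le_antisymm ?_ (deadline_le_dmax I _)
  unfold Instance.dmax
  rw [Nat.cast_le]
  exact Finset.sup_le fun j _ => I.d_mono (Fin.le_def.2 (Nat.le_sub_one_of_lt j.2))

theorem dmax_mem_Omega (I : Instance) : I.dmax ∈ Omega I := by
  rw [dmax_eq I (Nat.sub_lt I.n_pos one_pos)]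
  exact deadline_mem_Omega I _

theorem dmax_pos (I : Instance) : 0 < I.dmax := by
  have h := Nat.sub_lt I.n_pos one_pos
  rw [dmax_eq I h]
  exact_mod_cast (Nat.zero_le _).trans_lt (I.r_lt_d ⟨I.n - 1, h⟩)

theorem gammaCard_pos (I : Instance) : 0 < gammaCard I :=
  (Finset.card_pos.2 ⟨0, mem_Gamma_of_mem_Omega (zero_mem_Omega I)⟩).trans_le
    (card_Gamma_le_gammaCard (mem_Theta_of_mem_Omega (zero_mem_Omega I)))

/-- The grid with `n` cells between `0` and `dmax` already has `n + 1` points. Thanks to this,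
factors `n + 1` in running times can be absorbed by |Θ|. -/
theorem lt_card_Theta (I : Instance) : I.n < (Theta I).card := by
  have hn : (0 : ℝ) < I.n := by exact_mod_cast I.n_pos
  have hd := dmax_pos I
  have hsub : (Finset.range (I.n + 1)).image (fun h => gridPoint 0 I.dmax I.n h) ⊆ Theta I := by
    intro x hx
    obtain ⟨h, hh, rfl⟩ := Finset.mem_image.1 hx
    exact mem_Theta.2 ⟨0, zero_mem_Omega I, I.dmax, dmax_mem_Omega I, I.n, h, I.n_pos, le_rfl,
      by simpa [Nat.lt_succ_iff] using hh, rfl⟩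
  have := Finset.card_le_card hsub
  rw [Finset.card_image_of_injective, Finset.card_range] at this
  · exact this
  · intro h h' e
    simp only [gridPoint, zero_add, sub_zero] at e
    exact_mod_cast mul_right_cancel₀ (div_pos hd hn).ne' e

/-- The input array holds exactly the dates of `Ω`. -/
theorem mem_Omega_iff {I : Instance} {x : ℝ} :
    x ∈ Omega I ↔ ∃ q < 2 * I.n, (inputState I).rmem q = x := by
  simp only [Omega, Finset.mem_union, Finset.mem_image, Finset.mem_univ, true_and, inputState]
  constructor
  · rintro (⟨j, rfl⟩ | ⟨j, rfl⟩)
    · exact ⟨j, by have := j.2; omega, by simp⟩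
    · exact ⟨I.n + j, by have := j.2; omega, by simp⟩
  · rintro ⟨q, hq, rfl⟩
    by_cases h : q < I.n
    · exact Or.inl ⟨⟨q, h⟩, by simp [h]⟩
    · have h' : q - I.n < I.n := by omega
      exact Or.inr ⟨⟨q - I.n, h'⟩, by simp [h, h']⟩

end SpeedScaling

/-! ## Total correctness with time bounds for the real RAM -/

namespace RealRAM

/-- `c`, started in `σ`, halts within `B` steps in a state satisfying `Q`. -/
def Runs (M : ℕ) (c : Prog) (σ : State) (B : ℕ) (Q : State → Prop) : Prop :=
  ∃ T σ', Exec M c σ T σ' ∧ T ≤ B ∧ Q σ'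

/-- Assignment to an integer register. -/
def State.setI (σ : State) (r v : ℕ) : State := { σ with ireg := Function.update σ.ireg r v }

/-- Assignment to a real register. -/
def State.setR (σ : State) (r : ℕ) (v : ℝ) : State := { σ with rreg := Function.update σ.rreg r v }

/-- Assignment to an integer memory cell. -/
def State.storeI (σ : State) (a v : ℕ) : State := { σ with imem := Function.update σ.imem a v }

/-- Assignment to a real memory cell. -/
def State.storeR (σ : State) (a : ℕ) (v : ℝ) : State :=
  { σ with rmem := Function.update σ.rmem a v }

section
variable (σ : State) (r v : ℕ) (w : ℝ)

@[simp] theorem State.setI_ireg : (σ.setI r v).ireg = Function.update σ.ireg r v := rfl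
@[simp] theorem State.setI_rreg : (σ.setI r v).rreg = σ.rreg := rfl
@[simp] theorem State.setI_imem : (σ.setI r v).imem = σ.imem := rfl
@[simp] theorem State.setI_rmem : (σ.setI r v).rmem = σ.rmem := rfl
@[simp] theorem State.setR_ireg : (σ.setR r w).ireg = σ.ireg := rfl
@[simp] theorem State.setR_rreg : (σ.setR r w).rreg = Function.update σ.rreg r w := rfl
@[simp] theorem State.setR_imem : (σ.setR r w).imem = σ.imem := rfl
@[simp] theorem State.setR_rmem : (σ.setR r w).rmem = σ.rmem := rfl
@[simp] theorem State.storeI_ireg : (σ.storeI r v).ireg = σ.ireg := rfl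
@[simp] theorem State.storeI_rreg : (σ.storeI r v).rreg = σ.rreg := rfl
@[simp] theorem State.storeI_imem : (σ.storeI r v).imem = Function.update σ.imem r v := rfl
@[simp] theorem State.storeI_rmem : (σ.storeI r v).rmem = σ.rmem := rfl
@[simp] theorem State.storeR_ireg : (σ.storeR r w).ireg = σ.ireg := rfl
@[simp] theorem State.storeR_rreg : (σ.storeR r w).rreg = σ.rreg := rfl
@[simp] theorem State.storeR_imem : (σ.storeR r w).imem = σ.imem := rfl
@[simp] theorem State.storeR_rmem : (σ.storeR r w).rmem = Function.update σ.rmem r w := rfl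

end

section Rules
variable {M : ℕ} {σ : State} {B B' : ℕ} {Q Q' : State → Prop}

theorem Runs.mono {c : Prog} (h : Runs M c σ B Q) (hB : B ≤ B') (hQ : ∀ σ', Q σ' → Q' σ') :
    Runs M c σ B' Q' :=
  let ⟨T, σ', h1, h2, h3⟩ := h
  ⟨T, σ', h1, h2.trans hB, hQ _ h3⟩

theorem Runs.skip (hB : 1 ≤ B) (hQ : Q σ) : Runs M Prog.skip σ B Q := ⟨_, _, Exec.skip σ, hB, hQ⟩

theorem Runs.iset {r : ℕ} {e : IExp} (he : e.Safe M σ) (hB : e.cost + 1 ≤ B)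
    (hQ : Q (σ.setI r (e.eval σ))) : Runs M (Prog.iset r e) σ B Q :=
  ⟨_, _, Exec.iset σ r e he, hB, hQ⟩

theorem Runs.rset {r : ℕ} {e : RExp} (he : e.Safe M σ) (hB : e.cost + 1 ≤ B)
    (hQ : Q (σ.setR r (e.eval σ))) : Runs M (Prog.rset r e) σ B Q :=
  ⟨_, _, Exec.rset σ r e he, hB, hQ⟩

theorem Runs.istore {a e : IExp} (ha : a.Safe M σ) (hlt : a.eval σ < M) (he : e.Safe M σ)
    (hB : a.cost + e.cost + 1 ≤ B) (hQ : Q (σ.storeI (a.eval σ) (e.eval σ))) :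
    Runs M (Prog.istore a e) σ B Q :=
  ⟨_, _, Exec.istore σ a e ha hlt he, hB, hQ⟩

theorem Runs.rstore {a : IExp} {e : RExp} (ha : a.Safe M σ) (hlt : a.eval σ < M) (he : e.Safe M σ)
    (hB : a.cost + e.cost + 1 ≤ B) (hQ : Q (σ.storeR (a.eval σ) (e.eval σ))) :
    Runs M (Prog.rstore a e) σ B Q :=
  ⟨_, _, Exec.rstore σ a e ha hlt he, hB, hQ⟩

theorem Runs.seq {c₁ c₂ : Prog} {B₁ B₂ : ℕ}
    (h : Runs M c₁ σ B₁ fun σ₁ => Runs M c₂ σ₁ B₂ Q) : Runs M (Prog.seq c₁ c₂) σ (B₁ + B₂) Q :=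
  let ⟨_, _, h1, h2, _, _, h3, h4, h5⟩ := h
  ⟨_, _, Exec.seq h1 h3, Nat.add_le_add h2 h4, h5⟩

theorem Runs.seq_le {c₁ c₂ : Prog} (B₁ B₂ : ℕ) (hB : B₁ + B₂ ≤ B)
    (h : Runs M c₁ σ B₁ fun σ₁ => Runs M c₂ σ₁ B₂ Q) : Runs M (Prog.seq c₁ c₂) σ B Q :=
  (Runs.seq h).mono hB fun _ h => h

theorem Runs.cond {b : BExp} {c₁ c₂ : Prog} (B₁ : ℕ) (hB : b.cost + 1 + B₁ ≤ B) (hs : b.Safe M σ)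
    (h₁ : b.Holds σ → Runs M c₁ σ B₁ Q) (h₂ : ¬ b.Holds σ → Runs M c₂ σ B₁ Q) :
    Runs M (Prog.cond b c₁ c₂) σ B Q := by
  by_cases hb : b.Holds σ
  · obtain ⟨T, σ', h1, h2, h3⟩ := h₁ hb
    exact ⟨_, _, Exec.cond_true hs hb h1, by omega, h3⟩
  · obtain ⟨T, σ', h1, h2, h3⟩ := h₂ hb
    exact ⟨_, _, Exec.cond_false hs hb h1, by omega, h3⟩

end Rules

/-- The integer registers below `R` have the same contents in both states. -/
def Frame (R : ℕ) (σ σ' : State) : Prop := ∀ q < R, σ'.ireg q = σ.ireg q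

theorem Frame.refl (R : ℕ) (σ : State) : Frame R σ σ := fun _ _ => rfl

theorem Frame.trans {R : ℕ} {σ σ' σ'' : State} (h : Frame R σ σ') (h' : Frame R σ' σ'') :
    Frame R σ σ'' := fun q hq => (h' q hq).trans (h q hq)

theorem Frame.mono {R R' : ℕ} {σ σ' : State} (h : Frame R σ σ') (hR : R' ≤ R) : Frame R' σ σ' :=
  fun q hq => h q (hq.trans_le hR)

theorem Frame.setI {R r v : ℕ} {σ σ' : State} (h : Frame R σ σ') (hr : R ≤ r) :
    Frame R σ (σ'.setI r v) := fun q hq => by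
  rw [State.setI_ireg, Function.update_of_ne (by omega), h q hq]

theorem Frame.of_ireg_eq {R : ℕ} {σ σ' σ'' : State} (h : Frame R σ σ') (he : σ''.ireg = σ'.ireg) :
    Frame R σ σ'' := fun q hq => by rw [he, h q hq]

/-- Predicates on the contents of the real registers, the integer memory and the real memory. -/
abbrev DataPred := (ℕ → ℝ) → (ℕ → ℕ) → (ℕ → ℝ) → Prop

/-- The predicate holds of the data of a state. -/
abbrev DataPred.At (P : DataPred) (σ : State) : Prop := P σ.rreg σ.imem σ.rmem

/-- `for r := 0 to e - 1 do body`. -/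
def forLoop (r : ℕ) (e : IExp) (body : Prog) : Prog :=
  Prog.seq (Prog.iset r (IExp.const 0))
    (Prog.loop (BExp.not (BExp.ile e (IExp.reg r)))
      (Prog.seq body (Prog.iset r (IExp.add (IExp.reg r) (IExp.const 1)))))

/-- The time bound is a constant times `N' * X`, all additive overhead being absorbed through `1 ≤
N' * X`; thus the bounds of nested loops multiply. `N'` is a uniform bound for the number `N` of
rounds, which may depend on outer loop variables. The limit `e` is evaluated anew at each test, so
the invariant has to determine its value. -/
theorem Runs.forLoop {M r N N' K X : ℕ} {e : IExp} {body : Prog} {σ₀ : State} (Inv : ℕ → DataPred)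
    (hNM : N ≤ M) (hN : N ≤ N') (hN' : 0 < N') (hX : 0 < X) (h0 : (Inv 0).At σ₀)
    (he : ∀ i ≤ N, ∀ σ, Frame r σ₀ σ → (Inv i).At σ → e.Safe M σ ∧ e.eval σ = N)
    (hb : ∀ i < N, ∀ σ, Frame r σ₀ σ → σ.ireg r = i → (Inv i).At σ →
      Runs M body σ (K * X) fun σ' => Frame (r + 1) σ σ' ∧ (Inv (i + 1)).At σ') :
    Runs M (forLoop r e body) σ₀ ((K + 2 * e.cost + 14) * (N' * X)) fun σ' =>
      Frame r σ₀ σ' ∧ (Inv N).At σ' := by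
  -- Induction on the number `d` of rounds left.
  have key : ∀ d i, i + d = N → ∀ σ, Frame r σ₀ σ → σ.ireg r = i → (Inv i).At σ →
      Runs M (Prog.loop (BExp.not (BExp.ile e (IExp.reg r)))
        (Prog.seq body (Prog.iset r (IExp.add (IExp.reg r) (IExp.const 1))))) σ
        (d * (K * X + e.cost + 8) + e.cost + 4)
        fun σ' => Frame r σ₀ σ' ∧ (Inv N).At σ' := by
    intro d
    induction d with
    | zero =>
      intro i hi σ hf hr hI
      obtain ⟨hs, hv⟩ := he i (by omega) σ hf hI
      refine ⟨_, _, Exec.loop_false ⟨hs, show σ.ireg r ≤ M by omega⟩ ?_, ?_, hf, ?_⟩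
      · simp only [BExp.Holds, IExp.eval]
        omega
      · simp only [BExp.cost, IExp.cost]
        omega
      · obtain rfl : i = N := by omega
        exact hI
    | succ d ih =>
      intro i hi σ hf hr hI
      obtain ⟨hs, hv⟩ := he i (by omega) σ hf hI
      obtain ⟨T, σ', h1, h2, h3, h4⟩ := hb i (by omega) σ hf hr hI
      have hr' : σ'.ireg r = i := (h3 r (by omega)).trans hr
      obtain ⟨T', σ'', h5, h6, h7⟩ := ih (i + 1) (by omega) (σ'.setI r (i + 1))
        ((hf.trans (h3.mono (by omega))).setI le_rfl) (by simp) h4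
      have hset : Exec M (Prog.iset r (IExp.add (IExp.reg r) (IExp.const 1))) σ' 4
          (σ'.setI r (i + 1)) := by
        have := Exec.iset (M := M) σ' r (IExp.add (IExp.reg r) (IExp.const 1))
          ⟨show σ'.ireg r ≤ M by omega, show 1 ≤ M by omega, show σ'.ireg r + 1 ≤ M by omega⟩
        simp only [IExp.cost, IExp.eval, hr'] at this
        exact this
      refine ⟨_, _, Exec.loop_true ⟨hs, show σ.ireg r ≤ M by omega⟩ ?_ (Exec.seq h1 hset) h5, ?_, h7⟩
      · simp only [BExp.Holds, IExp.eval]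
        omega
      · simp only [BExp.cost, IExp.cost]
        rw [Nat.succ_mul]
        omega
  refine Runs.seq_le 2 (N * (K * X + e.cost + 8) + e.cost + 4) ?_ (Runs.iset (Nat.zero_le _) le_rfl
    (key N 0 (by omega) _ ((Frame.refl r σ₀).setI le_rfl) (by simp [IExp.eval]) h0))
  have h1 : N * (K * X + e.cost + 8) ≤ N' * (K * X + e.cost + 8) := Nat.mul_le_mul_right _ hN
  have h2 : 1 ≤ N' * X := Nat.mul_pos hN' hX
  have h3 : N' ≤ N' * X := Nat.le_mul_of_pos_right _ hX
  have h4 : (e.cost + 8) * N' ≤ (e.cost + 8) * (N' * X) := Nat.mul_le_mul_left _ h3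
  have h5 : (e.cost + 6) * 1 ≤ (e.cost + 6) * (N' * X) := Nat.mul_le_mul_left _ h2
  nlinarith

/-- Four nested `for` loops, with the loop variables in the registers `8, …, 11`. -/
def nest4 (e₁ e₂ e₃ e₄ : IExp) (body : Prog) : Prog :=
  forLoop 8 e₁ (forLoop 9 e₂ (forLoop 10 e₃ (forLoop 11 e₄ body)))

/-- The innermost body of `nest4` is executed for the loop variables `a, b, c, d`. -/
structure AtLoop (σ₀ σ : State) (a b c d : ℕ) : Prop where
  frame : Frame 8 σ₀ σ
  reg8 : σ.ireg 8 = a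
  reg9 : σ.ireg 9 = b
  reg10 : σ.ireg 10 = c
  reg11 : σ.ireg 11 = d

/-- The invariant is indexed by the set of everything that the finished rounds have contributed, so
one statement about the innermost body serves all four levels. The second range may depend on the
first variable, as Γ(s) does on `s`, and the fourth on the third, as the range of `h` does on `i`.
-/
theorem Runs.nest4 {M K X : ℕ} {e₁ e₂ e₃ e₄ : IExp} {body : Prog} {σ₀ : State} {β : Type*}
    (Inv : Set β → DataPred) (A : ℕ → ℕ → ℕ → ℕ → Set β)
    {N₁ N₂' N₃ N₄' : ℕ} {N₂ : ℕ → ℕ} {N₄ : ℕ → ℕ} (hX : 0 < X)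
    (hp₁ : 0 < N₁) (hp₂ : 0 < N₂') (hp₃ : 0 < N₃) (hp₄ : 0 < N₄')
    (hm₁ : N₁ ≤ M) (hm₂ : N₂' ≤ M) (hm₃ : N₃ ≤ M) (hm₄ : N₄' ≤ M)
    (hle₂ : ∀ a < N₁, N₂ a ≤ N₂') (hle₄ : ∀ c < N₃, N₄ c ≤ N₄')
    (h0 : (Inv ∅).At σ₀)
    (he₁ : ∀ D σ, Frame 8 σ₀ σ → (Inv D).At σ → e₁.Safe M σ ∧ e₁.eval σ = N₁)
    (he₂ : ∀ D σ a, Frame 8 σ₀ σ → σ.ireg 8 = a → a < N₁ → (Inv D).At σ →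
      e₂.Safe M σ ∧ e₂.eval σ = N₂ a)
    (he₃ : ∀ D σ, Frame 8 σ₀ σ → (Inv D).At σ → e₃.Safe M σ ∧ e₃.eval σ = N₃)
    (he₄ : ∀ D σ c, Frame 8 σ₀ σ → σ.ireg 10 = c → c < N₃ → (Inv D).At σ →
      e₄.Safe M σ ∧ e₄.eval σ = N₄ c)
    (hb : ∀ D a b c d σ, a < N₁ → b < N₂ a → c < N₃ → d < N₄ c → AtLoop σ₀ σ a b c d →
      (Inv D).At σ →
      Runs M body σ (K * X) fun σ' => Frame 12 σ σ' ∧ (Inv (D ∪ A a b c d)).At σ') :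
    Runs M (nest4 e₁ e₂ e₃ e₄ body) σ₀
      ((K + 2 * e₄.cost + 14 + 2 * e₃.cost + 14 + 2 * e₂.cost + 14 + 2 * e₁.cost + 14) *
        (N₁ * (N₂' * (N₃ * (N₄' * X))))) fun σ' => Frame 8 σ₀ σ' ∧
      (Inv {y | ∃ a < N₁, ∃ b < N₂ a, ∃ c < N₃, ∃ d < N₄ c, y ∈ A a b c d}).At σ' := by
  refine Runs.forLoop (fun i => Inv {y | ∃ a < i, ∃ b < N₂ a, ∃ c < N₃, ∃ d < N₄ c, y ∈ A a b c d})
    hm₁ le_rfl hp₁ (by positivity) ?_ (fun i hi σ hf hI => he₁ _ σ hf hI) ?_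
  · convert h0 using 2
    simp
  intro a ha σ₁ hf₁ hr₁ hI₁
  -- At each level the accumulated set is the union of the contributions of the finished rounds of
  -- this loop and of the loops around it.
  refine (Runs.forLoop (fun i => Inv ({y | ∃ a' < a, ∃ b < N₂ a', ∃ c < N₃, ∃ d < N₄ c,
    y ∈ A a' b c d} ∪ {y | ∃ b < i, ∃ c < N₃, ∃ d < N₄ c, y ∈ A a b c d}))
    ((hle₂ a ha).trans hm₂) (hle₂ a ha) hp₂ (by positivity) ?_ (fun i hi σ hf hI =>
      he₂ _ σ a (hf₁.trans (hf.mono (by norm_num))) ((hf 8 (by norm_num)).trans hr₁) ha hI) ?_).mono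
    le_rfl ?_
  · convert hI₁ using 2
    simp
  swap
  · rintro σ' ⟨h1, h2⟩
    refine ⟨h1, ?_⟩
    convert h2 using 2
    ext y
    simp only [Set.mem_ofPred_eq, Set.mem_union, Nat.lt_succ_iff_lt_or_eq, or_and_right, exists_or,
      exists_eq_left]
  intro b hb₂ σ₂ hf₂ hr₂ hI₂
  refine (Runs.forLoop (fun i => Inv (({y | ∃ a' < a, ∃ b < N₂ a', ∃ c < N₃, ∃ d < N₄ c,
    y ∈ A a' b c d} ∪ {y | ∃ b' < b, ∃ c < N₃, ∃ d < N₄ c, y ∈ A a b' c d}) ∪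
      {y | ∃ c < i, ∃ d < N₄ c, y ∈ A a b c d}))
    hm₃ le_rfl hp₃ (by positivity) ?_ (fun i hi σ hf hI =>
      he₃ _ σ (hf₁.trans ((hf₂.trans (hf.mono (by norm_num))).mono (by norm_num))) hI) ?_).mono
    le_rfl ?_
  · convert hI₂ using 2
    simp
  swap
  · rintro σ' ⟨h1, h2⟩
    refine ⟨h1, ?_⟩
    convert h2 using 2
    ext y
    simp only [Set.mem_ofPred_eq, Set.mem_union, Nat.lt_succ_iff_lt_or_eq, or_and_right, exists_or,
      exists_eq_left, or_assoc]
  intro c hc₃ σ₃ hf₃ hr₃ hI₃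
  have hf13 : Frame 8 σ₀ σ₃ := hf₁.trans ((hf₂.trans (hf₃.mono (by norm_num))).mono (by norm_num))
  refine (Runs.forLoop (fun i => Inv ((({y | ∃ a' < a, ∃ b < N₂ a', ∃ c < N₃, ∃ d < N₄ c,
    y ∈ A a' b c d} ∪ {y | ∃ b' < b, ∃ c < N₃, ∃ d < N₄ c, y ∈ A a b' c d}) ∪
      {y | ∃ c' < c, ∃ d < N₄ c', y ∈ A a b c' d}) ∪ {y | ∃ d < i, y ∈ A a b c d}))
    ((hle₄ c hc₃).trans hm₄) (hle₄ c hc₃) hp₄ hX ?_ (fun i hi σ hf hI =>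
      he₄ _ σ c (hf13.trans (hf.mono (by norm_num))) ((hf 10 (by norm_num)).trans hr₃) hc₃ hI) ?_).mono
    le_rfl ?_
  · convert hI₃ using 2
    simp
  swap
  · rintro σ' ⟨h1, h2⟩
    refine ⟨h1, ?_⟩
    convert h2 using 2
    ext y
    simp only [Set.mem_ofPred_eq, Set.mem_union, Nat.lt_succ_iff_lt_or_eq, or_and_right, exists_or,
      exists_eq_left, or_assoc]
  intro d hd₄ σ₄ hf₄ hr₄ hI₄
  have hr8 : σ₄.ireg 8 = a := by
    rw [hf₄ 8 (by norm_num), hf₃ 8 (by norm_num), hf₂ 8 (by norm_num), hr₁]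
  have hr9 : σ₄.ireg 9 = b := by
    rw [hf₄ 9 (by norm_num), hf₃ 9 (by norm_num), hr₂]
  have hr10 : σ₄.ireg 10 = c := by
    rw [hf₄ 10 (by norm_num), hr₃]
  refine (hb _ a b c d σ₄ ha hb₂ hc₃ hd₄
    ⟨hf13.trans (hf₄.mono (by norm_num)), hr8, hr9, hr10, hr₄⟩ hI₄).mono le_rfl ?_
  rintro σ' ⟨h1, h2⟩
  refine ⟨h1, ?_⟩
  convert h2 using 2
  ext y
  simp only [Set.mem_ofPred_eq, Set.mem_union, Nat.lt_succ_iff_lt_or_eq, or_and_right, exists_or,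
    exists_eq_left, or_assoc]

end RealRAM

/-! ## Duplicate-free arrays -/

namespace RealRAM

/-- The `k` cells of `f` from address `b` on list the elements of `D` without repetition. -/
def Lists (f : ℕ → ℝ) (b k : ℕ) (D : Set ℝ) : Prop :=
  Set.BijOn (fun q => f (b + q)) (Set.Iio k) D

theorem Lists.empty (f : ℕ → ℝ) (b : ℕ) : Lists f b 0 ∅ := by
  have : Set.Iio 0 = (∅ : Set ℕ) := by ext; simp
  rw [Lists, this]
  exact Set.bijOn_empty _

theorem Lists.congr {f f' : ℕ → ℝ} {b k : ℕ} {D : Set ℝ} (h : Lists f b k D)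
    (hf : ∀ q < k, f' (b + q) = f (b + q)) : Lists f' b k D :=
  Set.BijOn.congr h fun q hq => (hf q hq).symm

theorem Lists.mem_iff {f : ℕ → ℝ} {b k : ℕ} {D : Set ℝ} (h : Lists f b k D) {v : ℝ} :
    v ∈ D ↔ ∃ q < k, f (b + q) = v := by
  rw [← h.image_eq]
  rfl

/-- While an array is under construction, only `D ⊆ T` is known; this already bounds the time of a
search and the room needed. -/
theorem Lists.card_le {f : ℕ → ℝ} {b k : ℕ} {D : Set ℝ} (h : Lists f b k D) {T : Finset ℝ}
    (hD : D ⊆ T) : k ≤ T.card := by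
  rw [← Finset.card_range k]
  exact Finset.card_le_card_of_injOn (fun q => f (b + q))
    (fun q hq => hD (h.mapsTo (by simpa using hq))) (by simpa [Set.Iio] using h.injOn)

theorem Lists.card_eq {f : ℕ → ℝ} {b k : ℕ} {T : Finset ℝ} (h : Lists f b k T) : k = T.card := by
  refine le_antisymm (h.card_le subset_rfl) ?_
  rw [← Finset.card_range k]
  refine Finset.card_le_card_of_surjOn (fun q => f (b + q)) ?_
  simpa [Set.Iio] using h.surjOn

theorem Lists.insert {f f' : ℕ → ℝ} {b k : ℕ} {D : Set ℝ} {v : ℝ} (h : Lists f b k D) (hv : v ∉ D)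
    (hf : ∀ q < k, f' (b + q) = f (b + q)) (hf' : f' (b + k) = v) :
    Lists f' b (k + 1) (Set.insert v D) := by
  have h' := h.congr hf
  have hI : Set.Iio (k + 1) = Set.insert k (Set.Iio k) := by
    ext q
    simp only [Set.mem_Iio, Set.insert, Set.mem_ofPred_eq]
    omega
  rw [Lists, hI]
  subst hf'
  exact Set.BijOn.insert h' hv

/-- Equality test. -/
def isEqual (e₁ e₂ : RExp) : BExp := BExp.and (BExp.rle e₁ e₂) (BExp.rle e₂ e₁)

theorem isEqual_holds {σ : State} {e₁ e₂ : RExp} :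
    (isEqual e₁ e₂).Holds σ ↔ e₁.eval σ = e₂.eval σ :=
  le_antisymm_iff.symm

theorem isEqual_safe {M : ℕ} {σ : State} {e₁ e₂ : RExp} (h₁ : e₁.Safe M σ) (h₂ : e₂.Safe M σ) :
    (isEqual e₁ e₂).Safe M σ := ⟨⟨h₁, h₂⟩, h₂, h₁⟩

/-- Append the contents of real register `5` to the array whose base address is in integer register
`12` and whose length is in the integer memory cell given by integer register `13`, unless
the array already contains it. -/
def insertProg : Prog :=
  Prog.seq (Prog.rset 6 (RExp.ofInt (IExp.const 0))) <|
  Prog.seq (forLoop 14 (IExp.load (IExp.reg 13))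
    (Prog.cond (isEqual (RExp.load (IExp.add (IExp.reg 12) (IExp.reg 14))) (RExp.reg 5))
      (Prog.rset 6 (RExp.ofInt (IExp.const 1))) Prog.skip)) <|
  Prog.cond (BExp.rle (RExp.reg 6) (RExp.ofInt (IExp.const 0)))
    (Prog.seq (Prog.rstore (IExp.add (IExp.reg 12) (IExp.load (IExp.reg 13))) (RExp.reg 5))
      (Prog.istore (IExp.reg 13) (IExp.add (IExp.load (IExp.reg 13)) (IExp.const 1))))
    Prog.skip

/-- Linear search, with real register `6` as the flag for a hit. The strict bound `hk` is required
even if nothing is appended, which is why each capacity exceeds the bound on the length by one. -/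
theorem runs_insertProg {M W cap b cl : ℕ} {σ : State} {D : Set ℝ} (hb : σ.ireg 12 = b)
    (hcl : σ.ireg 13 = cl) (hL : Lists σ.rmem b (σ.imem cl) D) (hk : σ.imem cl < cap)
    (hW : σ.imem cl ≤ W) (hW0 : 0 < W) (hcap : b + cap ≤ M) (hclM : cl < M) :
    Runs M insertProg σ (70 * W) fun σ' => Frame 14 σ σ' ∧ (∀ q < 5, σ'.rreg q = σ.rreg q) ∧
      (∀ a, a ≠ cl → σ'.imem a = σ.imem a) ∧
      (∀ a, a < b ∨ b + cap ≤ a → σ'.rmem a = σ.rmem a) ∧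
      Lists σ'.rmem b (σ'.imem cl) (Set.insert (σ.rreg 5) D) := by
  classical
  set k := σ.imem cl with hkdef
  have hr12 : ∀ {σ' : State}, Frame 14 σ σ' → σ'.ireg 12 = b := fun h => (h 12 (by norm_num)).trans hb
  have hr13 : ∀ {σ' : State}, Frame 14 σ σ' → σ'.ireg 13 = cl :=
    fun h => (h 13 (by norm_num)).trans hcl
  refine Runs.seq_le 3 (67 * W) (by omega) (Runs.rset (by simp [RExp.Safe, IExp.Safe]) le_rfl ?_)
  refine Runs.seq_le (48 * W) 19 (by omega) ?_
  refine (Runs.forLoop (M := M) (K := 30) (X := 1) (N := k) (N' := W) (fun i rr im rm => im = σ.imem ∧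
    rm = σ.rmem ∧ (∀ q < 6, rr q = σ.rreg q) ∧
    rr 6 = if ∃ q < i, σ.rmem (b + q) = σ.rreg 5 then 1 else 0)
    (by omega) hW hW0 one_pos ?_ ?_ ?_).mono ?_ ?_
  · refine ⟨rfl, rfl, fun q hq => ?_, ?_⟩
    · simp [Function.update_of_ne (show q ≠ 6 by omega)]
    · simp [RExp.eval, IExp.eval]
  · rintro i hi σ' hf ⟨h1, h2, h3, h4⟩
    have h13 : σ'.ireg 13 = cl := hr13 hf
    simp only [IExp.Safe, IExp.eval, h13, h1]
    refine ⟨⟨?_, hclM, ?_⟩, rfl⟩ <;> omega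
  · rintro i hi σ' hf hr ⟨h1, h2, h3, h4⟩
    have h12 : σ'.ireg 12 = b := hr12 hf
    have hiff : (isEqual (RExp.load (IExp.add (IExp.reg 12) (IExp.reg 14))) (RExp.reg 5)).Holds σ' ↔
        σ.rmem (b + i) = σ.rreg 5 := by
      rw [isEqual_holds]
      simp only [RExp.eval, IExp.eval, h12, hr, h2, h3 5 (by norm_num)]
    refine Runs.cond 3 (by decide) (isEqual_safe ?_ trivial) (fun h => ?_) (fun h => ?_)
    · simp only [RExp.Safe, IExp.Safe, IExp.eval, h12, hr]
      omega
    · refine Runs.rset (show 1 ≤ M by omega) le_rfl ⟨Frame.refl _ _, h1, h2, fun q hq => ?_, ?_⟩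
      · simp [Function.update_of_ne (show q ≠ 6 by omega), h3 q hq]
      · rw [if_pos ⟨i, by omega, hiff.1 h⟩]
        simp [RExp.eval, IExp.eval]
    · refine Runs.skip (by norm_num) ⟨Frame.refl _ _, h1, h2, h3, ?_⟩
      rw [h4]
      congr 1
      rw [hiff] at h
      refine propext ⟨fun ⟨q, hq, e⟩ => ⟨q, by omega, e⟩, fun ⟨q, hq, e⟩ => ⟨q, ?_, e⟩⟩
      rcases Nat.lt_succ_iff_lt_or_eq.1 hq with h' | rfl
      · exact h'
      · exact absurd e h
  · simp only [IExp.cost]; omega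
  rintro σ' ⟨hf, h1, h2, h3, h4⟩
  have h12 : σ'.ireg 12 = b := hr12 hf
  have h13 : σ'.ireg 13 = cl := hr13 hf
  have h5 : σ'.rreg 5 = σ.rreg 5 := h3 5 (by norm_num)
  have hmem : σ.rreg 5 ∈ D ↔ ∃ q < k, σ.rmem (b + q) = σ.rreg 5 := hL.mem_iff
  refine Runs.cond 12 (by decide) ⟨trivial, Nat.zero_le _⟩ (fun h => ?_) (fun h => ?_)
  · have hv : σ.rreg 5 ∉ D := by
      intro hv
      rw [if_pos (hmem.1 hv)] at h4
      simp only [BExp.Holds, RExp.eval, IExp.eval, h4] at h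
      norm_num at h
    refine Runs.seq_le 6 6 le_rfl (Runs.rstore ?_ ?_ trivial (by decide)
      (Runs.istore ?_ ?_ ?_ (by decide) ⟨?_, ?_, ?_, ?_, ?_⟩))
    · simp only [IExp.Safe, IExp.eval, h12, h13, h1]
      omega
    · simp only [IExp.eval, h12, h13, h1]
      omega
    · simp only [IExp.Safe, State.storeR_ireg, h13]
      omega
    · simp only [IExp.eval, State.storeR_ireg, h13]
      omega
    · simp only [IExp.Safe, IExp.eval, State.storeR_ireg, State.storeR_imem, h13, h1]
      omega
    · exact hf
    · intro q hq
      simpa using h3 q (by omega)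
    · intro a ha
      simp [IExp.eval, h13, h1, Function.update_of_ne ha]
    · intro a ha
      simp only [IExp.eval, h12, h13, h1, h2, State.storeI_rmem, State.storeR_rmem, RExp.eval]
      rw [Function.update_of_ne (by omega)]
    · simp only [IExp.eval, h12, h13, h1, h2, h5, State.storeI_rmem, State.storeR_rmem, RExp.eval,
        State.storeI_imem, State.storeR_imem, State.storeR_ireg, Function.update_self, ← hkdef]
      refine hL.insert hv (fun q hq => ?_) ?_
      · rw [Function.update_of_ne (by omega)]
      · rw [Function.update_self]
  · have hv : σ.rreg 5 ∈ D := by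
      by_contra hv
      rw [if_neg (fun e => hv (hmem.2 e))] at h4
      simp [BExp.Holds, RExp.eval, IExp.eval, h4] at h
    refine Runs.skip (by norm_num) ⟨hf, fun q hq => h3 q (by omega), fun a _ => by rw [h1],
      fun a _ => by rw [h2], ?_⟩
    rw [h1, h2, ← hkdef]
    have : Set.insert (σ.rreg 5) D = D := Set.insert_eq_of_mem hv
    rw [this]
    exact hL

end RealRAM

/-! ## Computation of the candidate sets -/

namespace SpeedScaling

open RealRAM

/-- Room for `Θ` in the real memory. -/
def thetaCap (I : Instance) : ℕ := 8 * I.n ^ 4 + 1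

/-- Room for one set `Γ(s)` in the real memory. -/
def gammaCap (I : Instance) : ℕ := 4 * I.n ^ 3 + 1

/-- Address of the array of the sets `Γ(s)`. -/
def gammaBase (I : Instance) : ℕ := 2 * I.n + thetaCap I

/-- Address of the table of the dynamic program. -/
def tableBase (I : Instance) : ℕ := gammaBase I + thetaCap I * gammaCap I

/-- Number of memory cells in use. -/
def numCells (I : Instance) : ℕ :=
  tableBase I + (I.n + 1) * thetaCap I * gammaCap I * thetaCap I * (I.n + 1)

theorem card_Theta_lt_thetaCap (I : Instance) : (Theta I).card < thetaCap I :=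
  Nat.lt_succ_of_le (card_Theta_le I)

theorem card_Gamma_lt_gammaCap (I : Instance) (s : ℝ) : (Gamma I s).card < gammaCap I :=
  Nat.lt_succ_of_le (card_Gamma_le I s)

theorem tableBase_lt_numCells (I : Instance) : tableBase I < numCells I :=
  Nat.lt_add_of_pos_right (by unfold thetaCap gammaCap; positivity)

/-- The parameters of the instance and of the memory layout are in the registers. -/
structure Regs (I : Instance) (σ : State) : Prop where
  reg0 : σ.ireg 0 = I.n
  reg1 : σ.ireg 1 = 2 * I.n
  reg3 : σ.ireg 3 = gammaBase I
  reg4 : σ.ireg 4 = gammaCap I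
  reg5 : σ.ireg 5 = tableBase I
  reg6 : σ.ireg 6 = I.n + 1

theorem Regs.of_frame {I : Instance} {σ σ' : State} {R : ℕ} (h : Regs I σ) (hf : Frame R σ σ')
    (hR : 7 ≤ R) : Regs I σ' where
  reg0 := (hf 0 (by omega)).trans h.reg0
  reg1 := (hf 1 (by omega)).trans h.reg1
  reg3 := (hf 3 (by omega)).trans h.reg3
  reg4 := (hf 4 (by omega)).trans h.reg4
  reg5 := (hf 5 (by omega)).trans h.reg5
  reg6 := (hf 6 (by omega)).trans h.reg6

/-- The real parameters of the instance. -/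
def RealIn (I : Instance) (rr : ℕ → ℝ) : Prop := rr 0 = I.p ∧ rr 1 = I.E ∧ rr 2 = I.α

theorem RealIn.congr {I : Instance} {rr rr' : ℕ → ℝ} (h : RealIn I rr)
    (he : ∀ q < 3, rr' q = rr q) : RealIn I rr' :=
  ⟨(he 0 (by norm_num)).trans h.1, (he 1 (by norm_num)).trans h.2.1,
    (he 2 (by norm_num)).trans h.2.2⟩

/-- The contents of the real memory at the beginning. -/
noncomputable def inp (I : Instance) : ℕ → ℝ := (inputState I).rmem

/-- `n ^ 4`. -/
def pow4Exp : IExp :=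
  IExp.mul (IExp.reg 0) (IExp.mul (IExp.reg 0) (IExp.mul (IExp.reg 0) (IExp.reg 0)))

/-- Computation of the memory layout. -/
def setupProg : Prog :=
  Prog.seq (Prog.iset 1 (IExp.mul (IExp.const 2) (IExp.reg 0))) <|
  Prog.seq (Prog.iset 6 (IExp.add (IExp.reg 0) (IExp.const 1))) <|
  Prog.seq (Prog.iset 7 (IExp.add (IExp.mul (IExp.const 8) pow4Exp) (IExp.const 1))) <|
  Prog.seq (Prog.iset 4 (IExp.add (IExp.mul (IExp.const 4)
    (IExp.mul (IExp.reg 0) (IExp.mul (IExp.reg 0) (IExp.reg 0)))) (IExp.const 1))) <|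
  Prog.seq (Prog.iset 3 (IExp.add (IExp.reg 1) (IExp.reg 7))) <|
  Prog.iset 5 (IExp.add (IExp.reg 3) (IExp.mul (IExp.reg 7) (IExp.reg 4)))

theorem runs_setupProg {I : Instance} {M : ℕ} (hM : numCells I ≤ M) :
    Runs M setupProg (inputState I) 100 fun σ => Regs I σ ∧ RealIn I σ.rreg ∧
      (∀ a, σ.imem a = 0) ∧ σ.rmem = inp I := by
  have hlt := (tableBase_lt_numCells I).trans_le hM
  have hn := I.n_pos
  have hT : thetaCap I = 8 * (I.n * (I.n * (I.n * I.n))) + 1 := by unfold thetaCap; ring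
  have hG : gammaCap I = 4 * (I.n * (I.n * I.n)) + 1 := by unfold gammaCap; ring
  have hTM : gammaBase I + thetaCap I * gammaCap I ≤ M := hlt.le
  have hgb : gammaBase I = 2 * I.n + thetaCap I := rfl
  -- The partial products increase, so all of them fit into the machine once the largest does.
  have h2 : I.n ≤ I.n * I.n := Nat.le_mul_of_pos_left _ hn
  have h3 : I.n * I.n ≤ I.n * (I.n * I.n) := Nat.le_mul_of_pos_left _ hn
  have h4 : I.n * (I.n * I.n) ≤ I.n * (I.n * (I.n * I.n)) := Nat.le_mul_of_pos_left _ hn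
  have hreg : (inputState I).ireg 0 = I.n := rfl
  refine Runs.seq_le 4 96 le_rfl (Runs.iset ?_ (by decide) ?_)
  · simp only [IExp.Safe, IExp.eval, hreg]
    omega
  refine Runs.seq_le 4 92 le_rfl (Runs.iset ?_ (by decide) ?_)
  · simp [IExp.Safe, IExp.eval, hreg]
    omega
  refine Runs.seq_le 12 80 le_rfl (Runs.iset ?_ (by decide) ?_)
  · simp [pow4Exp, IExp.Safe, IExp.eval, hreg]
    omega
  refine Runs.seq_le 10 70 le_rfl (Runs.iset ?_ (by decide) ?_)
  · simp [IExp.Safe, IExp.eval, hreg]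
    omega
  refine Runs.seq_le 10 60 le_rfl (Runs.iset ?_ (by decide) ?_)
  · simp [pow4Exp, IExp.Safe, IExp.eval, hreg]
    omega
  have hTG : thetaCap I * gammaCap I ≤ M := by omega
  have hGM : gammaCap I ≤ M := by omega
  refine Runs.iset ?_ (by decide) ⟨⟨?_, ?_, ?_, ?_, ?_, ?_⟩, ?_, ?_, rfl⟩
  · simp [pow4Exp, IExp.Safe, IExp.eval, hreg, ← hT, ← hG, ← hgb, hTM, hTG, hGM]
    omega
  · simp [hreg]
  · simp [IExp.eval, hreg]
  · simp [pow4Exp, IExp.eval, hreg, hgb, hT]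
  · simp [IExp.eval, hreg, hG]
  · simp [pow4Exp, IExp.eval, hreg, tableBase, hgb, hT, hG]
  · simp [IExp.eval, hreg]
  · simp [RealIn, inputState]
  · simp [inputState]

/-- The date `a + h (b - a) / i`, where registers `8` and `9` hold the addresses of `a` and `b`,
and register `10` holds `i - 1`. -/
def gridExp (h : IExp) : RExp :=
  RExp.add (RExp.load (IExp.reg 8)) (RExp.mul (RExp.ofInt h)
    (RExp.div (RExp.sub (RExp.load (IExp.reg 9)) (RExp.load (IExp.reg 8)))
      (RExp.ofInt (IExp.add (IExp.reg 10) (IExp.const 1)))))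

theorem gridExp_safe {M : ℕ} {σ : State} {h : IExp} (hh : h.Safe M σ) (h8 : σ.ireg 8 < M)
    (h9 : σ.ireg 9 < M) (h10 : σ.ireg 10 < M) : (gridExp h).Safe M σ := by
  simp only [gridExp, RExp.Safe, IExp.Safe, RExp.eval, IExp.eval, hh, true_and, ne_eq,
    Nat.cast_eq_zero]
  omega

theorem gridExp_eval {σ : State} {h : IExp} : (gridExp h).eval σ =
    gridPoint (σ.rmem (σ.ireg 8)) (σ.rmem (σ.ireg 9)) (σ.ireg 10 + 1) (h.eval σ) := rfl

/-- Computation of `Θ`. -/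
def thetaProg : Prog :=
  nest4 (IExp.reg 1) (IExp.reg 1) (IExp.reg 0) (IExp.add (IExp.reg 10) (IExp.const 2)) <|
    Prog.seq (Prog.rset 5 (gridExp (IExp.reg 11))) <|
    Prog.seq (Prog.iset 12 (IExp.reg 1)) <|
    Prog.seq (Prog.iset 13 (IExp.const 0)) insertProg

theorem two_mul_le_gammaBase (I : Instance) : 2 * I.n + thetaCap I ≤ gammaBase I := le_rfl

theorem gammaBase_le_tableBase (I : Instance) : gammaBase I ≤ tableBase I := Nat.le_add_right _ _

/-- At all times the array lists a subset of Θ. Hence its length stays within |Θ|, each insertion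
takes O(|Θ|) steps, and the reserved room suffices. -/
theorem runs_thetaProg {I : Instance} {M : ℕ} (hM : numCells I ≤ M) {σ₀ : State}
    (hR : Regs I σ₀) (hr : RealIn I σ₀.rreg) (hi : ∀ a, σ₀.imem a = 0)
    (hm : ∀ a < 2 * I.n, σ₀.rmem a = inp I a) :
    Runs M thetaProg σ₀ (300 * (2 * I.n * (2 * I.n * (I.n * ((I.n + 1) * (Theta I).card)))))
      fun σ => Frame 8 σ₀ σ ∧ RealIn I σ.rreg ∧ (∀ a, a ≠ 0 → σ.imem a = 0) ∧
        (∀ a < 2 * I.n, σ.rmem a = inp I a) ∧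
        Lists σ.rmem (2 * I.n) (σ.imem 0) (Theta I) := by
  have hn := I.n_pos
  have hMlt := (tableBase_lt_numCells I).trans_le hM
  have hg := gammaBase_le_tableBase I
  have h2 := two_mul_le_gammaBase I
  have hcap := card_Theta_lt_thetaCap I
  have hcard := lt_card_Theta I
  refine (Runs.nest4 (M := M) (K := 160) (X := (Theta I).card)
    (fun D rr im rm => RealIn I rr ∧ (∀ a, a ≠ 0 → im a = 0) ∧ (∀ a < 2 * I.n, rm a = inp I a) ∧
      D ⊆ Theta I ∧ Lists rm (2 * I.n) (im 0) D)
    (fun a b c d => {gridPoint (inp I a) (inp I b) (c + 1) d})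
    (N₁ := 2 * I.n) (N₂' := 2 * I.n) (N₂ := fun _ => 2 * I.n) (N₃ := I.n) (N₄' := I.n + 1)
    (N₄ := fun c => c + 2) (by omega) (by omega) (by omega) hn (by omega) (by omega) (by omega)
    (by omega) (by omega) (fun _ _ => le_rfl) (fun c hc => by omega) ?_ ?_ ?_ ?_ ?_ ?_).mono ?_ ?_
  · exact ⟨hr, fun a _ => hi a, hm, by simp, by rw [hi]; exact Lists.empty _ _⟩
  · intro D σ hf hI
    simp only [IExp.Safe, IExp.eval, (hR.of_frame hf (by norm_num)).reg1, and_true]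
    omega
  · intro D σ a hf ha haN hI
    simp only [IExp.Safe, IExp.eval, (hR.of_frame hf (by norm_num)).reg1, and_true]
    omega
  · intro D σ hf hI
    simp only [IExp.Safe, IExp.eval, (hR.of_frame hf (by norm_num)).reg0, and_true]
    omega
  · intro D σ c hf hc hcN hI
    simp only [IExp.Safe, IExp.eval, hc, and_true]
    omega
  · rintro D a b c d σ ha hb hc hd hat ⟨h1, h2, h3, h4, h5⟩
    have hR' := hR.of_frame hat.frame (by norm_num)
    have hv : (gridExp (IExp.reg 11)).eval σ = gridPoint (inp I a) (inp I b) (c + 1) d := by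
      rw [gridExp_eval, hat.reg8, hat.reg9, hat.reg10, h3 a ha, h3 b hb]
      simp only [IExp.eval, hat.reg11]
    have hle := h5.card_le h4
    refine Runs.seq_le 17 (143 * (Theta I).card) (by omega) (Runs.rset (gridExp_safe
      (show σ.ireg 11 ≤ M by rw [hat.reg11]; omega) (by rw [hat.reg8]; omega)
      (by rw [hat.reg9]; omega) (by rw [hat.reg10]; omega)) (by decide) ?_)
    refine Runs.seq_le 2 (141 * (Theta I).card) (by omega) (Runs.iset (by
      simp only [IExp.Safe, State.setR_ireg, hR'.reg1]; omega) (by decide) ?_)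
    refine Runs.seq_le 2 (139 * (Theta I).card) (by omega) (Runs.iset (Nat.zero_le _) (by decide) ?_)
    refine (runs_insertProg (b := 2 * I.n) (cl := 0) (cap := thetaCap I) (D := D)
      (W := (Theta I).card) (by simp [IExp.eval, hR'.reg1])
      (by simp [IExp.eval]) (by simpa using h5) (by simpa using hle.trans_lt hcap) (by simpa using hle)
      (by omega) (by omega) (by omega)).mono (by omega) ?_
    rintro σ' ⟨g1, g2, g3, g4, g5⟩
    simp only [State.setI_rreg, State.setR_rreg, State.setI_imem, State.setR_imem, State.setI_rmem,
      State.setR_rmem, Function.update_self, hv] at g2 g3 g4 g5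
    have hins : D ∪ {gridPoint (inp I a) (inp I b) (c + 1) d} =
        Set.insert (gridPoint (inp I a) (inp I b) (c + 1) d) D := by
      rw [Set.union_comm]; rfl
    refine ⟨((((Frame.refl 12 σ).of_ireg_eq (State.setR_ireg _ _ _)).setI (le_refl 12)).setI
      (by norm_num : 12 ≤ 13)).trans (g1.mono (by norm_num)), h1.congr fun q hq => ?_, fun q hq => ?_,
      fun q hq => ?_, ?_, ?_⟩
    · rw [g2 q (by omega), Function.update_of_ne (by omega)]
    · rw [g3 q hq, h2 q hq]
    · rw [g4 q (Or.inl hq), h3 q hq]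
    · refine Set.union_subset h4 (Set.singleton_subset_iff.2 ?_)
      exact mem_Theta.2 ⟨_, mem_Omega_iff.2 ⟨a, ha, rfl⟩, _, mem_Omega_iff.2 ⟨b, hb, rfl⟩, c + 1, d,
        by omega, by omega, by omega, rfl⟩
    · rw [hins]
      exact g5
  · simp only [IExp.cost]
    exact Nat.mul_le_mul_right _ (by norm_num)
  · rintro σ ⟨hf, h1, h2, h3, h4, h5⟩
    refine ⟨hf, h1, h2, h3, ?_⟩
    -- The third loop variable `c` starts at `0` and stands for the denominator `i = c + 1`;
    -- accordingly `h ≤ i` reads `d < c + 2`.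
    convert h5 using 1
    ext x
    rw [Finset.mem_coe, mem_Theta]
    simp only [Set.mem_ofPred_eq, Set.mem_singleton_iff]
    constructor
    · rintro ⟨u, hu, v, hv, i, h, hi1, hin, hh, rfl⟩
      obtain ⟨a, ha, rfl⟩ := mem_Omega_iff.1 hu
      obtain ⟨b, hb, rfl⟩ := mem_Omega_iff.1 hv
      refine ⟨a, ha, b, hb, i - 1, by omega, h, by omega, ?_⟩
      rw [Nat.sub_add_cancel hi1]
      rfl
    · rintro ⟨a, ha, b, hb, c, hc, d, hd, rfl⟩
      exact ⟨_, mem_Omega_iff.2 ⟨a, ha, rfl⟩, _, mem_Omega_iff.2 ⟨b, hb, rfl⟩, c + 1, d,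
        by omega, by omega, by omega, rfl⟩

end SpeedScaling

/-! ### Computation of the sets Γ(s) -/

namespace SpeedScaling

open RealRAM

/-- Computation of one set `Γ(s)`, for the date `s` whose index is in register `7`. -/
def gammaRowProg : Prog :=
  nest4 (IExp.reg 1) (IExp.reg 1) (IExp.reg 0) (IExp.add (IExp.reg 10) (IExp.const 2)) <|
    Prog.cond (isEqual (RExp.load (IExp.add (IExp.reg 1) (IExp.reg 7))) (gridExp (IExp.reg 11)))
      (Prog.seq (Prog.rset 5 (gridExp (IExp.add (IExp.reg 11) (IExp.const 1)))) <|
       Prog.seq (Prog.iset 12 (IExp.add (IExp.reg 3) (IExp.mul (IExp.reg 7) (IExp.reg 4)))) <|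
       Prog.seq (Prog.iset 13 (IExp.add (IExp.reg 7) (IExp.const 1))) insertProg)
      Prog.skip

/-- Computation of all sets `Γ(s)`, `s ∈ Θ`. -/
def gammaProg : Prog := forLoop 7 (IExp.reg 2) gammaRowProg

theorem gammaRow_le {I : Instance} {s : ℕ} (hs : s < (Theta I).card) :
    gammaBase I + s * gammaCap I + gammaCap I ≤ tableBase I := by
  have := Nat.mul_le_mul_right (gammaCap I) (show s + 1 ≤ thetaCap I by
    have := card_Theta_lt_thetaCap I; omega)
  rw [Nat.succ_mul] at this
  unfold tableBase
  omega

theorem Lists.mem_Theta {I : Instance} {f : ℕ → ℝ} {b : ℕ} (h : Lists f b (Theta I).card (Theta I))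
    {s : ℕ} (hs : s < (Theta I).card) : f (b + s) ∈ Theta I :=
  h.mapsTo (Set.mem_Iio.2 hs)

/-- Exact comparison of reals decides whether `s` is a given grid point. The length of row `s` is
kept in integer cell `s + 1`, since cell `0` holds |Θ|. Only the memory before the row is claimed to
be unchanged, which is enough because the rows are filled in increasing order. -/
theorem runs_gammaRowProg {I : Instance} {M : ℕ} (hM : numCells I ≤ M) {σ₀ : State} {s : ℕ}
    (hR : Regs I σ₀) (h7 : σ₀.ireg 7 = s) (hs : s < (Theta I).card) (hr : RealIn I σ₀.rreg)
    (hi : σ₀.imem (s + 1) = 0) (hm : ∀ a < 2 * I.n, σ₀.rmem a = inp I a)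
    (hL : Lists σ₀.rmem (2 * I.n) (Theta I).card (Theta I)) :
    Runs M gammaRowProg σ₀ (300 * (2 * I.n * (2 * I.n * (I.n * ((I.n + 1) * gammaCard I)))))
      fun σ => Frame 8 σ₀ σ ∧ RealIn I σ.rreg ∧ (∀ a, a ≠ s + 1 → σ.imem a = σ₀.imem a) ∧
        (∀ a, a < gammaBase I + s * gammaCap I → σ.rmem a = σ₀.rmem a) ∧
        Lists σ.rmem (gammaBase I + s * gammaCap I) (σ.imem (s + 1))
          (Gamma I (σ₀.rmem (2 * I.n + s))) := by
  have hn := I.n_pos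
  have hMlt := (tableBase_lt_numCells I).trans_le hM
  have hg := gammaBase_le_tableBase I
  have h2 := two_mul_le_gammaBase I
  have hcap := card_Theta_lt_thetaCap I
  have hcard := lt_card_Theta I
  have hgp := gammaCard_pos I
  have hrow := gammaRow_le hs
  set θ := σ₀.rmem (2 * I.n + s) with hθ
  have hθm : θ ∈ Theta I := Lists.mem_Theta hL hs
  have hΓ := card_Gamma_le_gammaCard hθm
  have hΓc := card_Gamma_lt_gammaCap I θ
  have hsG : s ≤ s * gammaCap I := Nat.le_mul_of_pos_right _ (by unfold gammaCap; omega)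
  refine (Runs.nest4 (M := M) (K := 195) (X := gammaCard I)
    (fun D rr im rm => RealIn I rr ∧ (∀ a, a ≠ s + 1 → im a = σ₀.imem a) ∧
      (∀ a, a < gammaBase I + s * gammaCap I → rm a = σ₀.rmem a) ∧
      D ⊆ Gamma I θ ∧ Lists rm (gammaBase I + s * gammaCap I) (im (s + 1)) D)
    (fun a b c d => {x | θ = gridPoint (inp I a) (inp I b) (c + 1) d ∧
      x = gridPoint (inp I a) (inp I b) (c + 1) (d + 1)})
    (N₁ := 2 * I.n) (N₂' := 2 * I.n) (N₂ := fun _ => 2 * I.n) (N₃ := I.n) (N₄' := I.n + 1)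
    (N₄ := fun c => c + 2) (by omega) (by omega) (by omega) hn (by omega) (by omega) (by omega)
    (by omega) (by omega) (fun _ _ => le_rfl) (fun c hc => by omega) ?_ ?_ ?_ ?_ ?_ ?_).mono ?_ ?_
  · exact ⟨hr, fun _ _ => rfl, fun _ _ => rfl, by simp, by rw [hi]; exact Lists.empty _ _⟩
  · intro D σ hf hI
    simp only [IExp.Safe, IExp.eval, (hR.of_frame hf (by norm_num)).reg1, and_true]
    omega
  · intro D σ a hf ha haN hI
    simp only [IExp.Safe, IExp.eval, (hR.of_frame hf (by norm_num)).reg1, and_true]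
    omega
  · intro D σ hf hI
    simp only [IExp.Safe, IExp.eval, (hR.of_frame hf (by norm_num)).reg0, and_true]
    omega
  · intro D σ c hf hc hcN hI
    simp only [IExp.Safe, IExp.eval, hc, and_true]
    omega
  · rintro D a b c d σ ha hb hc hd hat ⟨h1, h2', h3, h4, h5⟩
    have hR' := hR.of_frame hat.frame (by norm_num)
    have h7' : σ.ireg 7 = s := (hat.frame 7 (by norm_num)).trans h7
    have ha' : σ.rmem a = inp I a := by rw [h3 a (by omega), hm a ha]
    have hb' : σ.rmem b = inp I b := by rw [h3 b (by omega), hm b hb]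
    have hθ' : σ.rmem (2 * I.n + s) = θ := h3 _ (by omega)
    have hv : (gridExp (IExp.reg 11)).eval σ = gridPoint (inp I a) (inp I b) (c + 1) d := by
      rw [gridExp_eval, hat.reg8, hat.reg9, hat.reg10, ha', hb']
      simp only [IExp.eval, hat.reg11]
    have hv' : (gridExp (IExp.add (IExp.reg 11) (IExp.const 1))).eval σ =
        gridPoint (inp I a) (inp I b) (c + 1) (d + 1) := by
      rw [gridExp_eval, hat.reg8, hat.reg9, hat.reg10, ha', hb']
      simp only [IExp.eval, hat.reg11]
    have hle := h5.card_le h4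
    have hiff : (isEqual (RExp.load (IExp.add (IExp.reg 1) (IExp.reg 7)))
        (gridExp (IExp.reg 11))).Holds σ ↔ θ = gridPoint (inp I a) (inp I b) (c + 1) d := by
      rw [isEqual_holds, hv]
      simp only [RExp.eval, IExp.eval, hR'.reg1, h7', hθ']
    have h11 : σ.ireg 11 ≤ M := by rw [hat.reg11]; omega
    have h8M : σ.ireg 8 < M := by rw [hat.reg8]; omega
    have h9M : σ.ireg 9 < M := by rw [hat.reg9]; omega
    have h10M : σ.ireg 10 < M := by rw [hat.reg10]; omega
    refine Runs.cond (110 * gammaCard I) ?_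
      (isEqual_safe ?_ (gridExp_safe h11 h8M h9M h10M)) (fun h => ?_) (fun h => ?_)
    · exact le_trans (Nat.add_le_add_right (m := 85) (by decide) _) (by omega)
    · simp only [RExp.Safe, IExp.Safe, IExp.eval, hR'.reg1, h7']
      omega
    · have hx : gridPoint (inp I a) (inp I b) (c + 1) (d + 1) ∈ Gamma I θ :=
        mem_Gamma.2 ⟨_, mem_Omega_iff.2 ⟨a, ha, rfl⟩, _, mem_Omega_iff.2 ⟨b, hb, rfl⟩, c + 1, d,
          by omega, by omega, by omega, hiff.1 h, rfl⟩
      refine Runs.seq_le 19 (91 * gammaCard I) (by omega) (Runs.rset (gridExp_safe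
        (by simp only [IExp.Safe, IExp.eval, hat.reg11]; omega) h8M h9M h10M) (by decide) ?_)
      refine Runs.seq_le 6 (85 * gammaCard I) (by omega) (Runs.iset (by
        simp only [IExp.Safe, IExp.eval, State.setR_ireg, hR'.reg3, hR'.reg4, h7']; omega)
        (by decide) ?_)
      refine Runs.seq_le 4 (81 * gammaCard I) (by omega) (Runs.iset (by
        simp only [IExp.Safe, IExp.eval, State.setI_ireg, State.setR_ireg,
          Function.update_of_ne (show (7 : ℕ) ≠ 12 by norm_num), h7']; omega) (by decide) ?_)
      refine (runs_insertProg (b := gammaBase I + s * gammaCap I) (cl := s + 1) (cap := gammaCap I)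
        (D := D) (W := gammaCard I) (by simp [IExp.eval, hR'.reg3, hR'.reg4, h7'])
        (by simp [IExp.eval, h7']) (by simpa using h5) (by simpa using hle.trans_lt hΓc)
        (by simpa using hle.trans hΓ) hgp (by omega) (by omega)).mono (by omega) ?_
      rintro σ' ⟨g1, g2, g3, g4, g5⟩
      simp only [State.setI_rreg, State.setR_rreg, State.setI_imem, State.setR_imem,
        State.setI_rmem, State.setR_rmem, Function.update_self, hv'] at g2 g3 g4 g5
      have hins : D ∪ {x | θ = gridPoint (inp I a) (inp I b) (c + 1) d ∧
          x = gridPoint (inp I a) (inp I b) (c + 1) (d + 1)} =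
          Set.insert (gridPoint (inp I a) (inp I b) (c + 1) (d + 1)) D := by
        ext x
        simp only [← hiff.1 h, true_and, Set.mem_union, Set.mem_ofPred_eq, Set.insert]
        exact or_comm
      refine ⟨((((Frame.refl 12 σ).of_ireg_eq (State.setR_ireg _ _ _)).setI (le_refl 12)).setI
        (by norm_num : 12 ≤ 13)).trans (g1.mono (by norm_num)), h1.congr fun q hq => ?_,
        fun q hq => ?_, fun q hq => ?_, ?_, ?_⟩
      · rw [g2 q (by omega), Function.update_of_ne (by omega)]
      · rw [g3 q hq, h2' q hq]
      · rw [g4 q (Or.inl hq), h3 q hq]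
      · rw [hins]
        exact Set.insert_subset hx h4
      · rw [hins]
        exact g5
    · have hD : D ∪ {x | θ = gridPoint (inp I a) (inp I b) (c + 1) d ∧
          x = gridPoint (inp I a) (inp I b) (c + 1) (d + 1)} = D := by
        rw [hiff] at h
        simp [h]
      refine Runs.skip (by omega) ⟨Frame.refl _ _, ?_⟩
      rw [hD]
      exact ⟨h1, h2', h3, h4, h5⟩
  · simp only [IExp.cost]
    exact Nat.mul_le_mul_right _ (by norm_num)
  · rintro σ ⟨hf, h1, h2, h3, h4, h5⟩
    refine ⟨hf, h1, h2, h3, ?_⟩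
    convert h5 using 1
    ext x
    rw [Finset.mem_coe, mem_Gamma]
    simp only [Set.mem_ofPred_eq]
    constructor
    · rintro ⟨u, hu, v, hv, i, h, hi1, hin, hh, h1, rfl⟩
      obtain ⟨a, ha, rfl⟩ := mem_Omega_iff.1 hu
      obtain ⟨b, hb, rfl⟩ := mem_Omega_iff.1 hv
      refine ⟨a, ha, b, hb, i - 1, by omega, h, by omega, ?_⟩
      rw [Nat.sub_add_cancel hi1]
      exact ⟨h1, rfl⟩
    · rintro ⟨a, ha, b, hb, c, hc, d, hd, h1, rfl⟩
      exact ⟨_, mem_Omega_iff.2 ⟨a, ha, rfl⟩, _, mem_Omega_iff.2 ⟨b, hb, rfl⟩, c + 1, d,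
        by omega, by omega, by omega, h1, rfl⟩

theorem runs_gammaProg {I : Instance} {M : ℕ} (hM : numCells I ≤ M) {σ₀ : State}
    (hR : Regs I σ₀) (h2 : σ₀.ireg 2 = (Theta I).card) (hr : RealIn I σ₀.rreg)
    (hi : ∀ a, a ≠ 0 → σ₀.imem a = 0) (hm : ∀ a < 2 * I.n, σ₀.rmem a = inp I a)
    (hL : Lists σ₀.rmem (2 * I.n) (Theta I).card (Theta I)) :
    Runs M gammaProg σ₀ (320 * ((Theta I).card *
        (2 * I.n * (2 * I.n * (I.n * ((I.n + 1) * gammaCard I))))))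
      fun σ => Frame 7 σ₀ σ ∧ RealIn I σ.rreg ∧
        (∀ a < gammaBase I, σ.rmem a = σ₀.rmem a) ∧
        ∀ s < (Theta I).card, Lists σ.rmem (gammaBase I + s * gammaCap I) (σ.imem (s + 1))
          (Gamma I (σ₀.rmem (2 * I.n + s))) := by
  have hn := I.n_pos
  have hMlt := (tableBase_lt_numCells I).trans_le hM
  have hg := gammaBase_le_tableBase I
  have hb := two_mul_le_gammaBase I
  have hcap := card_Theta_lt_thetaCap I
  have hcard := lt_card_Theta I
  have hgp := gammaCard_pos I
  -- The lengths of the rows still to come are `0`, so each of them starts as an empty array.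
  refine (Runs.forLoop (M := M) (K := 300)
    (X := 2 * I.n * (2 * I.n * (I.n * ((I.n + 1) * gammaCard I)))) (N := (Theta I).card)
    (N' := (Theta I).card) (fun i rr im rm => RealIn I rr ∧ (∀ a, i < a → im a = 0) ∧
      (∀ a < gammaBase I, rm a = σ₀.rmem a) ∧
      ∀ s < i, Lists rm (gammaBase I + s * gammaCap I) (im (s + 1))
        (Gamma I (σ₀.rmem (2 * I.n + s)))) (by omega) le_rfl (by omega) (by positivity) ?_ ?_ ?_).mono
    ?_ ?_
  · exact ⟨hr, fun a ha => hi a (by omega), fun _ _ => rfl, fun s hs => absurd hs (by omega)⟩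
  · rintro i hi' σ hf -
    simp only [IExp.Safe, IExp.eval, hf 2 (by norm_num), h2, and_true]
    omega
  · rintro s hs σ hf h7 ⟨h1, h3, h4, h5⟩
    have hθ : σ.rmem (2 * I.n + s) = σ₀.rmem (2 * I.n + s) := h4 _ (by omega)
    refine (runs_gammaRowProg hM (hR.of_frame hf (by norm_num)) h7 hs h1 (h3 _ (by omega))
      (fun a ha => (h4 a (by omega)).trans (hm a ha))
      (hL.congr fun q hq => h4 _ (by omega))).mono le_rfl ?_
    rintro σ' ⟨g1, g2, g3, g4, g5⟩
    refine ⟨g1, g2, fun a ha => ?_, fun a ha => ?_, fun s' hs' => ?_⟩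
    · rw [g3 a (by omega), h3 a (by omega)]
    · rw [g4 a (by omega), h4 a ha]
    · rcases Nat.lt_succ_iff_lt_or_eq.1 hs' with hlt | rfl
      · have hrow := Nat.mul_le_mul_right (gammaCap I) (show s' + 1 ≤ s by omega)
        rw [Nat.succ_mul] at hrow
        have hL' := h5 s' hlt
        have hk := hL'.card_eq.trans_lt (card_Gamma_lt_gammaCap I _)
        rw [g3 (s' + 1) (by omega)]
        exact hL'.congr fun q hq => g4 _ (by omega)
      · rw [← hθ]
        exact g5
  · simp only [IExp.cost]
    exact Nat.mul_le_mul_right _ (by norm_num)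
  · rintro σ ⟨hf, h1, -, h3, h4⟩
    exact ⟨hf, h1, h3, h4⟩

end SpeedScaling

/-! ## Layout of the table and loops over it -/

namespace SpeedScaling

open RealRAM

/-- Address of the entry of the table with the given indices. -/
noncomputable def cell (I : Instance) (k s x t u : ℕ) : ℕ :=
  tableBase I + ((((k * (Theta I).card + s) * gammaCap I + x) * (Theta I).card + t) * (I.n + 1) + u)

theorem mul_add_lt_mul {a b m P B : ℕ} (ha : a < P) (hb : b < m) (hm : m ≤ B) :
    a * m + b < P * B :=
  calc a * m + b < (a + 1) * m := by rw [Nat.succ_mul]; omega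
    _ ≤ P * B := Nat.mul_le_mul ha hm

theorem mul_add_inj {a a' b b' m : ℕ} (hb : b < m) (hb' : b' < m)
    (h : a * m + b = a' * m + b') : a = a' ∧ b = b' := by
  have hm : 0 < m := by omega
  have h1 := congrArg (· / m) h
  have h2 := congrArg (· % m) h
  simp only [Nat.mul_add_mod_of_lt hb, Nat.mul_add_mod_of_lt hb'] at h2
  simp only [Nat.add_div_of_dvd_right (Dvd.intro_left a rfl),
    Nat.add_div_of_dvd_right (Dvd.intro_left a' rfl), Nat.mul_div_cancel _ hm,
    Nat.div_eq_of_lt hb, Nat.div_eq_of_lt hb', add_zero] at h1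
  exact ⟨h1, h2⟩

/-- Up to the base address, a cell is a number in mixed radix with leading digit `k`, recovered
digit by digit through division with remainder. The leading digit needs no bound. -/
theorem cell_inj {I : Instance} {k s x t u k' s' x' t' u' : ℕ} (hs : s < (Theta I).card)
    (hs' : s' < (Theta I).card) (hx : x < gammaCap I) (hx' : x' < gammaCap I)
    (ht : t < (Theta I).card) (ht' : t' < (Theta I).card) (hu : u ≤ I.n) (hu' : u' ≤ I.n)
    (h : cell I k s x t u = cell I k' s' x' t' u') :
    k = k' ∧ s = s' ∧ x = x' ∧ t = t' ∧ u = u' := by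
  obtain ⟨h1, rfl⟩ := mul_add_inj (Nat.lt_succ_of_le hu) (Nat.lt_succ_of_le hu')
    (Nat.add_left_cancel h)
  obtain ⟨h2, rfl⟩ := mul_add_inj ht ht' h1
  obtain ⟨h3, rfl⟩ := mul_add_inj hx hx' h2
  obtain ⟨rfl, rfl⟩ := mul_add_inj hs hs' h3
  exact ⟨rfl, rfl, rfl, rfl, rfl⟩

/-- The expression that computes the address of an entry of the table. -/
def cellExp (k s x t u : IExp) : IExp :=
  IExp.add (IExp.reg 5) (IExp.add (IExp.mul (IExp.add (IExp.mul (IExp.add (IExp.mul (IExp.add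
    (IExp.mul k (IExp.reg 2)) s) (IExp.reg 4)) x) (IExp.reg 2)) t) (IExp.reg 6)) u)

theorem cell_lt {I : Instance} {k s x t u : ℕ} (hk : k ≤ I.n) (hs : s < (Theta I).card)
    (hx : x < gammaCap I) (ht : t < (Theta I).card) (hu : u ≤ I.n) :
    cell I k s x t u < numCells I := by
  have hcap := (card_Theta_lt_thetaCap I).le
  exact Nat.add_lt_add_left (mul_add_lt_mul (mul_add_lt_mul (mul_add_lt_mul (mul_add_lt_mul
    (Nat.lt_succ_of_le hk) hs hcap) hx le_rfl) ht hcap) (Nat.lt_succ_of_le hu) le_rfl) _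

theorem cellExp_spec {I : Instance} {M : ℕ} (hM : numCells I ≤ M) {σ : State} (hR : Regs I σ)
    (h2 : σ.ireg 2 = (Theta I).card) {k s x t u : ℕ} {ek es ex et eu : IExp}
    (hk : k ≤ I.n) (hs : s < (Theta I).card) (hx : x < gammaCap I) (ht : t < (Theta I).card)
    (hu : u ≤ I.n) (hek : ek.Safe M σ) (hes : es.Safe M σ) (hex : ex.Safe M σ) (het : et.Safe M σ)
    (heu : eu.Safe M σ) (vk : ek.eval σ = k) (vs : es.eval σ = s) (vx : ex.eval σ = x)
    (vt : et.eval σ = t) (vu : eu.eval σ = u) :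
    (cellExp ek es ex et eu).Safe M σ ∧ (cellExp ek es ex et eu).eval σ = cell I k s x t u ∧
      (cellExp ek es ex et eu).eval σ < M := by
  have hv : (cellExp ek es ex et eu).eval σ = cell I k s x t u := by
    simp only [cellExp, IExp.eval, hR.reg4, hR.reg5, hR.reg6, h2, vk, vs, vx, vt, vu, cell]
  have hlt := (cell_lt hk hs hx ht hu).trans_le hM
  refine ⟨?_, hv, hv ▸ hlt⟩
  unfold cell at hlt
  have hm : 0 < (Theta I).card := by omega
  have hG : 0 < gammaCap I := by omega
  -- Horner evaluation never decreases: each intermediate value is at most the final address and so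
  -- stays within `M`.
  have e1 : (k * (Theta I).card + s) ≤ (k * (Theta I).card + s) * gammaCap I :=
    Nat.le_mul_of_pos_right _ hG
  have e2 : (k * (Theta I).card + s) * gammaCap I + x ≤
      ((k * (Theta I).card + s) * gammaCap I + x) * (Theta I).card := Nat.le_mul_of_pos_right _ hm
  have e3 : ((k * (Theta I).card + s) * gammaCap I + x) * (Theta I).card + t ≤
      (((k * (Theta I).card + s) * gammaCap I + x) * (Theta I).card + t) * (I.n + 1) :=
    Nat.le_mul_of_pos_right _ (by omega)
  have hb := gammaBase_le_tableBase I
  have hb' := two_mul_le_gammaBase I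
  have hcap := card_Theta_lt_thetaCap I
  have hn := lt_card_Theta I
  have hG' : gammaCap I ≤ thetaCap I * gammaCap I := Nat.le_mul_of_pos_left _ (by omega)
  have hG'' : gammaBase I + thetaCap I * gammaCap I = tableBase I := rfl
  simp only [cellExp, IExp.Safe, IExp.eval, hR.reg4, hR.reg5, hR.reg6, h2, vk, vs, vx, vt, vu,
    hek, hes, hex, het, heu, true_and]
  constructorm* _ ∧ _ <;> omega

/-- A memory that extends `f` by the values of a function at the cells of the table. -/
theorem exists_memory (I : Instance) (f : ℕ → ℝ) (V : ℕ → ℕ → ℕ → ℕ → ℕ → ℝ) :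
    ∃ g : ℕ → ℝ, (∀ a < tableBase I, g a = f a) ∧ ∀ k s x t u, s < (Theta I).card →
      x < gammaCap I → t < (Theta I).card → u ≤ I.n → g (cell I k s x t u) = V k s x t u := by
  let Idx := {q : ℕ × ℕ × ℕ × ℕ × ℕ // q.2.1 < (Theta I).card ∧ q.2.2.1 < gammaCap I ∧
    q.2.2.2.1 < (Theta I).card ∧ q.2.2.2.2 ≤ I.n}
  let c : Idx → ℕ := fun q => cell I q.1.1 q.1.2.1 q.1.2.2.1 q.1.2.2.2.1 q.1.2.2.2.2
  have hc : Function.Injective c := by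
    rintro ⟨⟨k, s, x, t, u⟩, h1, h2, h3, h4⟩ ⟨⟨k', s', x', t', u'⟩, h1', h2', h3', h4'⟩ h
    obtain ⟨rfl, rfl, rfl, rfl, rfl⟩ := cell_inj h1 h1' h2 h2' h3 h3' h4 h4' h
    rfl
  refine ⟨Function.extend c (fun q => V q.1.1 q.1.2.1 q.1.2.2.1 q.1.2.2.2.1 q.1.2.2.2.2) f,
    fun a ha => ?_, fun k s x t u hs hx ht hu => ?_⟩
  · rw [Function.extend_apply']
    rintro ⟨q, rfl⟩
    exact absurd ha (by simp [c, cell])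
  · exact hc.extend_apply _ _ (⟨(k, s, x, t, u), hs, hx, ht, hu⟩ : Idx)

/-- The date of `Θ` with the given index. -/
def thetaAt (I : Instance) (f : ℕ → ℝ) (s : ℕ) : ℝ := f (2 * I.n + s)

/-- The date of `Γ(s)` with the given index. -/
def gammaAt (I : Instance) (f : ℕ → ℝ) (s x : ℕ) : ℝ := f (gammaBase I + s * gammaCap I + x)

/-- `f` is the final contents of the real memory, and `im` has the sizes of the sets `Γ(s)`. -/
structure IsTarget (I : Instance) (im : ℕ → ℕ) (f : ℕ → ℝ) : Prop where
  inp : ∀ a < 2 * I.n, f a = inp I a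
  theta : Lists f (2 * I.n) (Theta I).card (Theta I)
  gamma : ∀ s < (Theta I).card,
    Lists f (gammaBase I + s * gammaCap I) (im (s + 1)) (Gamma I (thetaAt I f s))
  table : ∀ k s x t u, s < (Theta I).card → x < gammaCap I → t < (Theta I).card → u ≤ I.n →
    f (cell I k s x t u) = encode (dpValue I k (thetaAt I f s) (gammaAt I f s x) (thetaAt I f t) u)

section Target
variable {I : Instance} {im : ℕ → ℕ} {f : ℕ → ℝ}

theorem IsTarget.lt_gammaCap (h : IsTarget I im f) {s : ℕ} (hs : s < (Theta I).card) :
    im (s + 1) < gammaCap I := by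
  rw [(h.gamma s hs).card_eq]
  exact card_Gamma_lt_gammaCap I _

theorem IsTarget.le_gammaCard (h : IsTarget I im f) {s : ℕ} (hs : s < (Theta I).card) :
    im (s + 1) ≤ gammaCard I := by
  rw [(h.gamma s hs).card_eq]
  exact card_Gamma_le_gammaCard (Lists.mem_Theta h.theta hs)

theorem gammaCard_lt_gammaCap (I : Instance) : gammaCard I < gammaCap I :=
  Nat.lt_succ_of_le (gammaCard_le I)

/-- The candidate sets and the layers below `k` of the table are in the memory. -/
def Filled (I : Instance) (im : ℕ → ℕ) (f : ℕ → ℝ) (k : ℕ) (rm : ℕ → ℝ) : Prop :=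
  (∀ a < tableBase I, rm a = f a) ∧ ∀ k' < k, ∀ s < (Theta I).card, ∀ x < im (s + 1),
    ∀ t < (Theta I).card, ∀ u < I.n + 1, rm (cell I k' s x t u) = f (cell I k' s x t u)

/-- A loop over all entries of one layer of the table. -/
def layerProg (body : Prog) : Prog :=
  nest4 (IExp.reg 2) (IExp.load (IExp.add (IExp.reg 8) (IExp.const 1))) (IExp.reg 2) (IExp.reg 6) body

theorem cap_bounds (I : Instance) : I.n + 1 ≤ (Theta I).card ∧ (Theta I).card < thetaCap I ∧
    gammaCard I < gammaCap I ∧ 2 * I.n + thetaCap I = gammaBase I ∧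
    gammaBase I + gammaCap I ≤ tableBase I ∧ tableBase I < numCells I := by
  have h1 := card_Theta_lt_thetaCap I
  have h2 := gammaRow_le (I := I) (s := 0) ((Nat.zero_le _).trans_lt (lt_card_Theta I))
  refine ⟨lt_card_Theta I, h1, gammaCard_lt_gammaCap I, rfl, by omega, tableBase_lt_numCells I⟩

theorem runs_nest4_table (hf : IsTarget I im f) {M K X : ℕ} (hM : numCells I ≤ M) {σ₀ : State}
    (hR : Regs I σ₀) (h2 : σ₀.ireg 2 = (Theta I).card) {body : Prog} {β : Type*}
    (Inv : Set β → DataPred) (A : ℕ → ℕ → ℕ → ℕ → Set β) (hX : 0 < X) (h0 : (Inv ∅).At σ₀)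
    (him : ∀ D rr im' rm, Inv D rr im' rm → ∀ s < (Theta I).card, im' (s + 1) = im (s + 1))
    (hb : ∀ D s x t u σ, s < (Theta I).card → x < im (s + 1) → t < (Theta I).card → u < I.n + 1 →
      AtLoop σ₀ σ s x t u → (Inv D).At σ →
      Runs M body σ (K * X) fun σ' => Frame 12 σ σ' ∧ (Inv (D ∪ A s x t u)).At σ') :
    Runs M (layerProg body) σ₀
      ((K + 80) * ((Theta I).card * (gammaCard I * ((Theta I).card * ((I.n + 1) * X)))))
      fun σ' => Frame 8 σ₀ σ' ∧ (Inv {y | ∃ s < (Theta I).card, ∃ x < im (s + 1),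
        ∃ t < (Theta I).card, ∃ u < I.n + 1, y ∈ A s x t u}).At σ' := by
  have hn := I.n_pos
  obtain ⟨b1, b2, b3, b4, b5, b6⟩ := cap_bounds I
  have hgp := gammaCard_pos I
  refine (Runs.nest4 (M := M) (K := K) Inv A (N₁ := (Theta I).card) (N₂' := gammaCard I)
    (N₂ := fun s => im (s + 1)) (N₃ := (Theta I).card) (N₄' := I.n + 1) (N₄ := fun _ => I.n + 1) hX
    (by omega) hgp (by omega) (by omega) (by omega) (by omega) (by omega) (by omega)
    (fun s hs => hf.le_gammaCard hs) (fun _ _ => le_rfl) h0 ?_ ?_ ?_ ?_ hb).mono ?_ (fun _ h => h)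
  · intro D σ hfr hI
    simp only [IExp.Safe, IExp.eval, hfr 2 (by norm_num), h2, and_true]
    omega
  · intro D σ s hfr h8 hs hI
    have := hf.le_gammaCard hs
    simp only [IExp.Safe, IExp.eval, h8, him _ _ _ _ hI s hs, and_true]
    omega
  · intro D σ hfr hI
    simp only [IExp.Safe, IExp.eval, hfr 2 (by norm_num), h2, and_true]
    omega
  · intro D σ t hfr h10 ht hI
    simp only [IExp.Safe, IExp.eval, (hR.of_frame hfr (by norm_num)).reg6, and_true]
    omega
  · simp only [IExp.cost]
    exact Nat.mul_le_mul_right _ (by omega)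

/-- Because the final contents `f` are fixed in advance, each store writes the value that `f` has at
that address. A cell that is already correct therefore stays correct wherever the store goes, and no
distinctness of addresses is needed. -/
theorem runs_layerProg (hf : IsTarget I im f) {M K X k : ℕ} (hM : numCells I ≤ M) {σ₀ : State}
    (hR : Regs I σ₀) (h2 : σ₀.ireg 2 = (Theta I).card) {body : Prog} (hX : 0 < X)
    (hr : RealIn I σ₀.rreg) (hi : σ₀.imem = im) (hF : Filled I im f k σ₀.rmem)
    (hb : ∀ s x t u σ, s < (Theta I).card → x < im (s + 1) → t < (Theta I).card → u < I.n + 1 →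
      AtLoop σ₀ σ s x t u → RealIn I σ.rreg → σ.imem = im → Filled I im f k σ.rmem →
      Runs M body σ (K * X) fun σ' => Frame 12 σ σ' ∧ RealIn I σ'.rreg ∧ σ'.imem = im ∧
        σ'.rmem = Function.update σ.rmem (cell I k s x t u) (f (cell I k s x t u))) :
    Runs M (layerProg body) σ₀
      ((K + 80) * ((Theta I).card * (gammaCard I * ((Theta I).card * ((I.n + 1) * X)))))
      fun σ' => Frame 8 σ₀ σ' ∧ RealIn I σ'.rreg ∧ σ'.imem = im ∧
        Filled I im f (k + 1) σ'.rmem := by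
  refine (runs_nest4_table hf hM hR h2 (fun D rr im' rm => RealIn I rr ∧ im' = im ∧
    Filled I im f k rm ∧ ∀ a ∈ D, rm a = f a) (fun s x t u => {cell I k s x t u}) hX
    ⟨hr, hi, hF, by simp⟩ ?_ ?_).mono le_rfl ?_
  · rintro D rr im' rm ⟨-, rfl, -⟩ s hs
    rfl
  · rintro D s x t u σ hs hx ht hu hat ⟨h1, h3, h4, h5⟩
    refine (hb s x t u σ hs hx ht hu hat h1 h3 h4).mono le_rfl ?_
    rintro σ' ⟨g1, g2, g3, g4⟩
    have key : ∀ a, σ.rmem a = f a → σ'.rmem a = f a := by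
      intro a ha
      rw [g4, Function.update_apply]
      split_ifs with h
      · rw [h]
      · exact ha
    refine ⟨g1, g2, g3, ⟨fun a ha => key a (h4.1 a ha), fun k' hk' s' hs' x' hx' t' ht' u' hu' =>
      key _ (h4.2 k' hk' s' hs' x' hx' t' ht' u' hu')⟩, ?_⟩
    rintro a (ha | rfl)
    · exact key a (h5 a ha)
    · rw [g4, Function.update_self]
  · rintro σ' ⟨g1, g2, g3, g4, g5⟩
    refine ⟨g1, g2, g3, g4.1, fun k' hk' s hs x hx t ht u hu => ?_⟩
    rcases Nat.lt_succ_iff_lt_or_eq.1 hk' with h | rfl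
    · exact g4.2 k' h s hs x hx t ht u hu
    · exact g5 _ ⟨s, hs, x, hx, t, ht, u, hu, rfl⟩

end Target

/-! ### Minima of encoded energies -/

theorem encode_nonneg_iff {v : ℝ≥0∞} : 0 ≤ encode v ↔ v ≠ ⊤ := by
  unfold encode
  split_ifs with h
  · simp [h]
  · simp [h]

theorem encode_add {v w : ℝ≥0∞} {c : ℝ} (hv : v ≠ ⊤) (hw : w ≠ ⊤) (hc : 0 ≤ c) :
    encode (v + w + ENNReal.ofReal c) = encode v + encode w + c := by
  have h1 : v + w ≠ ⊤ := ENNReal.add_ne_top.2 ⟨hv, hw⟩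
  have h2 : v + w + ENNReal.ofReal c ≠ ⊤ := ENNReal.add_ne_top.2 ⟨h1, ENNReal.ofReal_ne_top⟩
  rw [encode, encode, encode, if_neg h2, if_neg hv, if_neg hw,
    ENNReal.toReal_add h1 ENNReal.ofReal_ne_top, ENNReal.toReal_add hv hw, ENNReal.toReal_ofReal hc]

/-- The code `-1` of `∞` is smaller than all others, so comparing codes needs the sign test for `v`.
For `w = ⊤` the right-hand side would be false. -/
theorem le_iff_encode {v w : ℝ≥0∞} (hw : w ≠ ⊤) :
    v ≤ w ↔ 0 ≤ encode v ∧ encode v ≤ encode w := by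
  rw [encode_nonneg_iff]
  constructor
  · intro h
    have hv : v ≠ ⊤ := ne_top_of_le_ne_top hw h
    refine ⟨hv, ?_⟩
    rw [encode, encode, if_neg hv, if_neg hw]
    exact ENNReal.toReal_mono hw h
  · rintro ⟨hv, h⟩
    rw [encode, encode, if_neg hv, if_neg hw] at h
    exact (ENNReal.toReal_le_toReal hv hw).1 h

/-- A loop that accumulates a minimum in real register `3`. -/
theorem runs_minLoop {M r N N' K X : ℕ} {e : IExp} {body : Prog} {σ₀ : State} {P : DataPred}
    {F : ℕ → ℝ≥0∞} {W : ℝ≥0∞} (hNM : N ≤ M) (hN : N ≤ N') (hN' : 0 < N') (hX : 0 < X)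
    (hP : P.At σ₀) (h3 : σ₀.rreg 3 = encode W)
    (he : ∀ σ, Frame r σ₀ σ → P.At σ → e.Safe M σ ∧ e.eval σ = N)
    (hb : ∀ i < N, ∀ V σ, Frame r σ₀ σ → σ.ireg r = i → P.At σ → σ.rreg 3 = encode V →
      Runs M body σ (K * X) fun σ' => Frame (r + 1) σ σ' ∧ P.At σ' ∧ σ'.rreg 3 = encode (V ⊓ F i)) :
    Runs M (forLoop r e body) σ₀ ((K + 2 * e.cost + 14) * (N' * X)) fun σ' =>
      Frame r σ₀ σ' ∧ P.At σ' ∧ σ'.rreg 3 = encode (W ⊓ (Finset.range N).inf F) := by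
  refine Runs.forLoop (fun i rr im rm => P rr im rm ∧ rr 3 = encode (W ⊓ (Finset.range i).inf F))
    hNM hN hN' hX ⟨hP, by simpa using h3⟩ (fun i _ σ hf hI => he σ hf hI.1) ?_
  rintro i hi σ hf hr ⟨h1, h2⟩
  refine (hb i hi _ σ hf hr h1 h2).mono le_rfl ?_
  rintro σ' ⟨g1, g2, g3⟩
  refine ⟨g1, g2, ?_⟩
  rw [g3, Finset.range_add_one, Finset.inf_insert, inf_assoc, inf_comm (F i)]

/-- Only the set of values in the array matters for the infimum; the absence of repetitions matters
for the running time. -/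
theorem Lists.inf_eq {f : ℕ → ℝ} {b k : ℕ} {T : Finset ℝ} (h : Lists f b k T) (g : ℝ → ℝ≥0∞) :
    (Finset.range k).inf (fun q => g (f (b + q))) = ⨅ y ∈ T, g y := by
  rw [Finset.inf_eq_iInf]
  apply le_antisymm
  · refine le_iInf₂ fun y hy => ?_
    obtain ⟨q, hq, rfl⟩ := h.mem_iff.1 (Finset.mem_coe.2 hy)
    exact iInf₂_le q (Finset.mem_range.2 hq)
  · refine le_iInf₂ fun q hq => ?_
    exact iInf₂_le (f (b + q)) (h.mapsTo (Finset.mem_range.1 hq))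

end SpeedScaling

/-! ## One step of the dynamic program -/

namespace SpeedScaling

open RealRAM

/-- Try the choice of the dynamic program given by the registers `12`, `13`, `14`. -/
def choiceProg : Prog :=
  Prog.seq (Prog.rset 8 (RExp.load (cellExp (IExp.reg 7) (IExp.reg 8) (IExp.reg 9) (IExp.reg 12)
    (IExp.reg 14)))) <|
  Prog.seq (Prog.rset 9 (RExp.load (cellExp (IExp.reg 7) (IExp.reg 12) (IExp.reg 13) (IExp.reg 10)
    (IExp.sub (IExp.sub (IExp.reg 11) (IExp.reg 14)) (IExp.const 1))))) <|
  Prog.cond (BExp.and (BExp.rle (RExp.ofInt (IExp.const 0)) (RExp.reg 8))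
      (BExp.rle (RExp.ofInt (IExp.const 0)) (RExp.reg 9)))
    (Prog.seq (Prog.rset 8 (RExp.add (RExp.add (RExp.reg 8) (RExp.reg 9)) (RExp.reg 7))) <|
      Prog.cond (BExp.and (BExp.rle (RExp.ofInt (IExp.const 0)) (RExp.reg 3))
        (BExp.rle (RExp.reg 3) (RExp.reg 8))) Prog.skip (Prog.rset 3 (RExp.reg 8)))
    Prog.skip

/-- The test of the side conditions of the dynamic program. -/
def dpTest : BExp :=
  BExp.and (BExp.rle (RExp.load (IExp.add (IExp.reg 1) (IExp.reg 8))) (RExp.load (IExp.reg 7))) <|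
  BExp.and (BExp.rle (RExp.load (IExp.reg 7)) (RExp.reg 4)) <|
  BExp.and (BExp.rle (RExp.load (IExp.add (IExp.add (IExp.reg 3) (IExp.mul (IExp.reg 8)
    (IExp.reg 4))) (IExp.reg 9))) (RExp.reg 4)) <|
  BExp.and (BExp.not (BExp.rle (RExp.reg 5) (RExp.reg 4))) <|
  BExp.and (BExp.rle (RExp.reg 5) (RExp.load (IExp.add (IExp.reg 1) (IExp.reg 10)))) <|
    BExp.rle (RExp.reg 5) (RExp.load (IExp.add (IExp.reg 0) (IExp.reg 7)))

/-- The energy of one job in the interval whose ends are in the real registers `4` and `5`. -/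
def slotCostExp : RExp :=
  RExp.div (RExp.pow (RExp.reg 0) (RExp.reg 2)) (RExp.pow (RExp.sub (RExp.reg 5) (RExp.reg 4))
    (RExp.sub (RExp.reg 2) (RExp.ofInt (IExp.const 1))))

/-- Try all choices of the dynamic program with the interval given by the registers `12`, `13`. -/
def slotProg : Prog :=
  Prog.seq (Prog.rset 4 (RExp.load (IExp.add (IExp.reg 1) (IExp.reg 12)))) <|
  Prog.seq (Prog.rset 5 (RExp.load (IExp.add (IExp.add (IExp.reg 3) (IExp.mul (IExp.reg 12)
    (IExp.reg 4))) (IExp.reg 13)))) <|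
  Prog.cond dpTest (Prog.seq (Prog.rset 7 slotCostExp) (forLoop 14 (IExp.reg 11) choiceProg))
    Prog.skip

/-- Compute the entry of the layer after the one in register `7` whose indices are in the
registers `8, …, 11`. -/
def entryProg : Prog :=
  Prog.seq (Prog.rset 3 (RExp.load (cellExp (IExp.reg 7) (IExp.reg 8) (IExp.reg 9) (IExp.reg 10)
    (IExp.reg 11)))) <|
  Prog.seq (forLoop 12 (IExp.reg 2)
    (forLoop 13 (IExp.load (IExp.add (IExp.reg 12) (IExp.const 1))) slotProg)) <|
  Prog.rstore (cellExp (IExp.add (IExp.reg 7) (IExp.const 1)) (IExp.reg 8) (IExp.reg 9)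
    (IExp.reg 10) (IExp.reg 11)) (RExp.reg 3)

/-- The registers address the entry with the given indices, and the layers up to `k` are filled. -/
structure EntryCtx (I : Instance) (im : ℕ → ℕ) (f rm : ℕ → ℝ) (σ : State) (k s x t u : ℕ) :
    Prop where
  regs : Regs I σ
  reg2 : σ.ireg 2 = (Theta I).card
  reg7 : σ.ireg 7 = k
  reg8 : σ.ireg 8 = s
  reg9 : σ.ireg 9 = x
  reg10 : σ.ireg 10 = t
  reg11 : σ.ireg 11 = u
  k_lt : k < I.n
  s_lt : s < (Theta I).card
  x_lt : x < im (s + 1)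
  t_lt : t < (Theta I).card
  u_le : u ≤ I.n
  target : IsTarget I im f
  filled : Filled I im f (k + 1) rm

/-- The data that the computation of one entry leaves unchanged. -/
def Fixed (I : Instance) (im : ℕ → ℕ) (rm : ℕ → ℝ) : DataPred := fun rr im' rm' =>
  RealIn I rr ∧ im' = im ∧ rm' = rm

theorem Fixed.setR {I : Instance} {im : ℕ → ℕ} {rm : ℕ → ℝ} {σ : State} {q : ℕ} {v : ℝ}
    (h : (Fixed I im rm).At σ) (hq : 3 ≤ q) : (Fixed I im rm).At (σ.setR q v) :=
  ⟨h.1.congr fun q' hq' => by simp [Function.update_of_ne (show q' ≠ q by omega)], h.2⟩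

section Entry

variable {I : Instance} {im : ℕ → ℕ} {f rm : ℕ → ℝ} {σ : State} {k s x t u : ℕ}

theorem EntryCtx.of_frame (h : EntryCtx I im f rm σ k s x t u) {R : ℕ} {σ' : State}
    (hf : Frame R σ σ') (hR : 12 ≤ R) : EntryCtx I im f rm σ' k s x t u :=
  { h with
    regs := h.regs.of_frame hf (by omega)
    reg2 := (hf 2 (by omega)).trans h.reg2
    reg7 := (hf 7 (by omega)).trans h.reg7
    reg8 := (hf 8 (by omega)).trans h.reg8
    reg9 := (hf 9 (by omega)).trans h.reg9
    reg10 := (hf 10 (by omega)).trans h.reg10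
    reg11 := (hf 11 (by omega)).trans h.reg11 }

theorem EntryCtx.theta_eq (h : EntryCtx I im f rm σ k s x t u) {q : ℕ} (hq : q < (Theta I).card) :
    rm (2 * I.n + q) = thetaAt I f q := by
  obtain ⟨b1, b2, b3, b4, b5, b6⟩ := cap_bounds I
  exact h.filled.1 _ (by omega)

theorem EntryCtx.gamma_eq (h : EntryCtx I im f rm σ k s x t u) {q y : ℕ} (hq : q < (Theta I).card)
    (hy : y < im (q + 1)) : rm (gammaBase I + q * gammaCap I + y) = gammaAt I f q y := by
  have := h.target.lt_gammaCap hq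
  have := gammaRow_le hq
  exact h.filled.1 _ (by omega)

theorem EntryCtx.release_eq (h : EntryCtx I im f rm σ k s x t u) :
    rm k = I.r ⟨k, h.k_lt⟩ := by
  obtain ⟨b1, b2, b3, b4, b5, b6⟩ := cap_bounds I
  have hk := h.k_lt
  rw [h.filled.1 k (by omega), h.target.inp k (by omega)]
  simp [inp, inputState, hk]

theorem EntryCtx.deadline_eq (h : EntryCtx I im f rm σ k s x t u) :
    rm (I.n + k) = I.d ⟨k, h.k_lt⟩ := by
  obtain ⟨b1, b2, b3, b4, b5, b6⟩ := cap_bounds I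
  have hk := h.k_lt
  rw [h.filled.1 _ (by omega), h.target.inp _ (by omega)]
  simp [inp, inputState, hk]

theorem EntryCtx.table_eq (h : EntryCtx I im f rm σ k s x t u) {s' x' t' u' : ℕ}
    (hs : s' < (Theta I).card) (hx : x' < im (s' + 1)) (ht : t' < (Theta I).card) (hu : u' ≤ I.n) :
    rm (cell I k s' x' t' u') =
      encode (dpValue I k (thetaAt I f s') (gammaAt I f s' x') (thetaAt I f t') u') := by
  rw [h.filled.2 k (Nat.lt_succ_self k) s' hs x' hx t' ht u' (Nat.lt_succ_of_le hu),
    h.target.table k s' x' t' u' hs (hx.trans (h.target.lt_gammaCap hs)) ht hu]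

/-- Codes may be added only if both stand for finite values, as the outer test ensures. Otherwise
the choice is worth `∞` and the minimum stays as it is. The inner test must likewise treat a current
minimum `∞` as larger than any finite value. -/
theorem runs_choiceProg {M : ℕ} (hM : numCells I ≤ M) (h : EntryCtx I im f rm σ k s x t u)
    {s' x' l : ℕ} (h12 : σ.ireg 12 = s') (h13 : σ.ireg 13 = x') (h14 : σ.ireg 14 = l)
    (hs' : s' < (Theta I).card) (hx' : x' < im (s' + 1)) (hl : l < u)
    (hlt : thetaAt I f s' < gammaAt I f s' x') (hP : (Fixed I im rm).At σ) {W : ℝ≥0∞}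
    (h3 : σ.rreg 3 = encode W) (h7 : σ.rreg 7 = slotCost I (gammaAt I f s' x' - thetaAt I f s')) :
    Runs M choiceProg σ 90 fun σ' => Frame 15 σ σ' ∧ ((Fixed I im rm).At σ' ∧
        σ'.rreg 7 = slotCost I (gammaAt I f s' x' - thetaAt I f s')) ∧
      σ'.rreg 3 = encode (W ⊓ dpTerm I k (thetaAt I f s) (gammaAt I f s x) (thetaAt I f t) u
        (thetaAt I f s') (gammaAt I f s' x') l) := by
  obtain ⟨b1, b2, b3, b4, b5, b6⟩ := cap_bounds I
  have hk := h.k_lt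
  have hsl := h.s_lt
  have hxl := h.x_lt.trans (h.target.lt_gammaCap hsl)
  have hxl' := hx'.trans (h.target.lt_gammaCap hs')
  have htl := h.t_lt
  have hul := h.u_le
  have hrm : σ.rmem = rm := hP.2.2
  set A := dpValue I k (thetaAt I f s) (gammaAt I f s x) (thetaAt I f s') l with hA
  set B := dpValue I k (thetaAt I f s') (gammaAt I f s' x') (thetaAt I f t) (u - l - 1) with hB
  have hcost := slotCost_pos I (sub_pos.2 hlt)
  have hT : dpTerm I k (thetaAt I f s) (gammaAt I f s x) (thetaAt I f t) u
      (thetaAt I f s') (gammaAt I f s' x') l =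
      A + B + ENNReal.ofReal (slotCost I (gammaAt I f s' x' - thetaAt I f s')) := rfl
  obtain ⟨c1, c2, c3⟩ := cellExp_spec (ek := IExp.reg 7) (es := IExp.reg 8) (ex := IExp.reg 9)
    (et := IExp.reg 12) (eu := IExp.reg 14) hM h.regs h.reg2 hk.le hsl hxl hs' (show l ≤ I.n by omega)
    (by simp only [IExp.Safe, h.reg7]; omega) (by simp only [IExp.Safe, h.reg8]; omega)
    (by simp only [IExp.Safe, h.reg9]; omega) (by simp only [IExp.Safe, h12]; omega)
    (by simp only [IExp.Safe, h14]; omega) h.reg7 h.reg8 h.reg9 h12 h14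
  have e1 : σ.rmem (cell I k s x s' l) = encode A := by
    rw [hrm, h.table_eq hsl h.x_lt hs' (by omega)]
  refine Runs.seq_le 25 65 le_rfl (Runs.rset ⟨c1, c3⟩ (by decide) ?_)
  obtain ⟨d1, d2, d3⟩ := cellExp_spec (σ := σ.setR 8 (encode A)) (ek := IExp.reg 7)
    (es := IExp.reg 12) (ex := IExp.reg 13) (et := IExp.reg 10)
    (eu := IExp.sub (IExp.sub (IExp.reg 11) (IExp.reg 14)) (IExp.const 1)) hM
    (h.regs.of_frame ((Frame.refl 7 σ).of_ireg_eq rfl) le_rfl) h.reg2 hk.le hs' hxl' htl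
    (show u - l - 1 ≤ I.n by omega)
    (by simp only [IExp.Safe, State.setR_ireg, h.reg7]; omega)
    (by simp only [IExp.Safe, State.setR_ireg, h12]; omega)
    (by simp only [IExp.Safe, State.setR_ireg, h13]; omega)
    (by simp only [IExp.Safe, State.setR_ireg, h.reg10]; omega)
    (by simp only [IExp.Safe, State.setR_ireg, h14, h.reg11]; omega) h.reg7 h12 h13 h.reg10
    (by simp only [IExp.eval, State.setR_ireg, h14, h.reg11])
  have e2 : σ.rmem (cell I k s' x' t (u - l - 1)) = encode B := by
    rw [hrm, h.table_eq hs' hx' htl (by omega)]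
  rw [show RExp.eval σ (RExp.load _) = encode A by simp only [RExp.eval, c2, e1]]
  refine Runs.seq_le 29 36 le_rfl (Runs.rset ⟨d1, d3⟩ (by decide) ?_)
  rw [show RExp.eval _ (RExp.load _) = encode B by
    simp only [RExp.eval, d2, State.setR_rmem, e2]]
  have hP' : (Fixed I im rm).At ((σ.setR 8 (encode A)).setR 9 (encode B)) :=
    (hP.setR (by norm_num)).setR (by norm_num)
  have r8 : ((σ.setR 8 (encode A)).setR 9 (encode B)).rreg 8 = encode A := by simp
  have r9 : ((σ.setR 8 (encode A)).setR 9 (encode B)).rreg 9 = encode B := by simp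
  have r3 : ((σ.setR 8 (encode A)).setR 9 (encode B)).rreg 3 = encode W := by simpa using h3
  have r7 : ((σ.setR 8 (encode A)).setR 9 (encode B)).rreg 7 =
      slotCost I (gammaAt I f s' x' - thetaAt I f s') := by simpa using h7
  have hfr : Frame 15 σ ((σ.setR 8 (encode A)).setR 9 (encode B)) :=
    (Frame.refl 15 σ).of_ireg_eq rfl
  generalize (σ.setR 8 (encode A)).setR 9 (encode B) = τ at hP' r8 r9 r3 r7 hfr ⊢
  refine Runs.cond 24 (by decide) (by simp [BExp.Safe, RExp.Safe, IExp.Safe]) (fun hc => ?_)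
    (fun hc => ?_)
  · simp only [BExp.Holds, RExp.eval, IExp.eval, r8, r9, Nat.cast_zero, encode_nonneg_iff] at hc
    have hne : A + B + ENNReal.ofReal (slotCost I (gammaAt I f s' x' - thetaAt I f s')) ≠ ⊤ :=
      ENNReal.add_ne_top.2 ⟨ENNReal.add_ne_top.2 hc, ENNReal.ofReal_ne_top⟩
    refine Runs.seq_le 6 18 le_rfl (Runs.rset (by simp [RExp.Safe]) (by decide) ?_)
    simp only [RExp.eval, r8, r9, r7, ← encode_add hc.1 hc.2 hcost.le]
    rw [hT]
    set T := A + B + ENNReal.ofReal (slotCost I (gammaAt I f s' x' - thetaAt I f s'))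
    refine Runs.cond 3 (by decide) (by simp [BExp.Safe, RExp.Safe, IExp.Safe]) (fun hc' => ?_)
      (fun hc' => ?_)
    · have hle : W ≤ T := (le_iff_encode hne).2 (by
        simpa [BExp.Holds, RExp.eval, IExp.eval, r3] using hc')
      rw [inf_eq_left.2 hle]
      exact Runs.skip (by norm_num) ⟨hfr, ⟨hP'.setR (by norm_num), by simpa using r7⟩,
        by simpa using r3⟩
    · have hle : T ≤ W := by
        refine (not_le.1 fun hle => hc' ?_).le
        simpa [BExp.Holds, RExp.eval, IExp.eval, r3] using (le_iff_encode hne).1 hle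
      rw [inf_eq_right.2 hle]
      exact Runs.rset trivial (by decide) ⟨hfr, ⟨(hP'.setR (by norm_num)).setR (by norm_num),
        by simpa using r7⟩, by simp [RExp.eval]⟩
  · have htop : A + B + ENNReal.ofReal (slotCost I (gammaAt I f s' x' - thetaAt I f s')) = ⊤ := by
      simp only [BExp.Holds, RExp.eval, IExp.eval, r8, r9, Nat.cast_zero, encode_nonneg_iff,
        not_and_or, not_not] at hc
      rcases hc with hc | hc <;> simp [hc]
    rw [hT, htop, inf_top_eq]
    exact Runs.skip (by norm_num) ⟨hfr, ⟨hP', r7⟩, r3⟩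

open Classical in
/-- The best choice of the dynamic program with the interval given by the indices `s'` and `x'`. -/
noncomputable def slotMin (I : Instance) (f : ℕ → ℝ) (j : Fin I.n) (s x t u s' x' : ℕ) : ℝ≥0∞ :=
  if DpCond I j (thetaAt I f s) (gammaAt I f s x) (thetaAt I f t) (thetaAt I f s')
      (gammaAt I f s' x') then
    (Finset.range u).inf fun l => dpTerm I j (thetaAt I f s) (gammaAt I f s x) (thetaAt I f t) u
      (thetaAt I f s') (gammaAt I f s' x') l
  else ⊤

/-- The side conditions do not involve `l` and are tested once, before the loop. Conjunctions are
not short-circuited by the machine, so all their comparisons must be legal at once. The power in the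
cost is legal because the test has established `s' < x'`. -/
theorem runs_slotProg {M : ℕ} (hM : numCells I ≤ M) (h : EntryCtx I im f rm σ k s x t u)
    {s' x' : ℕ} (h12 : σ.ireg 12 = s') (h13 : σ.ireg 13 = x')
    (hs' : s' < (Theta I).card) (hx' : x' < im (s' + 1)) (hP : (Fixed I im rm).At σ) {W : ℝ≥0∞}
    (h3 : σ.rreg 3 = encode W) :
    Runs M slotProg σ (200 * I.n) fun σ' => Frame 14 σ σ' ∧ (Fixed I im rm).At σ' ∧
      σ'.rreg 3 = encode (W ⊓ slotMin I f ⟨k, h.k_lt⟩ s x t u s' x') := by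
  obtain ⟨b1, b2, b3, b4, b5, b6⟩ := cap_bounds I
  have hn := I.n_pos
  have hk := h.k_lt
  have hsl := h.s_lt
  have hxl := h.x_lt.trans (h.target.lt_gammaCap hsl)
  have hxl' := hx'.trans (h.target.lt_gammaCap hs')
  have htl := h.t_lt
  have hul := h.u_le
  have hrow := gammaRow_le hsl
  have hrow' := gammaRow_le hs'
  have hrm : σ.rmem = rm := hP.2.2
  refine Runs.seq_le 5 (195 * I.n) (by omega) (Runs.rset (by
    simp only [RExp.Safe, IExp.Safe, IExp.eval, h.regs.reg1, h12]; omega) (by decide) ?_)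
  refine Runs.seq_le 9 (186 * I.n) (by omega) (Runs.rset (by
    simp only [RExp.Safe, IExp.Safe, IExp.eval, State.setR_ireg, h.regs.reg3, h.regs.reg4, h12, h13]
    omega) (by decide) ?_)
  rw [show RExp.eval σ (RExp.load (IExp.add (IExp.reg 1) (IExp.reg 12))) = thetaAt I f s' by
    simp only [RExp.eval, IExp.eval, h.regs.reg1, h12, hrm, h.theta_eq hs']]
  rw [show RExp.eval (σ.setR 4 (thetaAt I f s')) _ = gammaAt I f s' x' by
    simp only [RExp.eval, IExp.eval, State.setR_ireg, State.setR_rmem, h.regs.reg3, h.regs.reg4, h12,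
      h13, hrm, h.gamma_eq hs' hx']]
  have hP' : (Fixed I im rm).At ((σ.setR 4 (thetaAt I f s')).setR 5 (gammaAt I f s' x')) :=
    (hP.setR (by norm_num)).setR (by norm_num)
  have r4 : ((σ.setR 4 (thetaAt I f s')).setR 5 (gammaAt I f s' x')).rreg 4 = thetaAt I f s' := by
    simp
  have r5 : ((σ.setR 4 (thetaAt I f s')).setR 5 (gammaAt I f s' x')).rreg 5 =
    gammaAt I f s' x' := by simp
  have r3 : ((σ.setR 4 (thetaAt I f s')).setR 5 (gammaAt I f s' x')).rreg 3 = encode W := by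
    simpa using h3
  have hfr : Frame 14 σ ((σ.setR 4 (thetaAt I f s')).setR 5 (gammaAt I f s' x')) :=
    (Frame.refl 14 σ).of_ireg_eq rfl
  generalize (σ.setR 4 (thetaAt I f s')).setR 5 (gammaAt I f s' x') = τ at hP' r4 r5 r3 hfr ⊢
  have h' := h.of_frame hfr (by norm_num)
  have hiff : dpTest.Holds τ ↔ DpCond I ⟨k, hk⟩ (thetaAt I f s) (gammaAt I f s x) (thetaAt I f t)
      (thetaAt I f s') (gammaAt I f s' x') := by
    simp only [dpTest, BExp.Holds, RExp.eval, IExp.eval, h'.regs.reg0, h'.regs.reg1, h'.regs.reg3,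
      h'.regs.reg4, h'.reg7, h'.reg8, h'.reg9, h'.reg10, r4, r5, hP'.2.2, h.theta_eq hsl,
      h.theta_eq htl, h.gamma_eq hsl h.x_lt, h.release_eq, h.deadline_eq, not_le, DpCond]
  refine Runs.cond (140 * I.n) ?_ ?_ (fun hc => ?_) (fun hc => ?_)
  · exact le_trans (Nat.add_le_add_right (m := 46) (by decide) _) (by omega)
  · simp only [dpTest, BExp.Safe, RExp.Safe, IExp.Safe, IExp.eval, h'.regs.reg0, h'.regs.reg1,
      h'.regs.reg3, h'.regs.reg4, h'.reg7, h'.reg8, h'.reg9, h'.reg10, and_true, true_and]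
    constructorm* _ ∧ _ <;> omega
  · rw [hiff] at hc
    have hlt := hc.2.2.2.1
    rw [slotMin, if_pos hc]
    refine Runs.seq_le 13 (127 * I.n) (by omega) (Runs.rset ?_ (by decide) ?_)
    · have hpos : (0 : ℝ) < I.p := by exact_mod_cast I.p_pos
      have hsub := sub_pos.2 hlt
      have := Real.rpow_pos_of_pos hsub (I.α - 1)
      simp only [slotCostExp, RExp.Safe, RExp.eval, IExp.Safe, IExp.eval, r4, r5, hP'.1.1, hP'.1.2.2,
        Nat.cast_one, true_and, hpos, hsub, and_true]
      exact ⟨by omega, this.ne'⟩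
    rw [show RExp.eval τ slotCostExp = slotCost I (gammaAt I f s' x' - thetaAt I f s') by
      simp only [slotCostExp, slotCost, RExp.eval, IExp.eval, r4, r5, hP'.1.1, hP'.1.2.2,
        Nat.cast_one]]
    set τ' := τ.setR 7 (slotCost I (gammaAt I f s' x' - thetaAt I f s'))
    have hfr' : Frame 14 σ τ' := hfr.of_ireg_eq rfl
    have h'' := h.of_frame hfr' (by norm_num)
    refine (runs_minLoop (M := M) (K := 90) (X := 1) (N := u) (N' := I.n) (W := W)
      (F := fun l => dpTerm I k (thetaAt I f s) (gammaAt I f s x) (thetaAt I f t) u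
        (thetaAt I f s') (gammaAt I f s' x') l)
      (P := fun rr im' rm' => Fixed I im rm rr im' rm' ∧
        rr 7 = slotCost I (gammaAt I f s' x' - thetaAt I f s')) (by omega) hul hn one_pos
      ⟨hP'.setR (by norm_num), by simp⟩ (by simpa using r3) ?_ ?_).mono ?_ ?_
    · intro ρ hfρ _
      have hρ11 : ρ.ireg 11 = u := (hfρ 11 (by norm_num)).trans h''.reg11
      simp only [IExp.Safe, IExp.eval, hρ11, and_true]
      omega
    · rintro l hl V ρ hfρ h14 ⟨hPρ, hρ7⟩ hρ3
      have hfr'' := hfr'.trans hfρ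
      exact runs_choiceProg hM (h.of_frame hfr'' (by norm_num)) ((hfr'' 12 (by norm_num)).trans h12)
        ((hfr'' 13 (by norm_num)).trans h13) h14 hs' hx' hl hlt hPρ hρ3 hρ7
    · simp only [IExp.cost]; omega
    · rintro ρ ⟨g1, g2, g3⟩
      exact ⟨hfr'.trans g1, g2.1, g3⟩
  · rw [hiff] at hc
    rw [slotMin, if_neg hc, inf_top_eq]
    exact Runs.skip (by omega) ⟨hfr, hP', r3⟩

/-- A violated side condition makes the inner infimum empty, hence `⊤`, in agreement with `slotMin`;
the infima over dates become minima over array indices. -/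
theorem dpValue_succ_eq_slotMin (hf : IsTarget I im f) (j : Fin I.n) (s x t u : ℕ) :
    dpValue I (j + 1) (thetaAt I f s) (gammaAt I f s x) (thetaAt I f t) u =
      dpValue I j (thetaAt I f s) (gammaAt I f s x) (thetaAt I f t) u ⊓
        (Finset.range (Theta I).card).inf fun s' =>
          (Finset.range (im (s' + 1))).inf fun x' => slotMin I f j s x t u s' x' := by
  classical
  rw [dpValue_succ]
  congr 1
  rw [← Lists.inf_eq hf.theta]
  refine Finset.inf_congr rfl fun s' hs' => ?_
  change (⨅ x' ∈ Gamma I (thetaAt I f s'), _) = _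
  rw [← Lists.inf_eq (hf.gamma s' (Finset.mem_range.1 hs'))]
  refine Finset.inf_congr rfl fun x' hx' => ?_
  rw [slotMin]
  split_ifs with hc
  · rw [Finset.inf_eq_iInf]
    exact iInf_pos hc
  · exact iInf_neg hc

/-- There are at most |Θ| |Γ| n choices, each tried in constant time. The running minimum stays in a
register and is stored only at the end, so the memory read by the loops is constant. -/
theorem runs_entryProg {M : ℕ} (hM : numCells I ≤ M) (h : EntryCtx I im f rm σ k s x t u)
    (hP : (Fixed I im rm).At σ) :
    Runs M entryProg σ (400 * ((Theta I).card * (gammaCard I * I.n))) fun σ' => Frame 12 σ σ' ∧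
      RealIn I σ'.rreg ∧ σ'.imem = im ∧
      σ'.rmem = Function.update rm (cell I (k + 1) s x t u) (f (cell I (k + 1) s x t u)) := by
  obtain ⟨b1, b2, b3, b4, b5, b6⟩ := cap_bounds I
  have hn := I.n_pos
  have hgp := gammaCard_pos I
  have hk := h.k_lt
  have hsl := h.s_lt
  have hxl := h.x_lt.trans (h.target.lt_gammaCap hsl)
  have htl := h.t_lt
  have hul := h.u_le
  have hY : 1 ≤ (Theta I).card * (gammaCard I * I.n) :=
    Nat.mul_pos (by omega) (Nat.mul_pos hgp hn)
  obtain ⟨c1, c2, c3⟩ := cellExp_spec (ek := IExp.reg 7) (es := IExp.reg 8) (ex := IExp.reg 9)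
    (et := IExp.reg 10) (eu := IExp.reg 11) hM h.regs h.reg2 hk.le hsl hxl htl hul
    (by simp only [IExp.Safe, h.reg7]; omega) (by simp only [IExp.Safe, h.reg8]; omega)
    (by simp only [IExp.Safe, h.reg9]; omega) (by simp only [IExp.Safe, h.reg10]; omega)
    (by simp only [IExp.Safe, h.reg11]; omega) h.reg7 h.reg8 h.reg9 h.reg10 h.reg11
  refine Runs.seq_le 25 (375 * ((Theta I).card * (gammaCard I * I.n))) (by omega)
    (Runs.rset ⟨c1, c3⟩ (by decide) ?_)
  rw [show RExp.eval σ (RExp.load _) =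
      encode (dpValue I k (thetaAt I f s) (gammaAt I f s x) (thetaAt I f t) u) by
    simp only [RExp.eval, c2, hP.2.2, h.table_eq hsl h.x_lt htl hul]]
  set τ := σ.setR 3 (encode (dpValue I k (thetaAt I f s) (gammaAt I f s x) (thetaAt I f t) u))
    with hτ
  have hfr : Frame 12 σ τ := (Frame.refl 12 σ).of_ireg_eq rfl
  have hPτ : (Fixed I im rm).At τ := hP.setR le_rfl
  refine Runs.seq_le (300 * ((Theta I).card * (gammaCard I * I.n)))
    (75 * ((Theta I).card * (gammaCard I * I.n))) (by omega) ?_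
  refine (runs_minLoop (M := M) (K := 230) (X := gammaCard I * I.n) (N := (Theta I).card)
    (N' := (Theta I).card) (P := Fixed I im rm)
    (W := dpValue I k (thetaAt I f s) (gammaAt I f s x) (thetaAt I f t) u) (by omega) le_rfl
    (by omega) (Nat.mul_pos hgp hn)
    hPτ (by simp [hτ]) (F := fun s' => (Finset.range (im (s' + 1))).inf
      fun x' => slotMin I f ⟨k, hk⟩ s x t u s' x') ?_ ?_).mono ?_ ?_
  · intro ρ hfρ _
    simp only [IExp.Safe, IExp.eval, (h.of_frame (hfr.trans hfρ) le_rfl).reg2, and_true]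
    omega
  · intro s' hs' V ρ hfρ h12 hPρ hρ3
    have hρ := hfr.trans hfρ
    have hcnt := h.target.le_gammaCard hs'
    refine (runs_minLoop (M := M) (K := 200) (X := I.n) (N := im (s' + 1))
      (N' := gammaCard I) (P := Fixed I im rm) (by omega) hcnt hgp hn hPρ hρ3
      (F := fun x' => slotMin I f ⟨k, hk⟩ s x t u s' x') ?_ ?_).mono ?_ (fun _ h => h)
    · rintro ρ' hfρ' ⟨-, him, -⟩
      simp only [IExp.Safe, IExp.eval, hfρ' 12 (by norm_num), h12, him, and_true]
      omega
    · intro x' hx' V' ρ' hfρ' h13 hPρ' hρ3'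
      exact runs_slotProg hM (h.of_frame (hρ.trans (hfρ'.mono (by norm_num))) le_rfl)
        ((hfρ' 12 (by norm_num)).trans h12) h13 hs' hx' hPρ' hρ3'
    · simp only [IExp.cost]
      exact Nat.mul_le_mul_right _ (by norm_num)
  · simp only [IExp.cost]
    exact Nat.mul_le_mul_right _ (by norm_num)
  · rintro ρ ⟨g1, g2, g3⟩
    have hρ := hfr.trans g1
    have h' := h.of_frame hρ le_rfl
    obtain ⟨d1, d2, d3⟩ := cellExp_spec (ek := IExp.add (IExp.reg 7) (IExp.const 1))
      (es := IExp.reg 8) (ex := IExp.reg 9)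
      (et := IExp.reg 10) (eu := IExp.reg 11) hM h'.regs h'.reg2 (show k + 1 ≤ I.n from hk) hsl hxl
      htl hul (by simp only [IExp.Safe, IExp.eval, h'.reg7]; omega)
      (by simp only [IExp.Safe, h'.reg8]; omega)
      (by simp only [IExp.Safe, h'.reg9]; omega) (by simp only [IExp.Safe, h'.reg10]; omega)
      (by simp only [IExp.Safe, h'.reg11]; omega) (by simp only [IExp.eval, h'.reg7]) h'.reg8 h'.reg9
      h'.reg10 h'.reg11
    refine Runs.rstore d1 d3 trivial (le_trans (b := 75) (by decide) (by omega))
      ⟨hρ.of_ireg_eq rfl, g2.1, g2.2.1, ?_⟩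
    rw [State.storeR_rmem, d2, g2.2.2]
    congr 1
    rw [h.target.table (k + 1) s x t u hsl hxl htl hul, RExp.eval, g3]
    exact congrArg encode (dpValue_succ_eq_slotMin h.target ⟨k, hk⟩ s x t u).symm

end Entry

end SpeedScaling

/-! ## The whole program -/

namespace SpeedScaling

open RealRAM

/-- Initialization of one entry of the layer `0`. -/
def initEntryProg : Prog :=
  Prog.cond (BExp.ile (IExp.reg 11) (IExp.const 0))
    (Prog.rstore (cellExp (IExp.const 0) (IExp.reg 8) (IExp.reg 9) (IExp.reg 10) (IExp.reg 11))
      (RExp.ofInt (IExp.const 0)))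
    (Prog.rstore (cellExp (IExp.const 0) (IExp.reg 8) (IExp.reg 9) (IExp.reg 10) (IExp.reg 11))
      (RExp.sub (RExp.ofInt (IExp.const 0)) (RExp.ofInt (IExp.const 1))))

/-- Computation of the table. -/
def tableProg : Prog :=
  Prog.seq (layerProg initEntryProg) (forLoop 7 (IExp.reg 0) (layerProg entryProg))

section Table

variable {I : Instance} {im : ℕ → ℕ} {f : ℕ → ℝ}

theorem runs_initLayer (hf : IsTarget I im f) {M : ℕ} (hM : numCells I ≤ M) {σ₀ : State}
    (hR : Regs I σ₀) (h2 : σ₀.ireg 2 = (Theta I).card) (hr : RealIn I σ₀.rreg) (hi : σ₀.imem = im)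
    (hF : Filled I im f 0 σ₀.rmem) :
    Runs M (layerProg initEntryProg) σ₀
      (120 * ((Theta I).card * (gammaCard I * ((Theta I).card * ((I.n + 1) * 1)))))
      fun σ' => Frame 8 σ₀ σ' ∧ RealIn I σ'.rreg ∧ σ'.imem = im ∧ Filled I im f 1 σ'.rmem := by
  obtain ⟨b1, b2, b3, b4, b5, b6⟩ := cap_bounds I
  refine runs_layerProg (K := 40) hf hM hR h2 one_pos hr hi hF ?_
  rintro s x t u σ hs hx ht hu hat h1 h3 h4
  have hR' := hR.of_frame hat.frame (by norm_num)
  have hxl := hx.trans (hf.lt_gammaCap hs)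
  obtain ⟨c1, c2, c3⟩ := cellExp_spec (ek := IExp.const 0) (es := IExp.reg 8) (ex := IExp.reg 9)
    (et := IExp.reg 10) (eu := IExp.reg 11) hM hR' ((hat.frame 2 (by norm_num)).trans h2)
    (Nat.zero_le _) hs hxl ht (Nat.le_of_lt_succ hu) (Nat.zero_le _)
    (by simp only [IExp.Safe, hat.reg8]; omega) (by simp only [IExp.Safe, hat.reg9]; omega)
    (by simp only [IExp.Safe, hat.reg10]; omega) (by simp only [IExp.Safe, hat.reg11]; omega)
    rfl hat.reg8 hat.reg9 hat.reg10 hat.reg11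
  have hv := hf.table 0 s x t u hs hxl ht (Nat.le_of_lt_succ hu)
  refine Runs.cond 30 (by decide) ⟨by simp only [IExp.Safe, hat.reg11]; omega, Nat.zero_le _⟩
    (fun hc => ?_) (fun hc => ?_)
  · simp only [BExp.Holds, IExp.eval, hat.reg11, Nat.le_zero] at hc
    refine Runs.rstore c1 c3 (Nat.zero_le _) (by decide) ⟨Frame.refl _ _, h1, h3, ?_⟩
    rw [State.storeR_rmem, c2, hv, hc]
    simp [RExp.eval, IExp.eval, dpValue, encode]
  · simp only [BExp.Holds, IExp.eval, hat.reg11, Nat.le_zero] at hc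
    refine Runs.rstore c1 c3 ⟨Nat.zero_le _, show 1 ≤ M by omega⟩ (by decide)
      ⟨Frame.refl _ _, h1, h3, ?_⟩
    rw [State.storeR_rmem, c2, hv]
    simp [RExp.eval, IExp.eval, dpValue, encode, hc]

/-- The values of layer `k + 1` depend on layer `k` alone, so within a layer the order of the
entries is immaterial. -/
theorem runs_tableProg (hf : IsTarget I im f) {M : ℕ} (hM : numCells I ≤ M) {σ₀ : State}
    (hR : Regs I σ₀) (h2 : σ₀.ireg 2 = (Theta I).card) (hr : RealIn I σ₀.rreg) (hi : σ₀.imem = im)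
    (hF : Filled I im f 0 σ₀.rmem) :
    Runs M tableProg σ₀
      (120 * ((Theta I).card * (gammaCard I * ((Theta I).card * ((I.n + 1) * 1)))) +
        500 * (I.n * ((Theta I).card * (gammaCard I * ((Theta I).card * ((I.n + 1) *
          ((Theta I).card * (gammaCard I * I.n))))))))
      fun σ' => Frame 7 σ₀ σ' ∧ RealIn I σ'.rreg ∧ σ'.imem = im ∧
        Filled I im f (I.n + 1) σ'.rmem := by
  obtain ⟨b1, b2, b3, b4, b5, b6⟩ := cap_bounds I
  have hn := I.n_pos
  have hgp := gammaCard_pos I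
  have hm : 0 < (Theta I).card := by omega
  have hX : 0 < (Theta I).card * (gammaCard I * I.n) := by positivity
  refine Runs.seq ((runs_initLayer hf hM hR h2 hr hi hF).mono le_rfl ?_)
  rintro σ₁ ⟨g1, g2, g3, g4⟩
  refine (Runs.forLoop (M := M) (K := 480) (N := I.n) (N' := I.n)
    (X := (Theta I).card * (gammaCard I * ((Theta I).card * ((I.n + 1) *
      ((Theta I).card * (gammaCard I * I.n))))))
    (fun k rr im' rm => RealIn I rr ∧ im' = im ∧ Filled I im f (k + 1) rm) (by omega) le_rfl hn
    (by positivity) ⟨g2, g3, g4⟩ ?_ ?_).mono ?_ ?_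
  · intro k hk σ hfr _
    simp only [IExp.Safe, IExp.eval, ((hR.of_frame g1 (by norm_num)).of_frame hfr le_rfl).reg0,
      and_true]
    omega
  · rintro k hk σ hfr h7 ⟨k1, k2, k3⟩
    have hfr' := (g1.mono (by norm_num)).trans hfr
    have hR' := hR.of_frame hfr' le_rfl
    have h2' := (hfr' 2 (by norm_num)).trans h2
    refine runs_layerProg (K := 400) hf hM hR' h2' hX k1 k2 k3 ?_
    rintro s x t u σ' hs hx ht hu hat h1 h3 h4
    exact runs_entryProg hM
      { regs := hR'.of_frame hat.frame (by norm_num)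
        reg2 := (hat.frame 2 (by norm_num)).trans h2'
        reg7 := (hat.frame 7 (by norm_num)).trans h7
        reg8 := hat.reg8
        reg9 := hat.reg9
        reg10 := hat.reg10
        reg11 := hat.reg11
        k_lt := hk
        s_lt := hs
        x_lt := hx
        t_lt := ht
        u_le := Nat.le_of_lt_succ hu
        target := hf
        filled := h4 } ⟨h1, h3, rfl⟩
  · simp only [IExp.cost]
    exact Nat.mul_le_mul_right _ (by norm_num)
  · rintro σ ⟨k1, k2⟩
    exact ⟨(g1.mono (by norm_num)).trans k1, k2⟩

/-! ### Reading the throughput off the table -/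

/-- The energy budget suffices for the entry whose indices are in the registers, the entry belongs
to the whole time interval, and its number of jobs is at least the current output. -/
def outTest : BExp :=
  BExp.and (isEqual (RExp.load (IExp.add (IExp.reg 1) (IExp.reg 8))) (RExp.ofInt (IExp.const 0))) <|
  BExp.and (isEqual (RExp.load (IExp.add (IExp.add (IExp.reg 3) (IExp.mul (IExp.reg 8)
    (IExp.reg 4))) (IExp.reg 9))) (RExp.ofInt (IExp.const 0))) <|
  BExp.and (isEqual (RExp.load (IExp.add (IExp.reg 1) (IExp.reg 10)))
    (RExp.load (IExp.sub (IExp.reg 1) (IExp.const 1)))) <|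
  BExp.and (BExp.rle (RExp.ofInt (IExp.const 0)) (RExp.load (cellExp (IExp.reg 0) (IExp.reg 8)
    (IExp.reg 9) (IExp.reg 10) (IExp.reg 11)))) <|
  BExp.and (BExp.rle (RExp.load (cellExp (IExp.reg 0) (IExp.reg 8)
    (IExp.reg 9) (IExp.reg 10) (IExp.reg 11))) (RExp.reg 1)) <|
    BExp.ile (IExp.load (IExp.const 0)) (IExp.reg 11)

/-- Computation of the output from the table. -/
def outProg : Prog :=
  Prog.seq (Prog.istore (IExp.const 0) (IExp.const 0)) <|
  Prog.seq (layerProg (Prog.cond outTest (Prog.istore (IExp.const 0) (IExp.reg 11)) Prog.skip)) <|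
  Prog.iset 0 (IExp.load (IExp.const 0))

/-- The numbers of jobs that can be completed within the energy budget. -/
def feasible (I : Instance) : Set ℕ :=
  {u : ℕ | u ≤ I.n ∧ dpValue I I.n 0 0 I.dmax u ≤ ENNReal.ofReal I.E}

/-- The search for the output starts from `0`, which therefore has to be feasible itself. -/
theorem zero_mem_feasible (I : Instance) : 0 ∈ feasible I := by
  refine ⟨Nat.zero_le _, ?_⟩
  have : ∀ k, dpValue I k 0 0 I.dmax 0 = 0 := by
    intro k
    induction k with
    | zero => simp [dpValue]
    | succ k ih => exact nonpos_iff_eq_zero.1 ((dpValue_succ_le _ _ _ _ _ _).trans ih.le)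
  rw [this]
  exact zero_le

theorem le_ofReal_iff_encode {v : ℝ≥0∞} {E : ℝ} (hE : 0 ≤ E) :
    v ≤ ENNReal.ofReal E ↔ 0 ≤ encode v ∧ encode v ≤ E := by
  rw [le_iff_encode ENNReal.ofReal_ne_top]
  have : encode (ENNReal.ofReal E) = E := by
    rw [encode, if_neg ENNReal.ofReal_ne_top, ENNReal.toReal_ofReal hE]
  rw [this]

theorem feasible_eq (hf : IsTarget I im f) : {y | ∃ s < (Theta I).card, ∃ x < im (s + 1),
    ∃ t < (Theta I).card, ∃ u < I.n + 1, y ∈ {y | y = u ∧ thetaAt I f s = 0 ∧ gammaAt I f s x = 0 ∧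
      thetaAt I f t = I.dmax ∧ dpValue I I.n (thetaAt I f s) (gammaAt I f s x) (thetaAt I f t) u ≤
        ENNReal.ofReal I.E}} = feasible I := by
  ext y
  constructor
  · rintro ⟨s, hs, x, hx, t, ht, u, hu, rfl, h1, h2, h3, h4⟩
    rw [h1, h2, h3] at h4
    exact ⟨Nat.le_of_lt_succ hu, h4⟩
  · rintro ⟨h1, h2⟩
    obtain ⟨s, hs, hs'⟩ := hf.theta.mem_iff.1
      (Finset.mem_coe.2 (mem_Theta_of_mem_Omega (zero_mem_Omega I)))
    obtain ⟨t, ht, ht'⟩ := hf.theta.mem_iff.1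
      (Finset.mem_coe.2 (mem_Theta_of_mem_Omega (dmax_mem_Omega I)))
    have hs' : thetaAt I f s = 0 := hs'
    have ht' : thetaAt I f t = I.dmax := ht'
    obtain ⟨x, hx, hx'⟩ := ((hf.gamma s hs).mem_iff (v := 0)).1
      (by rw [hs']; exact mem_Gamma_of_mem_Omega (zero_mem_Omega I))
    have hx' : gammaAt I f s x = 0 := hx'
    exact ⟨s, hs, x, hx, t, ht, y, Nat.lt_succ_of_le h1, rfl, hs', hx', ht',
      by rw [hs', hx', ht']; exact h2⟩

/-- The arrays are not sorted and the indices of `0` and `dmax` are unknown, so the whole layer `n`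
is scanned for entries with these dates. Integer cell `0` now keeps the best `u` so far; reusing it
is harmless, as |Θ| is in register `2` and the row lengths occupy cells from `1` on. -/
theorem runs_outProg (hf : IsTarget I im f) {M : ℕ} (hM : numCells I ≤ M) {σ₀ : State}
    (hR : Regs I σ₀) (h2 : σ₀.ireg 2 = (Theta I).card) (hr : RealIn I σ₀.rreg) (hi : σ₀.imem = im)
    (hF : Filled I im f (I.n + 1) σ₀.rmem) :
    Runs M outProg σ₀
      (310 * ((Theta I).card * (gammaCard I * ((Theta I).card * ((I.n + 1) * 1)))))
      fun σ' => σ'.rmem = σ₀.rmem ∧ IsGreatest (feasible I) (σ'.ireg 0) := by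
  obtain ⟨b1, b2, b3, b4, b5, b6⟩ := cap_bounds I
  have hn := I.n_pos
  have hgp := gammaCard_pos I
  have hm : 0 < (Theta I).card := by omega
  have hY : 1 ≤ (Theta I).card * (gammaCard I * ((Theta I).card * ((I.n + 1) * 1))) := by
    have : 0 < (Theta I).card * (gammaCard I * ((Theta I).card * ((I.n + 1) * 1))) := by positivity
    exact this
  refine Runs.seq_le 3 (307 * ((Theta I).card * (gammaCard I * ((Theta I).card * ((I.n + 1) * 1)))))
    (by omega) (Runs.istore (Nat.zero_le _) (show 0 < M by omega) (Nat.zero_le _) (by decide) ?_)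
  set σ₁ := σ₀.storeI 0 0 with hσ₁
  have hfr₁ : Frame 8 σ₀ σ₁ := (Frame.refl 8 σ₀).of_ireg_eq rfl
  have hR₁ := hR.of_frame hfr₁ (by norm_num)
  refine Runs.seq_le
    (300 * ((Theta I).card * (gammaCard I * ((Theta I).card * ((I.n + 1) * 1))))) 3 (by omega)
    ((runs_nest4_table (K := 220) hf hM hR₁ ((hfr₁ 2 (by norm_num)).trans h2)
    (fun D rr im' rm => RealIn I rr ∧ (∀ s < (Theta I).card, im' (s + 1) = im (s + 1)) ∧
      rm = σ₀.rmem ∧ im' 0 ≤ I.n ∧ (im' 0 = 0 ∨ im' 0 ∈ D) ∧ ∀ y ∈ D, y ≤ im' 0)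
    (fun s x t u => {y | y = u ∧ thetaAt I f s = 0 ∧ gammaAt I f s x = 0 ∧
      thetaAt I f t = I.dmax ∧ dpValue I I.n (thetaAt I f s) (gammaAt I f s x) (thetaAt I f t) u ≤
        ENNReal.ofReal I.E}) one_pos ?_ ?_ ?_).mono le_rfl ?_)
  · refine ⟨hr, fun s _ => ?_, rfl, ?_, Or.inl ?_, fun y hy => absurd hy (Set.notMem_empty y)⟩
    · simp [hσ₁, hi]
    · simp [hσ₁]
    · simp [hσ₁]
  · rintro D rr im' rm ⟨-, h, -⟩
    exact h
  · rintro D s x t u σ hs hx ht hu hat ⟨i1, i2, i3, i4, i5, i6⟩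
    have hR' := hR₁.of_frame hat.frame (by norm_num)
    have hxl := hx.trans (hf.lt_gammaCap hs)
    have hrow := gammaRow_le hs
    obtain ⟨c1, c2, c3⟩ := cellExp_spec (ek := IExp.reg 0) (es := IExp.reg 8) (ex := IExp.reg 9)
      (et := IExp.reg 10) (eu := IExp.reg 11) hM hR'
      (((hfr₁.trans hat.frame) 2 (by norm_num)).trans h2)
      le_rfl hs hxl ht (Nat.le_of_lt_succ hu) (by simp only [IExp.Safe, hR'.reg0]; omega)
      (by simp only [IExp.Safe, hat.reg8]; omega) (by simp only [IExp.Safe, hat.reg9]; omega)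
      (by simp only [IExp.Safe, hat.reg10]; omega) (by simp only [IExp.Safe, hat.reg11]; omega)
      hR'.reg0 hat.reg8 hat.reg9 hat.reg10 hat.reg11
    have m1 : σ.rmem (2 * I.n + s) = thetaAt I f s := by
      rw [i3]; exact hF.1 _ (by omega)
    have m2 : σ.rmem (2 * I.n + t) = thetaAt I f t := by
      rw [i3]; exact hF.1 _ (by omega)
    have m3 : σ.rmem (gammaBase I + s * gammaCap I + x) = gammaAt I f s x := by
      rw [i3]; exact hF.1 _ (by omega)
    -- The deadlines are sorted, so the last input cell holds the latest one.
    have m4 : σ.rmem (2 * I.n - 1) = I.dmax := by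
      rw [i3, hF.1 _ (by omega), hf.inp _ (by omega), dmax_eq I (by omega)]
      simp only [inp, inputState]
      rw [dif_neg (by omega), dif_pos (show 2 * I.n - 1 - I.n < I.n by omega)]
      congr 3
      omega
    have m5 : σ.rmem (cell I I.n s x t u) =
        encode (dpValue I I.n (thetaAt I f s) (gammaAt I f s x) (thetaAt I f t) u) := by
      rw [i3, hF.2 I.n (Nat.lt_succ_self _) s hs x hx t ht u hu,
        hf.table _ _ _ _ _ hs hxl ht (Nat.le_of_lt_succ hu)]
    have hiff : outTest.Holds σ ↔ (thetaAt I f s = 0 ∧ gammaAt I f s x = 0 ∧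
        thetaAt I f t = I.dmax ∧ dpValue I I.n (thetaAt I f s) (gammaAt I f s x) (thetaAt I f t) u ≤
          ENNReal.ofReal I.E) ∧ σ.imem 0 ≤ u := by
      rw [le_ofReal_iff_encode I.E_nonneg]
      simp only [outTest, BExp.Holds, isEqual_holds, RExp.eval, c2, m5]
      simp only [IExp.eval, hR'.reg1, hR'.reg3, hR'.reg4, hat.reg8, hat.reg9, hat.reg10, hat.reg11,
        m1, m2, m3, m4, Nat.cast_zero, i1.2.1, and_assoc]
    refine Runs.cond 3 (by decide) ?_ (fun hc => ?_) (fun hc => ?_)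
    · have hθ : ∀ e, σ.ireg e < (Theta I).card →
          (RExp.load (IExp.add (IExp.reg 1) (IExp.reg e))).Safe M σ := by
        intro e he
        simp only [RExp.Safe, IExp.Safe, IExp.eval, hR'.reg1]
        omega
      refine ⟨isEqual_safe (hθ 8 (by rwa [hat.reg8])) (Nat.zero_le _), isEqual_safe ?_ (Nat.zero_le _),
        isEqual_safe (hθ 10 (by rwa [hat.reg10])) ?_, ⟨Nat.zero_le _, c1, c3⟩, ⟨⟨c1, c3⟩, trivial⟩,
        ?_⟩
      · simp only [RExp.Safe, IExp.Safe, IExp.eval, hR'.reg3, hR'.reg4, hat.reg8, hat.reg9]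
        constructorm* _ ∧ _ <;> omega
      · simp only [RExp.Safe, IExp.Safe, IExp.eval, hR'.reg1]
        constructorm* _ ∧ _ <;> omega
      · simp only [BExp.Safe, IExp.Safe, IExp.eval, hat.reg11]
        constructorm* _ ∧ _ <;> omega
    · rw [hiff] at hc
      refine Runs.istore (Nat.zero_le _) (show 0 < M by omega)
        (by simp only [IExp.Safe, hat.reg11]; omega) (by decide) ⟨(Frame.refl 12 σ).of_ireg_eq rfl,
        i1, fun s hs => ?_, i3, ?_, Or.inr (Or.inr ?_), ?_⟩
      · rw [← i2 s hs]
        simp [IExp.eval]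
      · simp only [IExp.eval, State.storeI_imem, Function.update_self, hat.reg11]
        omega
      · simp only [IExp.eval, State.storeI_imem, Function.update_self, hat.reg11]
        exact ⟨rfl, hc.1⟩
      · simp only [IExp.eval, State.storeI_imem, Function.update_self, hat.reg11]
        rintro y (hy | hy)
        · exact (i6 y hy).trans hc.2
        · exact hy.1.le
    · rw [hiff] at hc
      refine Runs.skip (by norm_num) ⟨Frame.refl _ _, i1, i2, i3, i4, i5.imp_right Or.inl, ?_⟩
      rintro y (hy | ⟨rfl, hy⟩)
      · exact i6 y hy
      · exact (not_le.1 fun hle => hc ⟨hy, hle⟩).le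
  · rintro σ ⟨hfr, i1, i2, i3, i4, i5, i6⟩
    rw [feasible_eq hf] at i5 i6
    refine Runs.iset (by simp only [IExp.Safe, IExp.eval]; constructorm* _ ∧ _ <;> omega) (by decide)
      ⟨i3, ?_⟩
    rw [State.setI_ireg, Function.update_self]
    refine ⟨?_, fun y hy => i6 y hy⟩
    rcases i5 with h | h
    · show σ.imem 0 ∈ _
      rw [h]
      exact zero_mem_feasible I
    · exact h

/-- States are given by dates and cells by indices; inverses of the array enumerations translate
between them. Different states get different cells because the dates can be read back from the
indices. -/
theorem tableStored_of_filled (hf : IsTarget I im f) {M : ℕ} (hM : numCells I ≤ M) {σ : State}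
    (hF : Filled I im f (I.n + 1) σ.rmem) : TableStored I M σ := by
  let ix : ℝ → ℕ := Function.invFunOn (fun q => f (2 * I.n + q)) (Set.Iio (Theta I).card)
  let iy : ℝ → ℝ → ℕ := fun s => Function.invFunOn
    (fun q => f (gammaBase I + ix s * gammaCap I + q)) (Set.Iio (im (ix s + 1)))
  have hix : ∀ s ∈ Theta I, ix s < (Theta I).card ∧ thetaAt I f (ix s) = s := by
    intro s hs
    have h := hf.theta.surjOn (Finset.mem_coe.2 hs)
    exact ⟨Function.invFunOn_mem h, Function.invFunOn_eq h⟩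
  have hiy : ∀ s ∈ Theta I, ∀ x ∈ Gamma I s, iy s x < im (ix s + 1) ∧
      gammaAt I f (ix s) (iy s x) = x := by
    intro s hs x hx
    have h := (hf.gamma (ix s) (hix s hs).1).surjOn (by
      rw [(hix s hs).2]; exact Finset.mem_coe.2 hx)
    exact ⟨Function.invFunOn_mem h, Function.invFunOn_eq h⟩
  refine ⟨fun q => cell I q.1 (ix q.2.1) (iy q.2.1 q.2.2.1) (ix q.2.2.2.1) q.2.2.2.2, ?_, ?_⟩
  · rintro ⟨k, s, x, t, u⟩ ⟨hk, hs, hx, ht, hu⟩ ⟨k', s', x', t', u'⟩ ⟨hk', hs', hx', ht', hu'⟩ h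
    dsimp only at hk hs hx ht hu hk' hs' hx' ht' hu' h
    obtain ⟨rfl, h1, h2, h3, rfl⟩ := cell_inj (hix s hs).1 (hix s' hs').1
      ((hiy s hs x hx).1.trans (hf.lt_gammaCap (hix s hs).1))
      ((hiy s' hs' x' hx').1.trans (hf.lt_gammaCap (hix s' hs').1)) (hix t ht).1 (hix t' ht').1
      hu hu' h
    have es : s = s' := by rw [← (hix s hs).2, h1, (hix s' hs').2]
    have et : t = t' := by rw [← (hix t ht).2, h3, (hix t' ht').2]
    have ex : x = x' := by rw [← (hiy s hs x hx).2, h1, h2, (hiy s' hs' x' hx').2]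
    rw [es, et, ex]
  · rintro k s x t u ⟨hk, hs, hx, ht, hu⟩
    dsimp only at hk hs hx ht hu ⊢
    have hxl := (hiy s hs x hx).1.trans (hf.lt_gammaCap (hix s hs).1)
    refine ⟨(cell_lt hk (hix s hs).1 hxl (hix t ht).1 hu).trans_le hM, ?_⟩
    rw [hF.2 k (Nat.lt_succ_of_le hk) _ (hix s hs).1 _ (hiy s hs x hx).1 _ (hix t ht).1 u
      (Nat.lt_succ_of_le hu), hf.table _ _ _ _ _ (hix s hs).1 hxl (hix t ht).1 hu, (hix s hs).2,
      (hix t ht).2, (hiy s hs x hx).2]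

end Table

/-- Fixes the final memory before the table is computed: below the table it is the present memory,
hence holds the same arrays, and the table itself is prescribed from them. -/
theorem exists_target {I : Instance} {im : ℕ → ℕ} {rm : ℕ → ℝ} (hm : ∀ a < 2 * I.n, rm a = inp I a)
    (hΘ : Lists rm (2 * I.n) (Theta I).card (Theta I))
    (hΓ : ∀ s < (Theta I).card,
      Lists rm (gammaBase I + s * gammaCap I) (im (s + 1)) (Gamma I (thetaAt I rm s))) :
    ∃ f, IsTarget I im f ∧ Filled I im f 0 rm := by
  obtain ⟨b1, b2, b3, b4, b5, b6⟩ := cap_bounds I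
  obtain ⟨f, hf, hf'⟩ := exists_memory I rm fun k s x t u =>
    encode (dpValue I k (thetaAt I rm s) (gammaAt I rm s x) (thetaAt I rm t) u)
  have hθ : ∀ s < (Theta I).card, thetaAt I f s = thetaAt I rm s := fun s hs => hf _ (by omega)
  have hγ : ∀ s < (Theta I).card, ∀ x < gammaCap I, gammaAt I f s x = gammaAt I rm s x := by
    intro s hs x hx
    have := gammaRow_le hs
    exact hf _ (by omega)
  refine ⟨f, ⟨fun a ha => ?_, hΘ.congr hθ, fun s hs => ?_, fun k s x t u hs hx ht hu => ?_⟩,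
    fun a ha => (hf a ha).symm, fun k hk => absurd hk (Nat.not_lt_zero k)⟩
  · rw [hf a (by omega), hm a ha]
  · rw [hθ s hs]
    refine (hΓ s hs).congr fun q hq => hγ s hs q (hq.trans ?_)
    rw [(hΓ s hs).card_eq]
    exact card_Gamma_lt_gammaCap I _
  · rw [hf' k s x t u hs hx ht hu, hθ s hs, hθ t ht, hγ s hs x hx]

/-- Here `m` is |Θ| and `g` is |Γ|. The last product dominates: `n` layers, `m * g * m * (n + 1)`
entries in each, `m * g * n` choices per entry. Only there is `n + 1` replaced by `2 * n`; elsewhere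
`n + 1 ≤ m` suffices. -/
theorem cost_bounds {n m g P : ℕ} (hn : 0 < n) (hnm : n + 1 ≤ m) (hgp : 0 < g)
    (hP : P = g ^ 2 * m ^ 3 * n ^ 3) :
    1 ≤ P ∧ 2 * n * (2 * n * (n * ((n + 1) * m))) ≤ 8 * P ∧
      m * (2 * n * (2 * n * (n * ((n + 1) * g)))) ≤ 8 * P ∧
      m * (g * (m * ((n + 1) * 1))) ≤ 2 * P ∧
      n * (m * (g * (m * ((n + 1) * (m * (g * n)))))) ≤ 2 * P := by
  have hm : 0 < m := by omega
  have hP1 : 0 < P := by rw [hP]; positivity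
  have hP2 : 2 * n * (2 * n * (n * ((n + 1) * m))) ≤ 8 * P :=
    calc 2 * n * (2 * n * (n * ((n + 1) * m))) = 4 * n ^ 3 * ((n + 1) * m) := by ring
      _ ≤ 4 * n ^ 3 * (m * m) := by gcongr
      _ ≤ 4 * n ^ 3 * (m * m) * (g ^ 2 * m) := Nat.le_mul_of_pos_right _ (by positivity)
      _ = 4 * P := by rw [hP]; ring
      _ ≤ 8 * P := by omega
  have hP3 : m * (2 * n * (2 * n * (n * ((n + 1) * g)))) ≤ 8 * P :=
    calc m * (2 * n * (2 * n * (n * ((n + 1) * g)))) = 4 * n ^ 3 * ((n + 1) * (m * g)) := by ring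
      _ ≤ 4 * n ^ 3 * (m * (m * g)) := by gcongr
      _ ≤ 4 * n ^ 3 * (m * (m * g)) * (g * m) := Nat.le_mul_of_pos_right _ (by positivity)
      _ = 4 * P := by rw [hP]; ring
      _ ≤ 8 * P := by omega
  have hP4 : m * (g * (m * ((n + 1) * 1))) ≤ 2 * P :=
    calc m * (g * (m * ((n + 1) * 1))) ≤ m * (g * (m * (m * 1))) := by gcongr
      _ ≤ m * (g * (m * (m * 1))) * (g * n ^ 3) := Nat.le_mul_of_pos_right _ (by positivity)
      _ = P := by rw [hP]; ring
      _ ≤ 2 * P := by omega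
  have hP5 : n * (m * (g * (m * ((n + 1) * (m * (g * n)))))) ≤ 2 * P :=
    calc n * (m * (g * (m * ((n + 1) * (m * (g * n))))))
        ≤ n * (m * (g * (m * ((2 * n) * (m * (g * n)))))) := by gcongr; omega
      _ = 2 * P := by rw [hP]; ring
  exact ⟨hP1, hP2, hP3, hP4, hP5⟩

/-- The program of the theorem. -/
def mainProg : Prog :=
  Prog.seq setupProg <| Prog.seq thetaProg <| Prog.seq (Prog.iset 2 (IExp.load (IExp.const 0))) <|
  Prog.seq gammaProg <| Prog.seq tableProg outProg

theorem runs_mainProg {I : Instance} {M : ℕ} (hM : numCells I ≤ M) :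
    Runs M mainProg (inputState I)
      (10000 * (gammaCard I ^ 2 * (Theta I).card ^ 3 * I.n ^ 3))
      fun σ => TableStored I M σ ∧ IsGreatest (feasible I) (σ.ireg 0) := by
  obtain ⟨b1, b2, b3, b4, b5, b6⟩ := cap_bounds I
  have hn := I.n_pos
  have hgp := gammaCard_pos I
  have hm : 0 < (Theta I).card := by omega
  obtain ⟨P, hP⟩ : ∃ P, P = gammaCard I ^ 2 * (Theta I).card ^ 3 * I.n ^ 3 := ⟨_, rfl⟩
  obtain ⟨hP1, hP2, hP3, hP4, hP5⟩ := cost_bounds hn b1 hgp hP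
  rw [← hP]
  -- The phases take at most 100, 2400, 3, 2560, 1240 and 620 times `P` steps, which leaves a margin
  -- below 10000.
  refine Runs.seq_le (100 * P) (9900 * P) (by omega)
    ((runs_setupProg hM).mono (by omega) ?_)
  rintro σ₁ ⟨hR₁, hr₁, hi₁, hm₁⟩
  refine Runs.seq_le (2400 * P) (7500 * P) (by omega)
    ((runs_thetaProg hM hR₁ hr₁ hi₁ (fun a _ => by rw [hm₁])).mono (by omega) ?_)
  rintro σ₂ ⟨hf₂, hr₂, hi₂, hm₂, hL₂⟩
  have hcard : σ₂.imem 0 = (Theta I).card := hL₂.card_eq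
  have hR₂ := hR₁.of_frame hf₂ (by norm_num)
  refine Runs.seq_le (3 * P) (7497 * P) (by omega) (Runs.iset (by
    simp only [IExp.Safe, IExp.eval, hcard]; omega) (le_trans (b := 3) (by decide) (by omega)) ?_)
  rw [show IExp.eval σ₂ (IExp.load (IExp.const 0)) = (Theta I).card from hcard]
  rw [hcard] at hL₂
  have hR₃ : Regs I (σ₂.setI 2 (Theta I).card) := ⟨by simpa using hR₂.reg0, by simpa using hR₂.reg1,
    by simpa using hR₂.reg3, by simpa using hR₂.reg4, by simpa using hR₂.reg5, by simpa using hR₂.reg6⟩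
  refine Runs.seq_le (2560 * P) (4937 * P) (by omega)
    ((runs_gammaProg hM hR₃ (by simp) hr₂ hi₂ hm₂ hL₂).mono (by omega) ?_)
  rintro σ₄ ⟨hf₄, hr₄, hm₄, hL₄⟩
  have hR₄ := hR₃.of_frame hf₄ le_rfl
  have h2₄ : σ₄.ireg 2 = (Theta I).card := (hf₄ 2 (by norm_num)).trans (by simp)
  have hθ : ∀ s < (Theta I).card, thetaAt I σ₄.rmem s = σ₂.rmem (2 * I.n + s) := fun s hs => hm₄ _ (by omega)
  obtain ⟨f, hf, hF⟩ := exists_target (I := I) (im := σ₄.imem) (rm := σ₄.rmem)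
    (fun a ha => (hm₄ a (by omega)).trans (hm₂ a ha)) (hL₂.congr hθ)
    (fun s hs => by rw [hθ s hs]; exact hL₄ s hs)
  refine Runs.seq_le (1240 * P) (3697 * P) (by omega)
    ((runs_tableProg hf hM hR₄ h2₄ hr₄ rfl hF).mono (by omega) ?_)
  rintro σ₅ ⟨hf₅, hr₅, hi₅, hF₅⟩
  refine (runs_outProg hf hM (hR₄.of_frame hf₅ le_rfl) ((hf₅ 2 (by norm_num)).trans h2₄) hr₅ hi₅
    hF₅).mono (by omega) ?_
  rintro σ₆ ⟨h6, h6'⟩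
  refine ⟨tableStored_of_filled hf hM ?_, h6'⟩
  rw [h6]
  exact hF₅

/-- The table dominates: two factors `n + 1`, two factors of order `n^4` and one of order `n^3` give
the exponent 13. -/
theorem numCells_le (I : Instance) : numCells I ≤ 2000 * I.n ^ 13 := by
  have hn := I.n_pos
  have hp : ∀ k, k ≤ 13 → I.n ^ k ≤ I.n ^ 13 := fun k hk => Nat.pow_le_pow_right hn hk
  have h0 := hp 0 (by norm_num)
  have h1 := hp 1 (by norm_num)
  have h4 := hp 4 (by norm_num)
  have h7 := hp 7 (by norm_num)
  have hT : thetaCap I ≤ 9 * I.n ^ 4 := by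
    have : 1 ≤ I.n ^ 4 := Nat.pow_pos hn
    unfold thetaCap
    omega
  have hG : gammaCap I ≤ 5 * I.n ^ 3 := by
    have : 1 ≤ I.n ^ 3 := Nat.pow_pos hn
    unfold gammaCap
    omega
  have hn1 : I.n + 1 ≤ 2 * I.n := by omega
  have e1 : thetaCap I * gammaCap I ≤ 45 * I.n ^ 7 :=
    (Nat.mul_le_mul hT hG).trans_eq (by ring)
  have e2 : (I.n + 1) * thetaCap I * gammaCap I * thetaCap I * (I.n + 1) ≤ 1620 * I.n ^ 13 :=
    (Nat.mul_le_mul (Nat.mul_le_mul (Nat.mul_le_mul (Nat.mul_le_mul hn1 hT) hG) hT) hn1).trans_eq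
      (by ring)
  rw [pow_one] at h1
  unfold numCells tableBase gammaBase
  omega

end SpeedScaling

theorem mainTheorem2 :
    ∃ (prog : RealRAM.Prog) (C : ℕ), ∀ I : SpeedScaling.Instance,
      -- size of the candidate sets
      (SpeedScaling.Theta I).card ≤ C * I.n ^ 4 ∧
      SpeedScaling.gammaCard I ≤ C * I.n ^ 3 ∧
      -- the dynamic program computes the minimum energy for every number of jobs
      (∀ u ≤ I.n, SpeedScaling.dpValue I I.n 0 0 I.dmax u =
        SpeedScaling.minEnergy I I.n 0 0 I.dmax u) ∧
      -- the program evaluates it on a machine of size `O(n ^ 13)`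
      ∃ (T : ℕ) (σ : RealRAM.State),
        RealRAM.Exec (C * I.n ^ 13) prog (SpeedScaling.inputState I) T σ ∧
        T ≤ C * (SpeedScaling.gammaCard I ^ 2 * (SpeedScaling.Theta I).card ^ 3 * I.n ^ 3) ∧
        T ≤ C * I.n ^ 21 ∧
        SpeedScaling.TableStored I (C * I.n ^ 13) σ ∧
        -- the output is the objective of the dynamic program, and the optimal throughput
        IsGreatest {u : ℕ | u ≤ I.n ∧
          SpeedScaling.dpValue I I.n 0 0 I.dmax u ≤ ENNReal.ofReal I.E} (σ.ireg 0) ∧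
        IsGreatest (SpeedScaling.throughputs I) (σ.ireg 0) := by
  -- The constant has to exceed 10000 · 4² · 8³ = 81920000, from inserting the sizes of the
  -- candidate sets into the step count; the other bounds need far less.
  refine ⟨SpeedScaling.mainProg, 100000000, fun I => ?_⟩
  have hT := SpeedScaling.card_Theta_le I
  have hG := SpeedScaling.gammaCard_le I
  have hM : SpeedScaling.numCells I ≤ 100000000 * I.n ^ 13 :=
    (SpeedScaling.numCells_le I).trans (Nat.mul_le_mul_right _ (by norm_num))
  obtain ⟨T, σ, h1, h2, h3, h4⟩ := SpeedScaling.runs_mainProg hM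
  refine ⟨hT.trans (Nat.mul_le_mul_right _ (by norm_num)),
    hG.trans (Nat.mul_le_mul_right _ (by norm_num)),
    fun u _ => SpeedScaling.dpValue_eq_minEnergy I u, T, σ, h1,
    h2.trans (Nat.mul_le_mul_right _ (by norm_num)), h2.trans ?_, h3, h4, ?_⟩
  · calc 10000 * (SpeedScaling.gammaCard I ^ 2 * (SpeedScaling.Theta I).card ^ 3 * I.n ^ 3)
        ≤ 10000 * ((4 * I.n ^ 3) ^ 2 * (8 * I.n ^ 4) ^ 3 * I.n ^ 3) := by gcongr
      _ = 81920000 * I.n ^ 21 := by ring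
      _ ≤ 100000000 * I.n ^ 21 := Nat.mul_le_mul_right _ (by norm_num)
  · rw [SpeedScaling.throughputs_eq]
    exact h4
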